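/- **LCL problems.** An LCL problem is a triple $\Pi=(\delta,\Sigma,\mathcal C)$ with an integer $\delta\ge 1$, a finite label set $\Sigma$ and a set $\mathcal C\subseteq\Sigma^{\delta+1}$ of allowed configurations $(a:b_1,\dots,b_\delta)$; $b_1,\dots,b_\delta$ are considered up to order. An input is a finite rooted tree in which every node has exactly $\delta$ or $0$ children; a solution labels its nodes with elements of $\Sigma$ such that every node with children, together with its children, forms (up to the order of the children) an allowed configuration. Round complexity is taken in the deterministic or randomized $\mathsf{LOCAL}$ or $\mathsf{CONGEST}$ model on $n$-node trees: the nodes have ports to their parent and their children, know $n$, and have unique identifiers from $\{1,\dots,n^c\}$ for a constant $c\ge1$; randomized algorithms succeed with probability at least $1-1/n$; in $\mathsf{CONGEST}$ messages have $O(\log n)$ bits. In $O(\cdot)$ and $\Omega(\cdot)$, $n$ tends to infinity through the possible sizes of input trees, and an unsolvable problem counts as having infinite complexity. The size $|\Pi|$ is the length of a description of $\Pi$ as a bit string that lists $\delta$, the labels and the configurations (numbers in unary). **The certificate-builder search.** For $\Sigma'\subseteq\Sigma$ let $\Pi'$ be the restriction of $\Pi$ to configurations that use only labels in $\Sigma'$.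 Start with the collection $R=\{\{\sigma\}:\sigma\in\Sigma'\}$. Repeatedly, for all $(r_1,\dots,r_\delta)\in R^\delta$, add to $R$ the set $\{\sigma : (\sigma:c_1,\dots,c_\delta)\text{ is allowed in }\Pi'\text{ up to order for some } c_i\in r_i\}$ if it is non-empty and not yet in $R$, and record the tuple it came from, until $R$ no longer grows. If $\Sigma'\in R$ and $\Pi'$ has a configuration, the record (a *certificate builder*) is the output for $\Sigma'$. The search on $\Pi$ returns the first certificate builder found over all $\Sigma'\subseteq\Sigma$, and fails if there is none. **Theorem.** Whether an LCL problem $\Pi$ has round complexity $O(\log^* n)$ or $\Omega(\log n)$ can be decided in time at most exponential in the size of $\Pi$, and the certificate-builder search decides it. Precisely: 1. There are a (multi-stack) Turing machine and a polynomial $p$ such that, given the description of any LCL problem $\Pi$, the machine outputs within $2^{p(|\Pi|)}$ steps whether the certificate-builder search on $\Pi$ returns a certificate builder. 2. For every LCL problem $\Pi$, in each of the four models (deterministic or randomized, $\mathsf{LOCAL}$ or $\mathsf{CONGEST}$) and for every $c\ge 1$: the search returns a certificate builder if and only if $\Pi$ has round complexity $O(\log^* n)$, and it fails if and only if $\Pi$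 has round complexity $\Omega(\log n)$. In particular exactly one of the two cases holds. -/

import Mathlib

open MeasureTheory Filter

namespace RootedLCL

/-! ### LCL problems on rooted regular trees -/

/-- An LCL problem with `δ` children: a finite set of labels and a finite set of allowed
configurations `(a : b₁, …, b_δ)` over these labels. -/
structure LCL (δ : ℕ) (L : Type) where
  labels : Finset L
  configs : Finset (L × (Fin δ → L))
  root_mem : ∀ c ∈ configs, c.1 ∈ labels
  child_mem : ∀ c ∈ configs, ∀ i, c.2 i ∈ labels

/-- The configurations are unordered below the root: `(a : b₁, …, b_δ)` is allowed if some
permutation of the children gives an element of `configs`. -/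
def LCL.Allows {δ : ℕ} {L : Type} (P : LCL δ L) (a : L) (b : Fin δ → L) : Prop :=
  ∃ ρ : Equiv.Perm (Fin δ), (a, fun i => b (ρ i)) ∈ P.configs

/-- The restriction of a problem to the labels in `S`. -/
def LCL.restrict {δ : ℕ} {L : Type} [DecidableEq L] (P : LCL δ L) (S : Finset L) : LCL δ L where
  labels := P.labels ∩ S
  configs := P.configs.filter fun c => c.1 ∈ S ∧ ∀ i, c.2 i ∈ S
  root_mem c hc := by
    rw [Finset.mem_filter] at hc
    exact Finset.mem_inter.2 ⟨P.root_mem c hc.1, hc.2.1⟩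
  child_mem c hc i := by
    rw [Finset.mem_filter] at hc
    exact Finset.mem_inter.2 ⟨P.child_mem c hc.1 i, hc.2.2 i⟩

/-- A finite description of an LCL problem: the positive number `δ` of children, the number `k`
of labels (the labels are the elements of `Fin k`), and a list of the allowed configurations. -/
structure Description where
  δ : ℕ
  δ_pos : 0 < δ
  k : ℕ
  configs : List (Fin k × (Fin δ → Fin k))

/-- The problem given by a description. -/
def Description.toLCL (D : Description) : LCL D.δ (Fin D.k) where
  labels := Finset.univ
  configs := D.configs.toFinset
  root_mem _ _ := Finset.mem_univ _
  child_mem _ _ _ := Finset.mem_univ _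

/-- A number as a block of ones followed by a zero. -/
def encodeNumber (m : ℕ) : List Bool := List.replicate m true ++ [false]

/-- The string describing a configuration: its root label and then its child labels. -/
def encodeConfig {δ k : ℕ} (c : Fin k × (Fin δ → Fin k)) : List Bool :=
  encodeNumber c.1 ++ (List.ofFn fun i => encodeNumber (c.2 i)).flatten

/-- The bit string describing a problem: `δ`, `k`, and the configurations one after the other.
Its length, the size of the problem, is polynomially related to
`δ + k + (number of configurations) * (δ + 1)`. -/
def Description.encode (D : Description) : List Bool :=
  encodeNumber D.δ ++ encodeNumber D.k ++ (D.configs.map encodeConfig).flatten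

theorem encodeNumber_append_inj {m m' : ℕ} {s s' : List Bool}
    (h : encodeNumber m ++ s = encodeNumber m' ++ s') : m = m' ∧ s = s' := by
  induction m generalizing m' with
  | zero =>
    cases m' with
    | zero => simpa [encodeNumber] using h
    | succ m' => simp [encodeNumber, List.replicate_succ] at h
  | succ m ih =>
    cases m' with
    | zero => simp [encodeNumber, List.replicate_succ] at h
    | succ m' =>
      have h' : encodeNumber m ++ s = encodeNumber m' ++ s' := by
        simpa [encodeNumber, List.replicate_succ] using h
      obtain ⟨rfl, rfl⟩ := ih h'
      exact ⟨rfl, rfl⟩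

theorem encodeChildren_append_inj {k : ℕ} : ∀ {δ : ℕ} {b b' : Fin δ → Fin k} {s s' : List Bool},
    (List.ofFn fun i => encodeNumber (b i)).flatten ++ s =
      (List.ofFn fun i => encodeNumber (b' i)).flatten ++ s' → b = b' ∧ s = s' := by
  intro δ
  induction δ with
  | zero =>
    intro b b' s s' h
    exact ⟨Subsingleton.elim _ _, by simpa using h⟩
  | succ δ ih =>
    intro b b' s s' h
    simp only [List.ofFn_succ, List.flatten_cons, List.append_assoc] at h
    obtain ⟨h0, h1⟩ := encodeNumber_append_inj h
    obtain ⟨h2, h3⟩ := ih (b := fun i => b i.succ) (b' := fun i => b' i.succ) h1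
    refine ⟨?_, h3⟩
    funext i
    refine Fin.cases (Fin.ext h0) (fun j => congrFun h2 j) i

theorem encodeConfigs_inj {δ k : ℕ} : ∀ {l l' : List (Fin k × (Fin δ → Fin k))},
    (l.map encodeConfig).flatten = (l'.map encodeConfig).flatten → l = l' := by
  intro l
  induction l with
  | nil =>
    intro l' h
    cases l' with
    | nil => rfl
    | cons c l' => simp [encodeConfig, encodeNumber] at h
  | cons c l ih =>
    intro l' h
    cases l' with
    | nil => simp [encodeConfig, encodeNumber] at h
    | cons c' l' =>
      simp only [List.map_cons, List.flatten_cons, encodeConfig, List.append_assoc] at h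
      obtain ⟨h0, h1⟩ := encodeNumber_append_inj h
      obtain ⟨h2, h3⟩ := encodeChildren_append_inj h1
      rw [ih h3, Prod.ext (Fin.ext h0) h2]

/-- Different descriptions have different encodings. -/
theorem Description.encode_injective : Function.Injective Description.encode := by
  rintro ⟨δ, hδ, k, l⟩ ⟨δ', hδ', k', l'⟩ h
  simp only [Description.encode, List.append_assoc] at h
  obtain ⟨h0, h1⟩ := encodeNumber_append_inj h
  obtain ⟨h2, h3⟩ := encodeNumber_append_inj h1
  subst h0 h2
  rw [encodeConfigs_inj h3]

/-! ### Input trees and solutions -/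

/-- A finite rooted tree in which every node has either exactly `δ` or no children. A node is
given by the list of child indices on the path from the node up to the root, so the root is `[]`,
the `i`-th child of `p` is `i :: p`, and the index `i` is the port of the parent. -/
structure FullTree (δ : ℕ) where
  nodes : Finset (List (Fin δ))
  root_mem : [] ∈ nodes
  parent_mem : ∀ i p, i :: p ∈ nodes → p ∈ nodes
  sibling_mem : ∀ i j p, i :: p ∈ nodes → j :: p ∈ nodes

/-- The number of nodes. -/
def FullTree.size {δ : ℕ} (G : FullTree δ) : ℕ := G.nodes.card

/-- A node is a leaf if it has no children. -/
def FullTree.IsLeaf {δ : ℕ} (G : FullTree δ) (v : List (Fin δ)) : Prop :=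
  ∀ i, i :: v ∉ G.nodes

/-- `lam` is a solution on `G`: all nodes have labels of the problem, and at every node that is
not a leaf the label of the node and the labels of its children form an allowed configuration. -/
def LCL.IsSolution {δ : ℕ} {L : Type} (P : LCL δ L) (G : FullTree δ)
    (lam : List (Fin δ) → L) : Prop :=
  (∀ v ∈ G.nodes, lam v ∈ P.labels) ∧
    ∀ v ∈ G.nodes, ¬ G.IsLeaf v → P.Allows (lam v) (fun i => lam (i :: v))

/-! ### Distributed algorithms -/

/-- The initial knowledge of a node, besides the number of nodes and its random bits: its
identifier and which of its ports exist (a parent, `δ` children). -/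
structure NodeInput where
  id : ℕ
  isRoot : Prop
  isLeaf : Prop

/-- A synchronous message-passing algorithm on rooted trees with `δ` children, for a fixed number
of nodes, where every node holds a random string from `R`. The port `none` leads to the parent and
the port `some i` to the `i`-th child. -/
structure DistAlg (δ : ℕ) (L R : Type) where
  State : Type
  Msg : Type
  init : NodeInput → R → State
  send : State → Option (Fin δ) → Msg
  receive : State → (Option (Fin δ) → Option Msg) → State
  output : State → L

/-- The messages that arrive at `v` if every node `u` is in state `s u`. Nothing arrives through
a port that does not exist. -/
def DistAlg.inbox {δ : ℕ} {L R : Type} (A : DistAlg δ L R) (G : FullTree δ)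
    (s : List (Fin δ) → A.State) (v : List (Fin δ)) : Option (Fin δ) → Option A.Msg
  | none =>
    match v with
    | [] => none
    | i :: p => some (A.send (s p) (some i))
  | some i => if i :: v ∈ G.nodes then some (A.send (s (i :: v)) none) else none

/-- The state of every node after `t` rounds. -/
def DistAlg.run {δ : ℕ} {L R : Type} (A : DistAlg δ L R) (G : FullTree δ)
    (ids : List (Fin δ) → ℕ) (rnd : List (Fin δ) → R) : ℕ → List (Fin δ) → A.State
  | 0, v => A.init ⟨ids v, v = [], G.IsLeaf v⟩ (rnd v)
  | t + 1, v =>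
    A.receive (DistAlg.run A G ids rnd t v) (A.inbox G (DistAlg.run A G ids rnd t) v)

/-- The labels that the nodes output after `t` rounds. -/
def DistAlg.result {δ : ℕ} {L R : Type} (A : DistAlg δ L R) (G : FullTree δ)
    (ids : List (Fin δ) → ℕ) (rnd : List (Fin δ) → R) (t : ℕ) (v : List (Fin δ)) : L :=
  A.output (A.run G ids rnd t v)

/-- The messages can be written with at most `b` bits. -/
def DistAlg.HasBandwidth {δ : ℕ} {L R : Type} (A : DistAlg δ L R) (b : ℕ) : Prop :=
  ∃ enc : A.Msg → List Bool, Function.Injective enc ∧ ∀ m, (enc m).length ≤ b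

/-- The nodes have distinct identifiers from `{1, …, n ^ c}`, where `n` is the number of nodes. -/
def ValidIds {δ : ℕ} (c : ℕ) (G : FullTree δ) (ids : List (Fin δ) → ℕ) : Prop :=
  Set.InjOn ids (G.nodes : Set (List (Fin δ))) ∧
    ∀ v ∈ G.nodes, 1 ≤ ids v ∧ ids v ≤ G.size ^ c

/-- The law of a stream of independent fair random bits. -/
noncomputable def coinStream : Measure (ℕ → Bool) :=
  Measure.infinitePi fun _ => (PMF.uniformOfFintype Bool).toMeasure

instance : IsProbabilityMeasure coinStream := by
  unfold coinStream
  infer_instance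

/-- The law of independent streams, one for every node. -/
noncomputable def nodeStreams (δ : ℕ) : Measure (List (Fin δ) → ℕ → Bool) :=
  Measure.infinitePi fun _ => coinStream

/-- Messages of any size, or messages of `O(log n)` bits. -/
inductive Communication
  | localModel
  | congestModel

inductive Randomness
  | deterministic
  | randomized

/-- The restriction that the model puts on a family of algorithms, one for every number `n` of
nodes. -/
def Communication.Permits {δ : ℕ} {L R : Type} (cm : Communication) (A : ℕ → DistAlg δ L R) :
    Prop :=
  match cm with
  | .localModel => True
  | .congestModel => ∃ B : ℕ, ∀ n, (A n).HasBandwidth (B * (Nat.log 2 n + 1))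

/-- `P` can be solved in `T n` rounds on all trees with `n` nodes, for all `n`, in the given model
with identifiers from `{1, …, n ^ c}`. A randomized algorithm has to succeed with probability at
least `1 - 1 / n`. -/
def LCL.SolvableIn {δ : ℕ} {L : Type} (P : LCL δ L) (cm : Communication) (rm : Randomness)
    (c : ℕ) (T : ℕ → ℕ) : Prop :=
  match rm with
  | .deterministic =>
    ∃ A : ℕ → DistAlg δ L Unit, cm.Permits A ∧
      ∀ (G : FullTree δ) (ids : List (Fin δ) → ℕ), ValidIds c G ids →
        P.IsSolution G ((A G.size).result G ids (fun _ => ()) (T G.size))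
  | .randomized =>
    ∃ A : ℕ → DistAlg δ L (ℕ → Bool), cm.Permits A ∧
      ∀ (G : FullTree δ) (ids : List (Fin δ) → ℕ), ValidIds c G ids →
        (∀ v ∈ G.nodes, ∀ a : L,
          MeasurableSet {rnd | (A G.size).result G ids rnd (T G.size) v = a}) ∧
        1 - 1 / (G.size : ℝ) ≤ (nodeStreams δ).real
          {rnd | P.IsSolution G ((A G.size).result G ids rnd (T G.size))}

/-- `n` tends to infinity through the possible numbers of nodes of an input tree. -/
def treeSizes (δ : ℕ) : Filter ℕ := atTop ⊓ 𝓟 {n | ∃ G : FullTree δ, G.size = n}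

/-- The round complexity of `P` is `O(f)`. -/
def LCL.ComplexityO {δ : ℕ} {L : Type} (P : LCL δ L) (cm : Communication) (rm : Randomness)
    (c : ℕ) (f : ℕ → ℝ) : Prop :=
  ∃ T : ℕ → ℕ, P.SolvableIn cm rm c T ∧ (fun n => (T n : ℝ)) =O[treeSizes δ] f

/-- The round complexity of `P` is `Ω(f)`; this includes problems that cannot be solved. -/
def LCL.ComplexityOmega {δ : ℕ} {L : Type} (P : LCL δ L) (cm : Communication) (rm : Randomness)
    (c : ℕ) (f : ℕ → ℝ) : Prop :=
  ∀ T : ℕ → ℕ, P.SolvableIn cm rm c T → f =O[treeSizes δ] (fun n => (T n : ℝ))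

/-- `tower k` is a tower of `k` twos. -/
def tower : ℕ → ℕ
  | 0 => 1
  | k + 1 => 2 ^ tower k

/-- The iterated logarithm: how often `log₂` has to be applied to `n` to get a number at most `1`,
that is, the least `k` with `n ≤ tower k`. -/
noncomputable def logStar (n : ℕ) : ℕ := sInf {k | n ≤ tower k}

/-! ### The search for a certificate builder -/

/-- A set of labels together with an indicator. -/
abbrev Entry (L : Type) := Finset L × Bool

/-- A certificate builder records for every entry the tuple of entries that it came from. -/
abbrev Builder (δ : ℕ) (L : Type) := List (Entry L × (Fin δ → Entry L))

section Search

open scoped Classical in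
/-- The labels `a` that have an allowed configuration `(a : b₁, …, b_δ)` with `bᵢ ∈ r i`. -/
noncomputable def LCL.rootLabels {δ : ℕ} {L : Type} (P : LCL δ L) (r : Fin δ → Finset L) :
    Finset L :=
  P.labels.filter fun a => ∃ b : Fin δ → L, (∀ i, b i ∈ r i) ∧ P.Allows a b

/-- The entry obtained from a tuple of entries. -/
noncomputable def LCL.newEntry {δ : ℕ} {L : Type} (P : LCL δ L) (t : Fin δ → Entry L) : Entry L :=
  (P.rootLabels fun i => (t i).1, decide (∃ i, (t i).2 = true))

open scoped Classical in
/-- One pass through the body of the inner loop, for the tuple `t`. -/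
noncomputable def LCL.processTuple {δ : ℕ} {L : Type} (P : LCL δ L)
    (s : Finset (Entry L) × Builder δ L) (t : Fin δ → Entry L) :
    Finset (Entry L) × Builder δ L :=
  if (P.newEntry t).1 ≠ ∅ ∧ P.newEntry t ∉ s.1 then
    (insert (P.newEntry t) s.1, s.2 ++ [(P.newEntry t, t)])
  else s

/-- One pass through the outer loop: all tuples of entries found before are processed, in some
order. -/
noncomputable def LCL.searchRound {δ : ℕ} {L : Type} (P : LCL δ L)
    (s : Finset (Entry L) × Builder δ L) : Finset (Entry L) × Builder δ L :=
  (Fintype.piFinset fun _ : Fin δ => s.1).toList.foldl P.processTuple s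

open scoped Classical in
/-- The entries at the start: the singletons, with the indicator true at the label `a` only. -/
noncomputable def LCL.startEntries {δ : ℕ} {L : Type} (P : LCL δ L) (a : Option L) :
    Finset (Entry L) :=
  P.labels.image fun σ => ({σ}, decide (some σ = a))

open scoped Classical in
/-- The outer loop is repeated until no entry is added. There are at most `2 ^ (|labels| + 1)`
entries, so this number of passes reaches that point, and further passes change nothing. The
result is a builder if the set of all labels was found (with the indicator true exactly if a label
`a` was prescribed) and there is a configuration at all, and `none` otherwise. -/
noncomputable def LCL.findUnrestrictedCertificate {δ : ℕ} {L : Type} (P : LCL δ L)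
    (a : Option L) : Option (Builder δ L) :=
  let s := P.searchRound^[2 ^ (P.labels.card + 1)] (P.startEntries a, [])
  if (P.labels, a.isSome) ∈ s.1 ∧ P.configs.Nonempty then some s.2 else none

/-- The search runs through all sets of labels and returns the first builder that it finds for a
restriction of the problem to such a set, or `none`. -/
noncomputable def LCL.findCertificate {δ : ℕ} {L : Type} [DecidableEq L] (P : LCL δ L) :
    Option (Builder δ L) :=
  P.labels.powerset.toList.findSome? fun S => (P.restrict S).findUnrestrictedCertificate none

end Search

end RootedLCL

/-! For every set S of labels the search computes the least family of label sets that contains the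
singletons and is closed under passing from sets for the children to the non-empty set of possible
labels of their parent (`Reach`). It succeeds exactly if, for some S, the restriction to S has a
configuration and its family contains S itself (`findCertificate_isSome_iff`).

Success gives O(log* n). A derivation of S unfolds into complete trees of one depth d, one for each
root label in S, all with the same leaf labels (`Reach.commonLeaves`). Suppose that marked nodes are
more than d apart on every root path, but occur within boundedly many ancestors of every deep node.
Labels are assigned from the root downwards, and at a marked node the tree for its present label
begins. After d levels the labels are the common leaf labels, which have forgotten everything above
the marked node; so a label depends on a bounded part of the coloured root path (`SameView.pos_eq`).
The marks come from strict local minima of a colouring with boundedly many colours in which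
ancestors at distance at most d differ, and log* n Cole–Vishkin steps, in parallel for the distances
1, …, d, produce it from the identifiers (`iterate_cvStep_lt_const`). Information flows only from
parents to children, in messages of O(log n) bits, so this runs in deterministic CONGEST, the most
restrictive model (`Certificate.solvable_congest`).

Conversely, let a randomized LOCAL algorithm take t rounds on n nodes, where n exceeds a suitable
exponential in t. Take a tree whose first 4t+3 levels are complete, and make the identifiers there
independent and uniform; collisions are unlikely (`measure_randLabel_fail`). Now labels of distant
nodes are independent, and the law of a label depends only on the last t child indices. Among
geometrically decreasing thresholds there is a gap: a set S of labels each of which has probability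
at least θ at some node, while all other labels are much less likely everywhere
(`reach_of_probable`). In a complete tree of depth 2t+1 the root label is independent of the leaf
labels, whose law does not depend on where the tree sits. Averaging over the leaf patterns gives one
pattern that, for every σ in S, occurs together with root label σ and a correct labelling inside S
(`reach_of_gap`). These trees, read from the leaves upwards, show that the search reaches S
(`reach_of_trees`). So failure of the search forces Ω(log n) even in the least restrictive model. As
log* n = o(log n), the two cases exclude each other, and both implications become equivalences.

For the running time, the search is written in a language of bounded loops in which all numbers stay
below some N = 2^poly. Its programs are translated into programs on stacks of unary numbers, at a
cost polynomial in N (`Ev.exec`, `Run.exec`), and these into a multi-stack Turing machine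
(`StackProg.Exec.leads`). The machine does not imitate the order of the search but computes the same
closure (`Description.exists_good_iff`). -/

namespace RootedLCL

/-! ### Fixed points of inflationary maps -/

/-- An inflationary map whose iterates stay inside `U` reaches a fixed point within `U.card`
iterations. -/
theorem iterate_card_fixed {α : Type*} (f : Finset α → Finset α) (hf : ∀ s, s ⊆ f s)
    (x U : Finset α) (hU : ∀ n, f^[n] x ⊆ U) {m : ℕ} (hm : U.card ≤ m) :
    f (f^[m] x) = f^[m] x := by
  -- Before a fixed point every application adds an element, so cardinalities grow at least as fast
  -- as the number of steps; at `n = m` this exceeds `U.card`.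
  have key : ∀ n, f (f^[n] x) = f^[n] x ∨ n + 1 ≤ (f^[n + 1] x).card := by
    intro n
    induction n with
    | zero =>
      by_cases h : f x = x
      · left; simpa using h
      · right
        have : x ⊂ f x := (hf x).ssubset_of_ne (Ne.symm h)
        have := Finset.card_lt_card this
        simp only [zero_add, Function.iterate_one]
        omega
    | succ n ih =>
      rcases ih with h | h
      · left
        rw [Function.iterate_succ_apply', h, h]
      · by_cases h' : f (f^[n + 1] x) = f^[n + 1] x
        · left; exact h'
        · right
          have : f^[n + 1] x ⊂ f (f^[n + 1] x) := (hf _).ssubset_of_ne (Ne.symm h')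
          have := Finset.card_lt_card this
          rw [Function.iterate_succ_apply']
          omega
  rcases key m with h | h
  · exact h
  · have := Finset.card_le_card (hU (m + 1))
    omega

theorem subset_iterate {α : Type*} (f : Finset α → Finset α) (hf : ∀ s, s ⊆ f s)
    (x : Finset α) (n : ℕ) : x ⊆ f^[n] x := by
  induction n with
  | zero => exact subset_rfl
  | succ n ih =>
    rw [Function.iterate_succ_apply']
    exact ih.trans (hf _)

/-! ### What the search finds -/

/-- The sets of labels that the search can reach. -/
inductive Reach {δ : ℕ} {L : Type} (P : LCL δ L) : Finset L → Prop
  | single (σ : L) (h : σ ∈ P.labels) : Reach P {σ}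
  | step (r : Fin δ → Finset L) (hr : ∀ i, Reach P (r i)) (h : P.rootLabels r ≠ ∅) :
    Reach P (P.rootLabels r)

theorem mem_rootLabels {δ : ℕ} {L : Type} {P : LCL δ L} {r : Fin δ → Finset L} {a : L} :
    a ∈ P.rootLabels r ↔ a ∈ P.labels ∧ ∃ b : Fin δ → L, (∀ i, b i ∈ r i) ∧ P.Allows a b := by
  classical
  unfold LCL.rootLabels
  rw [Finset.mem_filter]

theorem Reach.subset_labels {δ : ℕ} {L : Type} {P : LCL δ L} {S : Finset L} (h : Reach P S) :
    S ⊆ P.labels := by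
  cases h with
  | single σ h => simpa using h
  | step r hr h => exact fun a ha => (mem_rootLabels.1 ha).1

theorem Reach.nonempty {δ : ℕ} {L : Type} {P : LCL δ L} {S : Finset L} (h : Reach P S) :
    S.Nonempty := by
  cases h with
  | single σ h => simp
  | step r hr h => exact Finset.nonempty_iff_ne_empty.2 h

open scoped Classical in
/-- The effect of `LCL.processTuple` on the set of entries. -/
noncomputable def addTuple {δ : ℕ} {L : Type} (P : LCL δ L) (s : Finset (Entry L))
    (t : Fin δ → Entry L) : Finset (Entry L) :=
  if (P.newEntry t).1 ≠ ∅ then insert (P.newEntry t) s else s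

theorem processTuple_fst {δ : ℕ} {L : Type} (P : LCL δ L) (s : Finset (Entry L) × Builder δ L)
    (t : Fin δ → Entry L) : (P.processTuple s t).1 = addTuple P s.1 t := by
  classical
  unfold LCL.processTuple addTuple
  by_cases h1 : (P.newEntry t).1 ≠ ∅ <;> by_cases h2 : P.newEntry t ∈ s.1
  · rw [if_neg (by tauto), if_pos h1, Finset.insert_eq_of_mem h2]
  · rw [if_pos ⟨h1, h2⟩, if_pos h1]
  · rw [if_neg (by tauto), if_neg h1]
  · rw [if_neg (by tauto), if_neg h1]

theorem foldl_processTuple_fst {δ : ℕ} {L : Type} (P : LCL δ L) (l : List (Fin δ → Entry L)) :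
    ∀ s : Finset (Entry L) × Builder δ L,
      (l.foldl P.processTuple s).1 = l.foldl (addTuple P) s.1 := by
  induction l with
  | nil => intro s; rfl
  | cons t l ih =>
    intro s
    rw [List.foldl_cons, List.foldl_cons, ih, processTuple_fst]

open scoped Classical in
theorem mem_foldl_addTuple {δ : ℕ} {L : Type} (P : LCL δ L) (l : List (Fin δ → Entry L)) :
    ∀ (s : Finset (Entry L)) (e : Entry L), e ∈ l.foldl (addTuple P) s ↔
      e ∈ s ∨ ∃ t ∈ l, (P.newEntry t).1 ≠ ∅ ∧ e = P.newEntry t := by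
  induction l with
  | nil => intro s e; simp
  | cons t l ih =>
    intro s e
    rw [List.foldl_cons, ih]
    unfold addTuple
    by_cases h1 : (P.newEntry t).1 ≠ ∅
    · rw [if_pos h1]
      constructor
      · rintro (h | ⟨t', h, h'⟩)
        · rcases Finset.mem_insert.1 h with h | h
          · exact Or.inr ⟨t, by simp, h1, h⟩
          · exact Or.inl h
        · exact Or.inr ⟨t', by simp [h], h'⟩
      · rintro (h | ⟨t', h, h'⟩)
        · exact Or.inl (Finset.mem_insert_of_mem h)
        · rcases List.mem_cons.1 h with rfl | h
          · exact Or.inl (h'.2 ▸ Finset.mem_insert_self _ _)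
          · exact Or.inr ⟨t', h, h'⟩
    · rw [if_neg h1]
      constructor
      · rintro (h | ⟨t', h, h'⟩)
        · exact Or.inl h
        · exact Or.inr ⟨t', by simp [h], h'⟩
      · rintro (h | ⟨t', h, h'⟩)
        · exact Or.inl h
        · rcases List.mem_cons.1 h with rfl | h
          · exact absurd h'.1 h1
          · exact Or.inr ⟨t', h, h'⟩

/-- The effect of `LCL.searchRound` on the set of entries. -/
noncomputable def roundSet {δ : ℕ} {L : Type} (P : LCL δ L) (s : Finset (Entry L)) :
    Finset (Entry L) :=
  (Fintype.piFinset fun _ : Fin δ => s).toList.foldl (addTuple P) s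

theorem mem_roundSet {δ : ℕ} {L : Type} (P : LCL δ L) (s : Finset (Entry L)) (e : Entry L) :
    e ∈ roundSet P s ↔ e ∈ s ∨ ∃ t : Fin δ → Entry L, (∀ i, t i ∈ s) ∧
      (P.newEntry t).1 ≠ ∅ ∧ e = P.newEntry t := by
  unfold roundSet
  rw [mem_foldl_addTuple]
  simp only [Finset.mem_toList, Fintype.mem_piFinset]

theorem searchRound_iterate_fst {δ : ℕ} {L : Type} (P : LCL δ L) (n : ℕ)
    (s : Finset (Entry L) × Builder δ L) :
    (P.searchRound^[n] s).1 = (roundSet P)^[n] s.1 := by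
  induction n with
  | zero => rfl
  | succ n ih =>
    rw [Function.iterate_succ_apply', Function.iterate_succ_apply', ← ih]
    exact foldl_processTuple_fst P _ _

theorem newEntry_false {δ : ℕ} {L : Type} (P : LCL δ L) (t : Fin δ → Entry L)
    (h : ∀ i, (t i).2 = false) : P.newEntry t = (P.rootLabels fun i => (t i).1, false) := by
  unfold LCL.newEntry
  simp [h]

/-- Without a prescribed label all indicators start as `false`, and a new indicator is the
disjunction of old ones; so entries carry no more than their sets. -/
theorem mem_iterate_roundSet {δ : ℕ} {L : Type} (P : LCL δ L) (n : ℕ) (e : Entry L)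
    (he : e ∈ (roundSet P)^[n] (P.startEntries none)) : Reach P e.1 ∧ e.2 = false := by
  classical
  induction n generalizing e with
  | zero =>
    simp only [Function.iterate_zero, id_eq, LCL.startEntries, Finset.mem_image] at he
    obtain ⟨σ, hσ, rfl⟩ := he
    exact ⟨.single σ hσ, by simp⟩
  | succ n ih =>
    rw [Function.iterate_succ_apply', mem_roundSet] at he
    rcases he with he | ⟨t, ht, hne, rfl⟩
    · exact ih e he
    · rw [newEntry_false P t fun i => (ih _ (ht i)).2] at hne ⊢
      exact ⟨.step _ (fun i => (ih _ (ht i)).1) hne, rfl⟩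

/-- The fixed number of passes is at least the number of possible entries, so the final collection
is closed under further passes, and induction on the derivation stays inside it. -/
theorem mem_search_iff {δ : ℕ} {L : Type} (P : LCL δ L) (S : Finset L) :
    (S, false) ∈ (P.searchRound^[2 ^ (P.labels.card + 1)] (P.startEntries none, [])).1 ↔
      Reach P S := by
  classical
  rw [searchRound_iterate_fst]
  constructor
  · exact fun h => (mem_iterate_roundSet P _ _ h).1
  · have hinf : ∀ s, s ⊆ roundSet P s := fun s e he => (mem_roundSet P s e).2 (Or.inl he)
    have hfix := iterate_card_fixed (roundSet P) hinf (P.startEntries none)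
      (P.labels.powerset ×ˢ Finset.univ) (m := 2 ^ (P.labels.card + 1)) (by
        intro n e he
        simp only [Finset.mem_product, Finset.mem_powerset, Finset.mem_univ, and_true]
        exact (mem_iterate_roundSet P n e he).1.subset_labels) (by
        rw [Finset.card_product, Finset.card_powerset, Finset.card_univ, Fintype.card_bool,
          pow_succ])
    intro h
    induction h with
    | single σ h =>
      refine subset_iterate _ hinf _ _ ?_
      simp only [LCL.startEntries, Finset.mem_image]
      exact ⟨σ, h, by simp⟩
    | step r hr h ih =>
      rw [← hfix, mem_roundSet]
      refine Or.inr ⟨fun i => (r i, false), ih, ?_, ?_⟩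
      · rwa [newEntry_false P _ fun i => rfl]
      · rw [newEntry_false P _ fun i => rfl]

theorem restrict_labels_eq {δ : ℕ} {L : Type} [DecidableEq L] (P : LCL δ L) {S : Finset L}
    (h : S ⊆ P.labels) : (P.restrict S).labels = S :=
  Finset.inter_eq_right.2 h

/-- The search succeeds iff some set `S` of labels is reachable for the restriction to `S`. -/
theorem findCertificate_isSome_iff {δ : ℕ} {L : Type} [DecidableEq L] (P : LCL δ L) :
    P.findCertificate.isSome = true ↔
      ∃ S ⊆ P.labels, Reach (P.restrict S) S ∧ (P.restrict S).configs.Nonempty := by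
  unfold LCL.findCertificate
  rw [List.findSome?_isSome_iff]
  constructor
  · rintro ⟨S, hS, h⟩
    rw [Finset.mem_toList, Finset.mem_powerset] at hS
    unfold LCL.findUnrestrictedCertificate at h
    simp only [Option.isSome_none] at h
    split_ifs at h with h'
    · rw [mem_search_iff] at h'
      rw [restrict_labels_eq P hS] at h'
      exact ⟨S, hS, h'⟩
    · simp at h
  · rintro ⟨S, hS, h, hc⟩
    refine ⟨S, by simpa using hS, ?_⟩
    unfold LCL.findUnrestrictedCertificate
    simp only [Option.isSome_none]
    rw [if_pos]
    · rfl
    · rw [mem_search_iff, restrict_labels_eq P hS]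
      exact ⟨h, hc⟩

/-! ### Certificate trees -/

theorem LCL.Allows.mem_labels {δ : ℕ} {L : Type} {P : LCL δ L} {a : L} {b : Fin δ → L}
    (h : P.Allows a b) : a ∈ P.labels ∧ ∀ i, b i ∈ P.labels := by
  obtain ⟨ρ, h⟩ := h
  refine ⟨P.root_mem _ h, fun i => ?_⟩
  simpa using P.child_mem _ h (ρ.symm i)

/-- `T` labels the complete tree of depth `d` (paths are read from the root) correctly, with root
label `a` and the labels `Lf` at depth `d`. -/
structure IsTree {δ : ℕ} {L : Type} (P : LCL δ L) (d : ℕ) (Lf : List (Fin δ) → L) (a : L)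
    (T : List (Fin δ) → L) : Prop where
  root : T [] = a
  leaf : ∀ x, x.length = d → T x = Lf x
  allows : ∀ x, x.length < d → P.Allows (T x) fun i => T (x ++ [i])

/-- All labels in `E` are roots of trees of depth `d` with the same leaf labels. -/
def CommonLeaves {δ : ℕ} {L : Type} (P : LCL δ L) (d : ℕ) (E : Finset L) : Prop :=
  ∃ Lf : List (Fin δ) → L, (∀ x, x.length = d → Lf x ∈ P.labels) ∧
    ∀ a ∈ E, ∃ T, IsTree P d Lf a T

/-- The continuation chosen below a leaf depends only on the label of that leaf, so the new leaf
labels are again common to all trees. -/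
theorem CommonLeaves.succ {δ : ℕ} {L : Type} {P : LCL δ L}
    (hg : ∀ a ∈ P.labels, ∃ b, P.Allows a b) {d : ℕ} {E : Finset L} (h : CommonLeaves P d E) :
    CommonLeaves P (d + 1) E := by
  classical
  obtain ⟨Lf, hLf, hT⟩ := h
  have hg' : ∀ a : L, ∃ b : Fin δ → L, a ∈ P.labels → P.Allows a b := fun a => by
    by_cases ha : a ∈ P.labels
    · obtain ⟨b, hb⟩ := hg a ha
      exact ⟨b, fun _ => hb⟩
    · exact ⟨fun _ => a, fun h => absurd h ha⟩
  choose g hg using hg'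
  set Lf' : List (Fin δ) → L := fun x =>
    if hx : x ≠ [] then g (Lf x.dropLast) (x.getLast hx) else Lf [] with hLf'
  have hLf'_concat : ∀ x i, Lf' (x ++ [i]) = g (Lf x) i := fun x i => by simp [hLf']
  refine ⟨Lf', ?_, ?_⟩
  · intro x hx
    obtain ⟨y, i, rfl⟩ : ∃ y i, x = y ++ [i] := by
      have hx' : x ≠ [] := by rintro rfl; simp at hx
      exact ⟨x.dropLast, x.getLast hx', (List.dropLast_append_getLast hx').symm⟩
    rw [hLf'_concat]
    exact (hg _ (hLf y (by simpa using hx))).mem_labels.2 i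
  · intro a ha
    obtain ⟨T, hT⟩ := hT a ha
    refine ⟨fun x => if x.length = d + 1 then Lf' x else T x, ?_, ?_, ?_⟩
    · simpa using hT.root
    · intro x hx; simp [hx]
    · intro x hx
      rcases Nat.lt_or_ge x.length d with h | h
      · have h1 : x.length ≠ d + 1 := by omega
        have h2 : x.length ≠ d := by omega
        simpa [h1, h2] using hT.allows x h
      · have h1 : x.length = d := by omega
        simp only [h1, List.length_append, List.length_singleton, if_true, hLf'_concat]
        rw [if_neg (by omega), hT.leaf x h1]
        exact hg _ (hLf x h1)

theorem CommonLeaves.mono {δ : ℕ} {L : Type} {P : LCL δ L}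
    (hg : ∀ a ∈ P.labels, ∃ b, P.Allows a b) {d d' : ℕ} (hd : d ≤ d') {E : Finset L}
    (h : CommonLeaves P d E) : CommonLeaves P d' E := by
  induction hd with
  | refl => exact h
  | step _ ih => exact ih.succ hg

/-- In a derivation step the trees for the children are first brought to one depth D and then hung
below the new root. The leaf labels below child i depend only on `r i`, not on the label chosen from
it, so they are common to all roots. -/
theorem Reach.commonLeaves {δ : ℕ} {L : Type} {P : LCL δ L}
    (hg : ∀ a ∈ P.labels, ∃ b, P.Allows a b) {E : Finset L} (h : Reach P E) :
    ∃ d, CommonLeaves P d E := by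
  classical
  induction h with
  | single σ h =>
    refine ⟨0, fun _ => σ, fun _ _ => h, fun a ha => ⟨fun _ => σ, ?_, fun _ _ => rfl, ?_⟩⟩
    · simpa [eq_comm] using ha
    · intro x hx; omega
  | step r hr hne ih =>
    choose d hd using ih
    have hd' : ∀ i, CommonLeaves P (Finset.univ.sup d) (r i) := fun i =>
      (hd i).mono hg (Finset.le_sup (Finset.mem_univ i))
    set D := Finset.univ.sup d
    choose Lf hLf hT using hd'
    obtain ⟨a₀, ha₀⟩ := Finset.nonempty_iff_ne_empty.2 hne
    refine ⟨D + 1, fun x => x.casesOn a₀ fun i y => Lf i y, ?_, ?_⟩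
    · rintro (_ | ⟨i, x⟩) hx
      · simp at hx
      · exact hLf i x (by simpa using hx)
    · intro a ha
      obtain ⟨-, b, hb, hab⟩ := mem_rootLabels.1 ha
      choose T hT using fun i => hT i (b i) (hb i)
      refine ⟨fun x => x.casesOn a fun i y => T i y, rfl, ?_, ?_⟩
      · rintro (_ | ⟨i, x⟩) hx
        · simp at hx
        · exact (hT i).leaf x (by simpa using hx)
      · rintro (_ | ⟨i, x⟩) hx
        · simpa [(hT _).root] using hab
        · exact (hT i).allows x (by simpa using hx)

/-- If the set of all labels came from a derivation step, each label has a configuration by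
construction. Otherwise there is a single label, and the existence of a configuration is needed. -/
theorem Reach.continues {δ : ℕ} {L : Type} {P : LCL δ L} (h : Reach P P.labels)
    (hc : P.configs.Nonempty) : ∀ a ∈ P.labels, ∃ b, P.Allows a b := by
  generalize hE : P.labels = E at h
  cases h with
  | single σ h =>
    obtain ⟨c, hc⟩ := hc
    intro a ha
    have h1 := P.root_mem c hc
    rw [hE] at h1
    rw [Finset.mem_singleton] at ha h1
    exact ⟨c.2, 1, by rw [ha, ← h1]; exact hc⟩
  | step r hr hne =>
    intro a ha
    obtain ⟨-, b, -, hab⟩ := mem_rootLabels.1 ha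
    exact ⟨b, hab⟩

/-- What the upper bound needs from a certificate: for every label a tree of depth `d > 0`
(a node is now the list of indices from the node up to the root), all with the same leaf labels,
and a continuation below every label. -/
structure Certificate {δ : ℕ} {L : Type} (P : LCL δ L) where
  d : ℕ
  d_pos : 0 < d
  leaf : List (Fin δ) → L
  tree : L → List (Fin δ) → L
  cont : L → Fin δ → L
  start : L
  start_mem : start ∈ P.labels
  tree_root : ∀ a ∈ P.labels, tree a [] = a
  tree_leaf : ∀ a ∈ P.labels, ∀ x, x.length = d → tree a x = leaf x
  tree_allows : ∀ a ∈ P.labels, ∀ x, x.length < d →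
    P.Allows (tree a x) fun i => tree a (i :: x)
  cont_allows : ∀ a ∈ P.labels, P.Allows a (cont a)

theorem exists_certificate {δ : ℕ} {L : Type} {P : LCL δ L} (h : Reach P P.labels)
    (hc : P.configs.Nonempty) : Nonempty (Certificate P) := by
  classical
  have hg := h.continues hc
  obtain ⟨d, hd⟩ := h.commonLeaves hg
  -- The extra level makes the depth positive even if the derivation is a single start entry.
  obtain ⟨Lf, hLf, hT⟩ := hd.succ hg
  obtain ⟨s, hs⟩ := h.nonempty
  have hT' : ∀ a, ∃ T, a ∈ P.labels → IsTree P (d + 1) Lf a T := fun a => by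
    by_cases ha : a ∈ P.labels
    · obtain ⟨T, h⟩ := hT a ha
      exact ⟨T, fun _ => h⟩
    · exact ⟨Lf, fun h => absurd h ha⟩
  have hg' : ∀ a : L, ∃ b : Fin δ → L, a ∈ P.labels → P.Allows a b := fun a => by
    by_cases ha : a ∈ P.labels
    · obtain ⟨b, hb⟩ := hg a ha
      exact ⟨b, fun _ => hb⟩
    · exact ⟨fun _ => a, fun h => absurd h ha⟩
  choose T hT using hT'
  choose g hg using hg'
  refine ⟨⟨d + 1, d.succ_pos, fun x => Lf x.reverse, fun a x => T a x.reverse, g, s, hs,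
    fun a ha => (hT a ha).root, fun a ha x hx => (hT a ha).leaf _ (by simpa using hx),
    fun a ha x hx => ?_, hg⟩⟩
  simpa using (hT a ha).allows x.reverse (by simpa using hx)

/-! ### Spacing along root paths -/

/-- Descent: if p is not a strict minimum within distance d, then a position at distance at most d
has a smaller value, since values this close are distinct. Every move lowers the value, so at most N
moves happen, and the margin (N + 1) * d on both sides accommodates them and the final window. -/
theorem exists_strict_local_min (u : ℕ → ℕ) (d A B : ℕ)
    (hu : ∀ a b, a < b → b ≤ a + d → b ≤ B → u a ≠ u b) :
    ∀ N p, u p ≤ N → A + (N + 1) * d ≤ p → p + (N + 1) * d ≤ B →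
      ∃ p', A + d ≤ p' ∧ p' + d ≤ B ∧ ∀ r, r ≤ p' + d → p' ≤ r + d → r ≠ p' → u p' < u r := by
  intro N
  induction N with
  | zero =>
    intro p h0 h1 h2
    refine ⟨p, by omega, by omega, fun r h3 h4 h5 => ?_⟩
    have : u r ≠ u p := by
      rcases Nat.lt_or_gt_of_ne h5 with h | h
      · exact hu r p h h4 (by omega)
      · exact (hu p r h h3 (by omega)).symm
    omega
  | succ N ih =>
    intro p h0 h1 h2
    have e : (N + 1 + 1) * d = (N + 1) * d + d := by ring
    have hpos : d ≤ (N + 1) * d := Nat.le_mul_of_pos_left _ (by omega)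
    by_cases h : ∀ r, r ≤ p + d → p ≤ r + d → r ≠ p → u p < u r
    · exact ⟨p, by omega, by omega, h⟩
    · push Not at h
      obtain ⟨r, h3, h4, h5, h6⟩ := h
      have : u r ≠ u p := by
        rcases Nat.lt_or_gt_of_ne h5 with h | h
        · exact hu r p h h4 (by omega)
        · exact (hu p r h h3 (by omega)).symm
      exact ih r (by omega) (by omega) (by omega)

/-- A node is marked if its ancestor at distance `d` has the smallest colour among the first
`2 * d + 1` nodes on the path to the root. -/
def Marked {δ : ℕ} (d : ℕ) (f : List (Fin δ) → ℕ) (v : List (Fin δ)) : Prop :=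
  2 * d ≤ v.length ∧ ∀ i ≤ 2 * d, i ≠ d → f (v.drop d) < f (v.drop i)

/-- The two minima would be at distance j ≤ d, each inside the window of the other, hence each
strictly smaller than the other. -/
theorem Marked.not_marked_drop {δ d : ℕ} {f : List (Fin δ) → ℕ} {v : List (Fin δ)} {j : ℕ}
    (h : Marked d f v) (hj : 1 ≤ j) (hjd : j ≤ d) : ¬ Marked d f (v.drop j) := by
  rintro ⟨-, h'⟩
  have h1 := h.2 (j + d) (by omega) (by omega)
  have h2 := h' (d - j) (by omega) (by omega)
  rw [List.drop_drop, List.drop_drop, Nat.add_sub_cancel' hjd] at h2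
  omega

/-- The number of ancestors within which a marked node occurs. -/
def reachBound (d q : ℕ) : ℕ := d + 2 * ((q + 1) * d)

theorem exists_marked {δ d q : ℕ} {f : List (Fin δ) → ℕ} {v : List (Fin δ)}
    (hf : ∀ p j, 1 ≤ j → j ≤ d → p + j ≤ v.length → f (v.drop p) ≠ f (v.drop (p + j)))
    (hq : ∀ p, f (v.drop p) < q) (hv : reachBound d q ≤ v.length) :
    ∃ j, d ≤ j ∧ j + 2 * d ≤ reachBound d q ∧ Marked d f (v.drop j) := by
  unfold reachBound at *
  -- The node marked by the minimum at p is d levels below it, at distance p - d. The left end d of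
  -- the interval makes this at least d, so that a complete tree fits between it and v.
  obtain ⟨p, h1, h2, h3⟩ := exists_strict_local_min (fun p => f (v.drop p)) d d
    (d + 2 * ((q + 1) * d)) (by
      intro a b hab hb hB
      have := hf a (b - a) (by omega) (by omega) (by omega)
      rwa [Nat.add_sub_cancel' hab.le] at this) q (d + (q + 1) * d) (hq _).le (by omega) (by omega)
  refine ⟨p - d, by omega, by omega, ?_, ?_⟩
  · rw [List.length_drop]; omega
  · intro i hi hid
    rw [List.drop_drop, List.drop_drop, Nat.sub_add_cancel (by omega)]
    exact h3 _ (by omega) (by omega) (by omega)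

/-! ### Labelling from marked nodes -/

section Labelling

variable {δ : ℕ} {L : Type} {P : LCL δ L} (C : Certificate P)

/-- The position of a node while labels are assigned from the root downwards: in the tree of the
certificate with a given root label, or outside such trees. -/
abbrev Pos (δ : ℕ) (L : Type) := (L × List (Fin δ)) ⊕ L

def Certificate.label : Pos δ L → L
  | .inl (a, x) => C.tree a x
  | .inr a => a

/-- Only the inner nodes of a tree have a position inside it. A node at depth d keeps nothing but
its label, and there the dependence on the root label is lost. -/
def Certificate.next : Pos δ L → Fin δ → Pos δ L
  | .inl (a, x), i => if x.length + 1 = C.d then .inr (C.tree a (i :: x)) else .inl (a, i :: x)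
  | .inr a, i => .inr (C.cont a i)

open scoped Classical in
/-- The positions on the path from the root, where a tree of the certificate starts at every
node in `mk`. -/
noncomputable def Certificate.pos (C : Certificate P) (mk : List (Fin δ) → Prop) : List (Fin δ) → Pos δ L
  | [] => .inr C.start
  | i :: v =>
    if mk (i :: v) then .inl (C.label (C.next (Certificate.pos C mk v) i), [])
    else C.next (Certificate.pos C mk v) i

def Certificate.Good : Pos δ L → Prop
  | .inl (a, x) => a ∈ P.labels ∧ x.length < C.d
  | .inr a => a ∈ P.labels

theorem Certificate.Good.allows {s : Pos δ L} (h : C.Good s) :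
    P.Allows (C.label s) fun i => C.label (C.next s i) := by
  rcases s with ⟨a, x⟩ | a
  · have := C.tree_allows a h.1 x h.2
    have e : (fun i => C.label (C.next (.inl (a, x)) i)) = fun i => C.tree a (i :: x) := by
      funext i
      by_cases hx : x.length + 1 = C.d <;> simp [hx, Certificate.label, Certificate.next]
    rw [e]
    exact this
  · exact C.cont_allows a h

theorem Certificate.Good.label_mem {s : Pos δ L} (h : C.Good s) : C.label s ∈ P.labels :=
  (Certificate.Good.allows C h).mem_labels.1

theorem Certificate.Good.next {s : Pos δ L} (h : C.Good s) (i : Fin δ) : C.Good (C.next s i) := by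
  rcases s with ⟨a, x⟩ | a
  · have h1 := (C.tree_allows a h.1 x h.2).mem_labels.2 i
    unfold Certificate.next
    by_cases hx : x.length + 1 = C.d
    · simpa [hx, Certificate.Good] using h1
    · have h2 := h.2
      simp only [hx, if_false]
      exact ⟨h.1, by simp only [List.length_cons]; omega⟩
  · exact (C.cont_allows a h).mem_labels.2 i

theorem Certificate.good_pos (mk : List (Fin δ) → Prop) (v : List (Fin δ)) :
    C.Good (C.pos mk v) := by
  induction v with
  | nil => exact C.start_mem
  | cons i v ih =>
    rw [Certificate.pos]
    split_ifs
    · exact ⟨Certificate.Good.label_mem C (Certificate.Good.next C ih i), C.d_pos⟩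
    · exact Certificate.Good.next C ih i

/-- Beginning a tree at a node does not change its label, since the tree for a label has that label
at its root. -/
theorem Certificate.label_pos_cons (mk : List (Fin δ) → Prop) (i : Fin δ) (v : List (Fin δ)) :
    C.label (C.pos mk (i :: v)) = C.label (C.next (C.pos mk v) i) := by
  have := Certificate.Good.label_mem C (Certificate.Good.next C (C.good_pos mk v) i)
  rw [Certificate.pos]
  split_ifs
  · exact C.tree_root _ this
  · rfl

/-- Correctness holds for any set of marks, even if trees are cut short by new ones. The spacing of
the marks matters only for locality. -/
theorem Certificate.isSolution (mk : List (Fin δ) → Prop) (G : FullTree δ) :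
    P.IsSolution G fun v => C.label (C.pos mk v) := by
  refine ⟨fun v _ => Certificate.Good.label_mem C (C.good_pos mk v), fun v _ _ => ?_⟩
  simp only [C.label_pos_cons]
  exact Certificate.Good.allows C (C.good_pos mk v)

/-- Two coloured root paths look the same from `v` and `v'` up to distance `K`. -/
def SameView (K : ℕ) (f f' : List (Fin δ) → ℕ) (v v' : List (Fin δ)) : Prop :=
  ∀ j ≤ K, (j ≤ v.length ↔ j ≤ v'.length) ∧ (j ≤ v.length →
    f (v.drop j) = f' (v'.drop j) ∧ (v.drop j).head? = (v'.drop j).head?)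

theorem SameView.length_eq {K : ℕ} {f f' : List (Fin δ) → ℕ} {v v' : List (Fin δ)}
    (h : SameView K f f' v v') (hv : v.length < K) : v'.length = v.length := by
  have h1 := (h v.length hv.le).1
  have h2 := (h (v.length + 1) hv).1
  omega

/-- A mark is decided by 2 * d further ancestors. Either these lie within the common view, or the
view contains the whole root path and p is arbitrary. -/
theorem SameView.marked_iff {K d : ℕ} {f f' : List (Fin δ) → ℕ} {v v' : List (Fin δ)}
    (h : SameView K f f' v v') {p : ℕ} (hp : p + 2 * d ≤ K ∨ v.length < K) :
    Marked d f (v.drop p) ↔ Marked d f' (v'.drop p) := by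
  unfold Marked
  have hlen : 2 * d ≤ (v.drop p).length ↔ 2 * d ≤ (v'.drop p).length := by
    rw [List.length_drop, List.length_drop]
    rcases hp with hp | hp
    · have := (h _ hp).1; omega
    · rw [h.length_eq hp]
  rw [← hlen]
  refine and_congr_right fun h1 => ?_
  rw [List.length_drop] at h1
  have key : ∀ i ≤ 2 * d, f ((v.drop p).drop i) = f' ((v'.drop p).drop i) := by
    intro i hi
    rw [List.drop_drop, List.drop_drop]
    -- For d = 0 the length condition of a mark is void, so p may lie beyond the root, and both
    -- paths then end in the root itself.
    rcases Nat.eq_zero_or_pos d with rfl | hd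
    · obtain rfl : i = 0 := by omega
      by_cases hpv : p ≤ v.length
      · exact ((h (p + 0) (by omega)).2 (by omega)).1
      · rcases hp with hp | hp
        · have := (h p (by omega)).1
          rw [List.drop_eq_nil_of_le (by omega), List.drop_eq_nil_of_le (by omega)]
          have h3 := h.length_eq (by omega)
          have h4 := ((h v.length (by omega)).2 le_rfl).1
          rwa [List.drop_eq_nil_of_le (by omega), List.drop_eq_nil_of_le (by omega)] at h4
        · have h3 := h.length_eq hp
          have h4 := ((h v.length (by omega)).2 le_rfl).1
          rwa [List.drop_eq_nil_of_le (by omega), List.drop_eq_nil_of_le (by omega)] at h4 ⊢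
    · exact ((h (p + i) (by omega)).2 (by omega)).1
  refine forall_congr' fun i => forall_congr' fun hi => ?_
  rw [key i hi, key d (by omega)]

theorem pos_drop {mk : List (Fin δ) → Prop} {v : List (Fin δ)} {p : ℕ} {i : Fin δ}
    (h : (v.drop p).head? = some i) [Decidable (mk (v.drop p))] :
    C.pos mk (v.drop p) = if mk (v.drop p) then
      .inl (C.label (C.next (C.pos mk (v.drop (p + 1))) i), [])
      else C.next (C.pos mk (v.drop (p + 1))) i := by
  have e : v.drop p = i :: v.drop (p + 1) := by
    rw [← List.tail_drop]
    exact List.eq_cons_of_mem_head? h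
  rw [← List.tail_drop] at *
  generalize v.drop p = w at *
  obtain ⟨t, rfl⟩ : ∃ t, w = i :: t := ⟨_, e⟩
  rw [Certificate.pos]
  simp only [List.tail_cons]
  congr

/-- Agreement at the ancestor at distance p is passed down one node at a time, because the child
indices and the marks agree on the way. -/
theorem SameView.pos_eq_of_le {K : ℕ} {f f' : List (Fin δ) → ℕ} {v v' : List (Fin δ)}
    (h : SameView K f f' v v') {p : ℕ} (hpv : p ≤ v.length)
    (hp : p + 2 * C.d ≤ K ∨ v.length < K)
    (h0 : C.pos (Marked C.d f) (v.drop p) = C.pos (Marked C.d f') (v'.drop p)) :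
    C.pos (Marked C.d f) v = C.pos (Marked C.d f') v' := by
  classical
  induction p with
  | zero => simpa using h0
  | succ p ih =>
    refine ih (by omega) (by omega) ?_
    obtain ⟨i, hi⟩ : ∃ i, (v.drop p).head? = some i := by
      rw [List.drop_eq_getElem_cons (by omega : p < v.length)]
      exact ⟨_, rfl⟩
    have hi' := ((h p (by omega)).2 (by omega)).2
    rw [pos_drop C hi, pos_drop C (hi'.symm.trans hi), h0]
    have := h.marked_iff (d := C.d) (p := p) (by omega)
    simp only [this]

theorem pos_of_marked {d : ℕ} {f : List (Fin δ) → ℕ} {v : List (Fin δ)} (hd : 0 < d)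
    (h : Marked d f v) : ∃ a ∈ P.labels, C.pos (Marked d f) v = .inl (a, []) := by
  obtain _ | ⟨i, v⟩ := v
  · have := h.1; simp at this; omega
  · refine ⟨_, ?_, by rw [Certificate.pos, if_pos h]⟩
    exact Certificate.Good.label_mem C (Certificate.Good.next C (C.good_pos _ v) i)

/-- The label of a node depends only on a bounded part of the path to the root. -/
theorem SameView.pos_eq {q : ℕ} {f f' : List (Fin δ) → ℕ} {v v' : List (Fin δ)}
    (h : SameView (reachBound C.d q) f f' v v')
    (hf : ∀ p j, 1 ≤ j → j ≤ C.d → p + j ≤ v.length → f (v.drop p) ≠ f (v.drop (p + j)))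
    (hq : ∀ p, f (v.drop p) < q) :
    C.pos (Marked C.d f) v = C.pos (Marked C.d f') v' := by
  classical
  rcases Nat.lt_or_ge v.length (reachBound C.d q) with hv | hv
  · refine h.pos_eq_of_le C le_rfl (Or.inr hv) ?_
    rw [List.drop_eq_nil_of_le le_rfl, List.drop_eq_nil_of_le (h.length_eq hv).le]
    rfl
  · obtain ⟨j, hdj, hjK, hm⟩ := exists_marked hf hq hv
    have hm' := (h.marked_iff (p := j) (Or.inl hjK)).1 hm
    obtain ⟨a, ha, hpos⟩ := pos_of_marked C C.d_pos hm
    obtain ⟨a', ha', hpos'⟩ := pos_of_marked C C.d_pos hm'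
    have hdp := C.d_pos
    -- On the d levels below the marked ancestor no other tree begins, and both paths turn to the
    -- same children.
    have hstep : ∀ e, e < C.d → ∃ i, ((v.drop (j - (e + 1))).head? = some i ∧
        (v'.drop (j - (e + 1))).head? = some i) ∧
        ¬ Marked C.d f (v.drop (j - (e + 1))) ∧ ¬ Marked C.d f' (v'.drop (j - (e + 1))) := by
      intro e he
      obtain ⟨i, hi⟩ : ∃ i, (v.drop (j - (e + 1))).head? = some i := by
        rw [List.drop_eq_getElem_cons (by omega : j - (e + 1) < v.length)]
        exact ⟨_, rfl⟩
      refine ⟨i, ⟨hi, ?_⟩, ?_, ?_⟩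
      · rw [← hi]
        exact (((h (j - (e + 1)) (by omega)).2 (by omega)).2).symm
      · intro hc
        refine hc.not_marked_drop (j := e + 1) (by omega) (by omega) ?_
        rwa [List.drop_drop, Nat.sub_add_cancel (by omega)]
      · intro hc
        refine hc.not_marked_drop (j := e + 1) (by omega) (by omega) ?_
        rwa [List.drop_drop, Nat.sub_add_cancel (by omega)]
    -- The root labels `a` and `a'` may differ, as they depend on what lies above the view, but the
    -- position x inside the tree is the same.
    have key : ∀ e, e < C.d → ∃ x : List (Fin δ), x.length = e ∧
        C.pos (Marked C.d f) (v.drop (j - e)) = .inl (a, x) ∧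
        C.pos (Marked C.d f') (v'.drop (j - e)) = .inl (a', x) := by
      intro e
      induction e with
      | zero => exact fun _ => ⟨[], rfl, hpos, hpos'⟩
      | succ e ih =>
        intro he
        obtain ⟨x, hx, h1, h2⟩ := ih (by omega)
        obtain ⟨i, ⟨hi, hi'⟩, hn, hn'⟩ := hstep e (by omega)
        refine ⟨i :: x, by simp [hx], ?_, ?_⟩
        · rw [pos_drop C hi, if_neg hn, show j - (e + 1) + 1 = j - e by omega, h1]
          simp only [Certificate.next]
          rw [if_neg (by omega)]
        · rw [pos_drop C hi', if_neg hn', show j - (e + 1) + 1 = j - e by omega, h2]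
          simp only [Certificate.next]
          rw [if_neg (by omega)]
    -- At distance j - d both paths leave their trees at the same leaf, where the certificate has
    -- one label for all roots.
    refine h.pos_eq_of_le C (p := j - C.d) (by omega) (Or.inl (by omega)) ?_
    obtain ⟨x, hx, h1, h2⟩ := key (C.d - 1) (by omega)
    obtain ⟨i, ⟨hi, hi'⟩, hn, hn'⟩ := hstep (C.d - 1) (by omega)
    rw [show C.d - 1 + 1 = C.d by omega] at hi hi' hn hn'
    have e1 : j - C.d + 1 = j - (C.d - 1) := by omega
    rw [pos_drop C hi, if_neg hn, pos_drop C hi', if_neg hn', e1, h1, h2]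
    simp only [Certificate.next]
    rw [if_pos (by omega), if_pos (by omega), C.tree_leaf a ha _ (by simp [hx]; omega),
      C.tree_leaf a' ha' _ (by simp [hx]; omega)]

end Labelling

/-! ### The Cole–Vishkin step -/

/-- The lowest binary digit at which two numbers differ. -/
noncomputable def diffIdx (x y : ℕ) : ℕ := sInf {i | x.testBit i ≠ y.testBit i}

theorem diffIdx_spec {x y : ℕ} (h : x ≠ y) :
    x.testBit (diffIdx x y) ≠ y.testBit (diffIdx x y) :=
  Nat.sInf_mem (s := {i | x.testBit i ≠ y.testBit i}) (Nat.exists_testBit_ne_of_ne h)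

noncomputable def cv (x y : ℕ) : ℕ := 2 * diffIdx x y + (x.testBit (diffIdx x y)).toNat

/-- A node without such an ancestor acts as if it had one whose colour differs from its own in the
lowest digit. -/
def cvRoot (x : ℕ) : ℕ := (x.testBit 0).toNat

/-- Equal new colours would mean equal digit positions and equal digits there, but x and y differ at
that position. -/
theorem cv_ne_cv {x y z : ℕ} (h : x ≠ y) : cv x y ≠ cv y z := by
  intro e
  unfold cv at e
  have h1 := (x.testBit (diffIdx x y)).toNat_le
  have h2 := (y.testBit (diffIdx y z)).toNat_le
  have h3 : diffIdx x y = diffIdx y z := by omega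
  have h4 : (x.testBit (diffIdx x y)).toNat = (y.testBit (diffIdx y z)).toNat := by omega
  rw [← h3] at h4
  have h5 := diffIdx_spec h
  revert h4 h5
  cases x.testBit (diffIdx x y) <;> cases y.testBit (diffIdx x y) <;> simp

theorem cv_ne_cvRoot {x y : ℕ} (h : x ≠ y) : cv x y ≠ cvRoot y := by
  intro e
  unfold cv cvRoot at e
  have h1 := (x.testBit (diffIdx x y)).toNat_le
  have h2 := (y.testBit 0).toNat_le
  have h3 : diffIdx x y = 0 := by omega
  have h5 := diffIdx_spec h
  rw [h3] at e h5
  revert e h5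
  cases x.testBit 0 <;> cases y.testBit 0 <;> simp

/-- Both numbers have only zero digits from position m on, so they differ below m. -/
theorem cv_lt {x y m : ℕ} (h : x ≠ y) (hx : x < 2 ^ m) (hy : y < 2 ^ m) : cv x y < 2 * m := by
  have h1 := (x.testBit (diffIdx x y)).toNat_le
  have h2 : diffIdx x y < m := by
    by_contra hc
    have hp : (2 : ℕ) ^ m ≤ 2 ^ diffIdx x y := Nat.pow_le_pow_right (by norm_num) (by omega)
    refine diffIdx_spec h ?_
    rw [Nat.testBit_lt_two_pow (hx.trans_le hp), Nat.testBit_lt_two_pow (hy.trans_le hp)]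
  unfold cv
  omega

theorem cvRoot_lt {x m : ℕ} (hm : 0 < m) : cvRoot x < 2 * m := by
  have := (x.testBit 0).toNat_le
  unfold cvRoot
  omega

/-- One step of colour reduction, where the ancestor at distance `j` plays the role of the
parent. -/
noncomputable def cvStep {δ : ℕ} (j : ℕ) (x : List (Fin δ) → ℕ) (v : List (Fin δ)) : ℕ :=
  if j ≤ v.length then cv (x v) (x (v.drop j)) else cvRoot (x v)

theorem FullTree.drop_mem {δ : ℕ} (G : FullTree δ) {v : List (Fin δ)} (hv : v ∈ G.nodes) (j : ℕ) :
    v.drop j ∈ G.nodes := by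
  induction j with
  | zero => simpa using hv
  | succ j ih =>
    rw [← List.tail_drop]
    generalize v.drop j = w at ih ⊢
    cases w with
    | nil => exact ih
    | cons i w => exact G.parent_mem i w ih

/-- Nodes at distance `j` on a path to the root have different colours. -/
def ProperAt {δ : ℕ} (G : FullTree δ) (j : ℕ) (x : List (Fin δ) → ℕ) : Prop :=
  ∀ v ∈ G.nodes, j ≤ v.length → x v ≠ x (v.drop j)

theorem ProperAt.cvStep {δ : ℕ} {G : FullTree δ} {j : ℕ} {x : List (Fin δ) → ℕ}
    (h : ProperAt G j x) : ProperAt G j (cvStep j x) := by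
  intro v hv hj
  unfold RootedLCL.cvStep
  rw [if_pos hj]
  split_ifs
  · exact cv_ne_cv (h v hv hj)
  · exact cv_ne_cvRoot (h v hv hj)

theorem cvStep_lt {δ : ℕ} {G : FullTree δ} {j m : ℕ} {x : List (Fin δ) → ℕ}
    (h : ProperAt G j x) (hm : 0 < m) (hx : ∀ v ∈ G.nodes, x v < 2 ^ m) :
    ∀ v ∈ G.nodes, cvStep j x v < 2 * m := by
  intro v hv
  unfold RootedLCL.cvStep
  split_ifs with hj
  · exact cv_lt (h v hv hj) (hx v hv) (hx _ (G.drop_mem hv j))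
  · exact cvRoot_lt hm

theorem ProperAt.iterate {δ : ℕ} {G : FullTree δ} {j : ℕ} {x : List (Fin δ) → ℕ}
    (h : ProperAt G j x) (s : ℕ) : ProperAt G j ((RootedLCL.cvStep j)^[s] x) := by
  induction s with
  | zero => exact h
  | succ s ih => rw [Function.iterate_succ_apply']; exact ih.cvStep

theorem two_mul_le_two_pow {m : ℕ} (hm : 0 < m) : 2 * m ≤ 2 ^ m := by
  obtain ⟨m, rfl⟩ : ∃ k, m = k + 1 := ⟨m - 1, by omega⟩
  have := Nat.lt_two_pow_self (n := m)
  rw [pow_succ]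
  omega

theorem iterate_cvStep_lt {δ : ℕ} {G : FullTree δ} {j m : ℕ} {x : List (Fin δ) → ℕ}
    (h : ProperAt G j x) (hm : 0 < m) (hx : ∀ v ∈ G.nodes, x v < 2 ^ m) (s : ℕ) :
    ∀ v ∈ G.nodes, (cvStep j)^[s] x v < 2 ^ m := by
  induction s with
  | zero => exact hx
  | succ s ih =>
    intro v hv
    rw [Function.iterate_succ_apply']
    exact (cvStep_lt (h.iterate s) hm ih v hv).trans_le (two_mul_le_two_pow hm)

/-! ### The iterated logarithm -/

theorem lt_tower (n : ℕ) : n < tower n := by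
  induction n with
  | zero => simp [tower]
  | succ n ih =>
    rw [tower]
    have := Nat.lt_two_pow_self (n := tower n)
    omega

theorem le_tower_logStar (n : ℕ) : n ≤ tower (logStar n) :=
  Nat.sInf_mem (s := {k | n ≤ tower k}) ⟨n, (lt_tower n).le⟩

theorem logStar_pos {n : ℕ} (hn : 2 ≤ n) : 0 < logStar n := by
  by_contra h
  have := le_tower_logStar n
  rw [Nat.eq_zero_of_not_pos h, tower] at this
  omega

theorem tower_pos (k : ℕ) : 0 < tower k := by
  cases k <;> simp [tower]

/-- Applied with a = c + 3, this makes the factor 2 ^ (c + 3) in the bound for the colours stable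
under a reduction step. -/
theorem succ_mul_two_le_two_pow {a : ℕ} (ha : 3 ≤ a) : 2 * (a + 1) ≤ 2 ^ a := by
  induction ha with
  | refl => norm_num
  | step h ih => rw [pow_succ]; simp only [Nat.succ_eq_add_one] at *; omega

/-- After `logStar n` steps only a constant number of colours is left. -/
theorem iterate_cvStep_lt_const {δ c : ℕ} {G : FullTree δ} {j : ℕ} {x : List (Fin δ) → ℕ}
    (h : ProperAt G j x) (hx : ∀ v ∈ G.nodes, x v ≤ G.size ^ c) :
    ∀ v ∈ G.nodes, (cvStep j)^[logStar G.size] x v < 2 ^ (c + 3) := by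
  set n := G.size
  have hn := le_tower_logStar n
  rcases Nat.eq_zero_or_pos (logStar n) with h0 | h0
  · rw [h0] at hn ⊢
    intro v hv
    have h1 : n ^ c ≤ 1 := (Nat.pow_le_pow_left hn c).trans (by simp [tower])
    have h2 := hx v hv
    have h3 := two_mul_le_two_pow (m := c + 3) (by omega)
    simp only [Function.iterate_zero, id_eq]
    omega
  · obtain ⟨k, hk⟩ : ∃ k, logStar n = k + 1 := ⟨logStar n - 1, by omega⟩
    -- A step turns a bound 2 ^ m into 2 * m. With m = c + 3 + tower l it lowers the tower by one
    -- level and keeps the factor; the first step takes care of the exponent c. At s = k the tower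
    -- is 1.
    have key : ∀ s ≤ k, ∀ v ∈ G.nodes,
        (cvStep j)^[s + 1] x v < 2 ^ (c + 3) * tower (k - s) := by
      intro s
      induction s with
      | zero =>
        intro _ v hv
        have hm : ∀ v ∈ G.nodes, x v < 2 ^ (c * tower k + 1) := by
          intro v hv
          refine (hx v hv).trans_lt ?_
          rw [hk, tower] at hn
          calc n ^ c ≤ (2 ^ tower k) ^ c := Nat.pow_le_pow_left hn c
            _ = 2 ^ (c * tower k) := by rw [← pow_mul, mul_comm]
            _ < 2 ^ (c * tower k + 1) := Nat.pow_lt_pow_right (by norm_num) (by omega)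
        refine (cvStep_lt h (by omega) hm v hv).trans_le ?_
        have h1 := tower_pos k
        have h2 := succ_mul_two_le_two_pow (a := c + 3) (by omega)
        calc 2 * (c * tower k + 1) ≤ 2 * (c + 3 + 1) * tower k := by nlinarith
          _ ≤ 2 ^ (c + 3) * tower (k - 0) := Nat.mul_le_mul_right _ h2
      | succ s ih =>
        intro hs v hv
        obtain ⟨l, hl⟩ : ∃ l, k - s = l + 1 := ⟨k - s - 1, by omega⟩
        have hl' : k - (s + 1) = l := by omega
        have ih' := ih (by omega)
        rw [hl, tower, ← pow_add] at ih'
        rw [Function.iterate_succ_apply', hl']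
        refine (cvStep_lt (h.iterate _) (by omega) ih' v hv).trans_le ?_
        have h1 := tower_pos l
        have h2 := succ_mul_two_le_two_pow (a := c + 3) (by omega)
        calc 2 * (c + 3 + tower l) ≤ 2 * (c + 3 + 1) * tower l := by nlinarith
          _ ≤ 2 ^ (c + 3) * tower l := Nat.mul_le_mul_right _ h2
    intro v hv
    have := key k le_rfl v hv
    rw [hk]
    simpa [tower] using this

/-! ### Simulating algorithms that look at root paths -/

section Simulation

variable {δ K : ℕ} {L Y : Type}

/-- What a node sees of the first `K` ancestors. -/
abbrev Window (δ K : ℕ) (Y : Type) := Fin (K + 1) → Option (Y × Option (Fin δ))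

def win (K : ℕ) (y : List (Fin δ) → Y) (v : List (Fin δ)) : Window δ K Y := fun j =>
  if (j : ℕ) ≤ v.length then some (y (v.drop j), (v.drop j).head?) else none

/-- Repeated recomputation of a value at every node from its window. -/
def evolve (step : Window δ K Y → Y) (y : List (Fin δ) → Y) : ℕ → List (Fin δ) → Y
  | 0 => y
  | s + 1 => fun v => step (win K (evolve step y s) v)

/-- The algorithm that collects windows in `K + 1` rounds and then applies `step`, repeatedly. -/
def windowAlg (step : Window δ K Y → Y) (y : ℕ → Y) (out : Window δ K Y → L) :
    DistAlg δ L Unit where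
  State := ℕ × Y × Window δ K Y
  Msg := Option (Fin δ × Window δ K Y)
  init inp _ := (0, y inp.id, fun _ => none)
  send s port := port.map fun i => (i, s.2.2)
  receive s inbox :=
    let m := (inbox none).join
    -- The parent's window, moved one place up, with the node's own value in front. The index sent
    -- by the parent tells the node which child it is; at the root no message arrives and the rest
    -- stays empty.
    let w : Window δ K Y := Fin.cases (some (s.2.1, m.map Prod.fst))
      fun j => m.bind fun x => x.2 j.castSucc
    (s.1 + 1, if K + 1 ∣ s.1 + 1 then step w else s.2.1, w)
  output s := out s.2.2

/-- The window after a round. -/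
theorem windowAlg_window (step : Window δ K Y → Y) (y : ℕ → Y) (out : Window δ K Y → L)
    (G : FullTree δ) (ids : List (Fin δ) → ℕ) (Z : List (Fin δ) → Y) (τ r : ℕ)
    (h : ∀ v, ((windowAlg step y out).run G ids (fun _ => ()) τ v).2.1 = Z v ∧
      ∀ j : Fin (K + 1), (j : ℕ) < r →
        ((windowAlg step y out).run G ids (fun _ => ()) τ v).2.2 j = win K Z v j)
    (v : List (Fin δ)) (j : Fin (K + 1)) (hj : (j : ℕ) < r + 1) :
    ((windowAlg step y out).run G ids (fun _ => ()) (τ + 1) v).2.2 j = win K Z v j := by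
  rw [DistAlg.run]
  cases v with
  | nil =>
    refine Fin.cases ?_ (fun j => ?_) j
    · simp [windowAlg, DistAlg.inbox, win, ← (h []).1]
    · simp [windowAlg, DistAlg.inbox, win]
  | cons i p =>
    revert hj
    refine Fin.cases (fun _ => ?_) (fun j hj => ?_) j
    · simp [windowAlg, DistAlg.inbox, win, ← (h (i :: p)).1]
    · have := (h p).2 j.castSucc (by simpa using hj)
      simp only [windowAlg, DistAlg.inbox, Option.map_some, Option.join_some, Fin.cases_succ,
        Option.bind_some] at this ⊢
      rw [this]
      simp [win]

/-- Time is cut into blocks of K + 1 rounds. The values are constant during a block, so each of its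
rounds makes one more entry of the window correct. The last round of the block completes the window
and replaces the value; the window is then outdated, and collection begins anew. -/
theorem windowAlg_run (step : Window δ K Y → Y) (y : ℕ → Y) (out : Window δ K Y → L)
    (G : FullTree δ) (ids : List (Fin δ) → ℕ) (s : ℕ) : ∀ r ≤ K, ∀ v,
    ((windowAlg step y out).run G ids (fun _ => ()) ((K + 1) * s + r) v).1 = (K + 1) * s + r ∧
    ((windowAlg step y out).run G ids (fun _ => ()) ((K + 1) * s + r) v).2.1 =
      evolve step (fun v => y (ids v)) s v ∧
    ∀ j : Fin (K + 1), (j : ℕ) < r →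
      ((windowAlg step y out).run G ids (fun _ => ()) ((K + 1) * s + r) v).2.2 j =
        win K (evolve step (fun v => y (ids v)) s) v j := by
  induction s with
  | zero =>
    intro r
    induction r with
    | zero => exact fun _ v => ⟨rfl, rfl, fun j hj => absurd hj (Nat.not_lt_zero _)⟩
    | succ r ih =>
      intro hr v
      have ih' := ih (by omega)
      refine ⟨?_, ?_, fun j hj => ?_⟩
      · rw [← Nat.add_assoc, DistAlg.run]
        exact congrArg (· + 1) (ih' v).1
      · rw [← Nat.add_assoc, DistAlg.run]
        have e := (ih' v).1
        simp only [windowAlg] at e ⊢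
        rw [e, if_neg]
        · exact (ih' v).2.1
        · intro hd
          have := Nat.le_of_dvd (by omega) hd
          omega
      · exact windowAlg_window step y out G ids _ _ r (fun v => (ih' v).2) v j hj
  | succ s ihs =>
    intro r
    induction r with
    | zero =>
      intro _ v
      have ih' := ihs K le_rfl
      have e : (K + 1) * (s + 1) + 0 = (K + 1) * s + K + 1 := by ring
      rw [e]
      refine ⟨?_, ?_, fun j hj => absurd hj (Nat.not_lt_zero _)⟩
      · rw [DistAlg.run]
        exact congrArg (· + 1) (ih' v).1
      · have hw : ((windowAlg step y out).run G ids (fun _ => ()) ((K + 1) * s + K + 1) v).2.2 =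
            win K (evolve step (fun v => y (ids v)) s) v := funext fun j =>
          windowAlg_window step y out G ids _ _ K (fun v => (ih' v).2) v j j.2
        have he : evolve step (fun v => y (ids v)) (s + 1) v =
            step (win K (evolve step (fun v => y (ids v)) s) v) := rfl
        rw [he, ← hw, DistAlg.run]
        have e := (ih' v).1
        simp only [windowAlg] at e ⊢
        rw [e, if_pos]
        exact ⟨s + 1, by ring⟩
    | succ r ih =>
      intro hr v
      have ih' := ih (by omega)
      refine ⟨?_, ?_, fun j hj => ?_⟩
      · rw [← Nat.add_assoc, DistAlg.run]
        exact congrArg (· + 1) (ih' v).1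
      · rw [← Nat.add_assoc, DistAlg.run]
        have e := (ih' v).1
        simp only [windowAlg] at e ⊢
        rw [e, if_neg]
        · exact (ih' v).2.1
        · intro hd
          rw [Nat.add_assoc] at hd
          have := Nat.le_of_dvd (by omega) ((Nat.dvd_add_right ⟨s + 1, rfl⟩).1 hd)
          omega
      · exact windowAlg_window step y out G ids _ _ r (fun v => (ih' v).2) v j hj

/-- One more block than the number of recomputations is needed, to collect the window of the final
values. The output reads only this window, not the value that is recomputed in the same round. -/
theorem windowAlg_result (step : Window δ K Y → Y) (y : ℕ → Y) (out : Window δ K Y → L)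
    (G : FullTree δ) (ids : List (Fin δ) → ℕ) (s : ℕ) (v : List (Fin δ)) :
    (windowAlg step y out).result G ids (fun _ => ()) ((K + 1) * (s + 1)) v =
      out (win K (evolve step (fun v => y (ids v)) s) v) := by
  have e : (K + 1) * (s + 1) = (K + 1) * s + K + 1 := by ring
  have hw : ((windowAlg step y out).run G ids (fun _ => ()) ((K + 1) * s + K + 1) v).2.2 =
      win K (evolve step (fun v => y (ids v)) s) v := funext fun j =>
    windowAlg_window step y out G ids _ _ K
      (fun v => (windowAlg_run step y out G ids s K le_rfl v).2) v j j.2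
  rw [e, ← hw]
  rfl

theorem hasBandwidth_of_card {R : Type} (A : DistAlg δ L R) [Fintype A.Msg] {b : ℕ}
    (h : Fintype.card A.Msg ≤ 2 ^ b) : A.HasBandwidth b := by
  obtain ⟨e⟩ : Nonempty (A.Msg ↪ (Fin b → Bool)) := Function.Embedding.nonempty_of_card_le (by
    simpa using h)
  refine ⟨fun m => List.ofFn (e m), fun m m' h => e.injective (List.ofFn_injective h), fun m => ?_⟩
  simp

/-- Messages are counted: a child index together with K + 1 optional pairs of a value and a child
index, or nothing at all. -/
theorem windowAlg_hasBandwidth [Fintype Y] (step : Window δ K Y → Y) (y : ℕ → Y)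
    (out : Window δ K Y → L) {b : ℕ} (hb : Fintype.card Y ≤ 2 ^ b) :
    (windowAlg step y out).HasBandwidth (δ + (b + δ + 1) * (K + 1) + 1) := by
  have : Fintype (windowAlg step y out).Msg :=
    inferInstanceAs (Fintype (Option (Fin δ × Window δ K Y)))
  refine hasBandwidth_of_card _ ?_
  have e : Fintype.card (windowAlg step y out).Msg =
      δ * (Fintype.card Y * (δ + 1) + 1) ^ (K + 1) + 1 := by
    trans Fintype.card (Option (Fin δ × Window δ K Y))
    · exact Fintype.card_congr (Equiv.refl _)
    · simp [Window]
  rw [e]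
  have h1 : δ + 1 ≤ 2 ^ δ := Nat.lt_two_pow_self
  have h2 : Fintype.card Y * (δ + 1) + 1 ≤ 2 ^ (b + δ + 1) := by
    have h3 : Fintype.card Y * (δ + 1) ≤ 2 ^ (b + δ) := by
      rw [pow_add]; exact Nat.mul_le_mul hb h1
    have := Nat.one_le_two_pow (n := b + δ)
    rw [pow_succ]; omega
  have h4 : δ * (Fintype.card Y * (δ + 1) + 1) ^ (K + 1) ≤ 2 ^ (δ + (b + δ + 1) * (K + 1)) := by
    rw [pow_add 2 δ, pow_mul 2 (b + δ + 1)]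
    exact Nat.mul_le_mul (by omega) (Nat.pow_le_pow_left h2 _)
  have := Nat.one_le_two_pow (n := δ + (b + δ + 1) * (K + 1))
  rw [pow_succ 2]; omega

end Simulation

/-! ### The upper bound -/

section Upper

variable {δ : ℕ} {L : Type} {P : LCL δ L} (C : Certificate P)

/-- All ancestors up to distance `d` have other colours, along the whole path to the root. -/
def ProperPath (d : ℕ) (f : List (Fin δ) → ℕ) (v : List (Fin δ)) : Prop :=
  ∀ p j, 1 ≤ j → j ≤ d → p + j ≤ v.length → f (v.drop p) ≠ f (v.drop (p + j))

open scoped Classical in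
/-- The label that a certificate gives to a node, read off from its window. -/
noncomputable def Certificate.outLabel {q : ℕ} {Y : Type} (f : Y → Fin q)
    (w : Window δ (reachBound C.d q) Y) : L :=
  if h : ∃ yv : (List (Fin δ) → Y) × List (Fin δ),
      ProperPath C.d (fun v => f (yv.1 v)) yv.2 ∧ win (reachBound C.d q) yv.1 yv.2 = w then
    C.label (C.pos (Marked C.d fun v => f (h.choose.1 v)) h.choose.2)
  else C.start

theorem sameView_of_win_eq {K : ℕ} {Y : Type} {y y' : List (Fin δ) → Y} {v v' : List (Fin δ)}
    (h : win K y v = win K y' v') (f : Y → ℕ) :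
    SameView K (fun v => f (y v)) (fun v => f (y' v)) v v' := by
  intro j hj
  have := congrFun h ⟨j, by omega⟩
  unfold win at this
  by_cases h1 : j ≤ v.length <;> by_cases h2 : j ≤ v'.length <;>
    simp only [h1, h2, if_true, if_false, Option.some.injEq, Prod.mk.injEq, reduceCtorEq] at this
  · exact ⟨by tauto, fun _ => ⟨by simp only [this.1], this.2⟩⟩
  · exact ⟨by tauto, fun h => absurd h h1⟩

/-- The coloured path selected by choice need not be the real one, but both have the same window,
which determines the label. -/
theorem Certificate.outLabel_win {q : ℕ} {Y : Type} (f : Y → Fin q) (y : List (Fin δ) → Y)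
    (v : List (Fin δ)) (hv : ProperPath C.d (fun v => f (y v)) v) :
    C.outLabel f (win _ y v) = C.label (C.pos (Marked C.d fun v => f (y v)) v) := by
  have h : ∃ yv : (List (Fin δ) → Y) × List (Fin δ),
      ProperPath C.d (fun v => f (yv.1 v)) yv.2 ∧
        win (reachBound C.d q) yv.1 yv.2 = win (reachBound C.d q) y v := ⟨(y, v), hv, rfl⟩
  unfold Certificate.outLabel
  rw [dif_pos h]
  have hs := sameView_of_win_eq h.choose_spec.2 fun z => (f z : ℕ)
  rw [hs.pos_eq C h.choose_spec.1 fun p => (f _).2]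

variable {d K : ℕ}

/-- The recolouring of a node from its window, for the jumps `1, …, d` in parallel. -/
noncomputable def cvWindow (M : ℕ) [NeZero M] (hK : d ≤ K) (w : Window δ K (Fin d → Fin M)) :
    Fin d → Fin M := fun j =>
  match w 0, w ⟨j + 1, by omega⟩ with
  | some a, some b => Fin.ofNat M (cv (a.1 j) (b.1 j))
  | some a, none => Fin.ofNat M (cvRoot (a.1 j))
  | none, _ => 0

theorem ValidIds.properAt {c : ℕ} {G : FullTree δ} {ids : List (Fin δ) → ℕ}
    (h : ValidIds c G ids) (j : ℕ) (hj : 0 < j) : ProperAt G j ids := by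
  intro v hv hjv e
  have := congrArg List.length (h.1 hv (G.drop_mem hv j) e)
  rw [List.length_drop] at this
  omega

theorem pow_lt_two_pow_log (n c : ℕ) : n ^ c < 2 ^ (c * (Nat.log 2 n + 1) + 1) := by
  have h : n ≤ 2 ^ (Nat.log 2 n + 1) := (Nat.lt_pow_succ_log_self (by norm_num) n).le
  calc n ^ c ≤ (2 ^ (Nat.log 2 n + 1)) ^ c := Nat.pow_le_pow_left h c
    _ = 2 ^ (c * (Nat.log 2 n + 1)) := by rw [← pow_mul, mul_comm]
    _ < 2 ^ (c * (Nat.log 2 n + 1) + 1) := Nat.pow_lt_pow_right (by norm_num) (by omega)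

/-- The reductions modulo 2 ^ m in the finite message alphabet are vacuous, because a reduction step
never leads out of the numbers below 2 ^ m. -/
theorem evolve_cvWindow {c m : ℕ} {G : FullTree δ} {ids : List (Fin δ) → ℕ}
    (h : ValidIds c G ids) (hm : 0 < m) (hM : ∀ v ∈ G.nodes, ids v < 2 ^ m) (hK : d ≤ K) (s : ℕ) :
    ∀ v ∈ G.nodes, ∀ j : Fin d,
      (evolve (cvWindow (δ := δ) (2 ^ m) hK) (fun v _ => Fin.ofNat (2 ^ m) (ids v)) s v j : ℕ) =
        (cvStep (j + 1))^[s] ids v := by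
  induction s with
  | zero =>
    intro v hv j
    exact Nat.mod_eq_of_lt (hM v hv)
  | succ s ih =>
    intro v hv j
    have hp := h.properAt (j + 1) (by omega)
    have hlt := iterate_cvStep_lt hp hm hM (s + 1) v hv
    rw [Function.iterate_succ_apply'] at hlt ⊢
    simp only [evolve]
    generalize evolve (cvWindow (δ := δ) (2 ^ m) hK) (fun v _ => Fin.ofNat (2 ^ m) (ids v)) s = E
      at ih ⊢
    unfold cvWindow
    by_cases hj : (j : ℕ) + 1 ≤ v.length
    · simp only [win, Fin.val_zero, zero_le, if_true, hj, List.drop_zero]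
      rw [ih v hv j, ih _ (G.drop_mem hv _) j]
      simp only [cvStep, hj, if_true] at hlt ⊢
      exact Nat.mod_eq_of_lt hlt
    · simp only [win, Fin.val_zero, zero_le, if_true, hj, List.drop_zero, if_false]
      rw [ih v hv j]
      simp only [cvStep, hj, if_false] at hlt ⊢
      exact Nat.mod_eq_of_lt hlt

/-- The colour tuples, reduced modulo a number `A` of colours and numbered. -/
noncomputable def colourIndex (A : ℕ) [NeZero A] {M : ℕ} (y : Fin d → Fin M) :
    Fin (Fintype.card (Fin d → Fin A)) :=
  Fintype.equivFin (Fin d → Fin A) fun j => Fin.ofNat A (y j)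

theorem IsSolution.congr {G : FullTree δ} {lam lam' : List (Fin δ) → L}
    (h : ∀ v ∈ G.nodes, lam v = lam' v) (hs : P.IsSolution G lam') : P.IsSolution G lam := by
  refine ⟨fun v hv => h v hv ▸ hs.1 v hv, fun v hv hl => ?_⟩
  have hc : ∀ i, i :: v ∈ G.nodes := by
    unfold FullTree.IsLeaf at hl
    push Not at hl
    obtain ⟨i, hi⟩ := hl
    exact fun j => G.sibling_mem i j v hi
  rw [h v hv, show (fun i => lam (i :: v)) = fun i => lam' (i :: v) from
    funext fun i => h _ (hc i)]
  exact hs.2 v hv hl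

theorem Certificate.solvable_congest (C : Certificate P) (c : ℕ) :
    ∃ K, P.SolvableIn .congestModel .deterministic c fun n => (K + 1) * (logStar n + 1) := by
  set A := 2 ^ (c + 3) with hA
  set q := Fintype.card (Fin C.d → Fin A) with hq
  have hK : C.d ≤ reachBound C.d q := by unfold reachBound; omega
  -- Enough binary digits for identifiers up to n ^ c, and still O(log n).
  set m : ℕ → ℕ := fun n => c * (Nat.log 2 n + 1) + 1 with hm
  refine ⟨reachBound C.d q, fun n => windowAlg (cvWindow (2 ^ m n) hK)
    (fun i _ => Fin.ofNat (2 ^ m n) i) (C.outLabel (colourIndex A)), ?_, ?_⟩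
  · refine ⟨δ + ((c + 1) * C.d + δ + 1) * (reachBound C.d q + 1) + 1, fun n => ?_⟩
    have hb := windowAlg_hasBandwidth (cvWindow (2 ^ m n) hK)
      (fun i _ => Fin.ofNat (2 ^ m n) i) (C.outLabel (colourIndex A)) (b := m n * C.d) (by
        simp [pow_mul])
    obtain ⟨enc, he, hl⟩ := hb
    refine ⟨enc, he, fun x => (hl x).trans ?_⟩
    generalize reachBound C.d q + 1 = R
    have h1 : m n ≤ (c + 1) * (Nat.log 2 n + 1) := by simp only [hm]; nlinarith
    obtain ⟨l, hl, hl1⟩ : ∃ l, Nat.log 2 n + 1 = l ∧ 1 ≤ l := ⟨_, rfl, by omega⟩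
    rw [hl] at h1 ⊢
    generalize m n = x at h1 ⊢
    calc δ + (x * C.d + δ + 1) * R + 1
        ≤ δ * l + ((c + 1) * l * C.d + δ * l + l) * R + l := by gcongr <;> nlinarith
      _ = (δ + ((c + 1) * C.d + δ + 1) * R + 1) * l := by ring
  · intro G ids hids
    refine IsSolution.congr (fun v hv => ?_) (C.isSolution (Marked C.d fun v =>
      colourIndex A (evolve (cvWindow (2 ^ m G.size) hK)
        (fun v _ => Fin.ofNat (2 ^ m G.size) (ids v)) (logStar G.size) v)) G)
    rw [windowAlg_result, C.outLabel_win]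
    intro p j hj hjd hpj
    simp only [← List.drop_drop]
    have hw := G.drop_mem hv p
    have hjw : j ≤ (v.drop p).length := by rw [List.length_drop]; omega
    generalize v.drop p = w at hw hjw ⊢
    have hM : ∀ v ∈ G.nodes, ids v < 2 ^ m G.size := fun v hv =>
      (hids.2 v hv).2.trans_lt (pow_lt_two_pow_log _ _)
    intro e
    -- Equal tuples agree in coordinate j - 1, which comes from the reduction with jump j and
    -- separates nodes at distance j.
    have e1 := congrFun ((Fintype.equivFin (Fin C.d → Fin A)).injective (Fin.ext e))
      ⟨j - 1, by omega⟩
    have e2 := congrArg Fin.val e1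
    simp only [Fin.val_ofNat] at e2
    have hp := hids.properAt j (by omega)
    rw [evolve_cvWindow hids (Nat.succ_pos _) hM hK _ w hw,
      evolve_cvWindow hids (Nat.succ_pos _) hM hK _ _
      (G.drop_mem hw j)] at e2
    simp only [Nat.sub_add_cancel hj] at e2
    have hc := iterate_cvStep_lt_const hp fun v hv => (hids.2 v hv).2
    rw [Nat.mod_eq_of_lt (hc w hw), Nat.mod_eq_of_lt (hc _ (G.drop_mem hw j))] at e2
    exact hp.iterate _ w hw hjw e2

end Upper

/-! ### Comparison of the four models: deterministic CONGEST is the most restrictive, randomized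
LOCAL the least. -/

theorem solvableIn_of_congest {δ : ℕ} {L : Type} {P : LCL δ L} {rm : Randomness} {c : ℕ}
    {T : ℕ → ℕ} (h : P.SolvableIn .congestModel rm c T) (cm : Communication) :
    P.SolvableIn cm rm c T := by
  cases cm with
  | congestModel => exact h
  | localModel =>
    cases rm with
    | deterministic => exact h.imp fun A hA => ⟨trivial, hA.2⟩
    | randomized => exact h.imp fun A hA => ⟨trivial, hA.2⟩

theorem solvableIn_local {δ : ℕ} {L : Type} {P : LCL δ L} {cm : Communication} {rm : Randomness}
    {c : ℕ} {T : ℕ → ℕ} (h : P.SolvableIn cm rm c T) : P.SolvableIn .localModel rm c T := by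
  cases rm with
  | deterministic => exact h.imp fun A hA => ⟨trivial, hA.2⟩
  | randomized => exact h.imp fun A hA => ⟨trivial, hA.2⟩

/-- A deterministic algorithm as a randomized algorithm that ignores its random bits. -/
def DistAlg.randomize {δ : ℕ} {L : Type} (A : DistAlg δ L Unit) (R : Type) : DistAlg δ L R where
  State := A.State
  Msg := A.Msg
  init inp _ := A.init inp ()
  send := A.send
  receive := A.receive
  output := A.output

theorem DistAlg.randomize_run {δ : ℕ} {L R : Type} (A : DistAlg δ L Unit) (G : FullTree δ)
    (ids : List (Fin δ) → ℕ) (rnd : List (Fin δ) → R) (t : ℕ) :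
    (A.randomize R).run G ids rnd t = A.run G ids (fun _ => ()) t := by
  induction t with
  | zero => rfl
  | succ t ih =>
    funext v
    rw [DistAlg.run, DistAlg.run, ih]
    rfl

instance (δ : ℕ) : IsProbabilityMeasure (nodeStreams δ) := by
  unfold nodeStreams
  infer_instance

theorem solvableIn_randomized {δ : ℕ} {L : Type} {P : LCL δ L} {cm : Communication} {c : ℕ}
    {T : ℕ → ℕ} (h : P.SolvableIn cm .deterministic c T) : P.SolvableIn cm .randomized c T := by
  obtain ⟨A, hA, hs⟩ := h
  refine ⟨fun n => (A n).randomize _, ?_, fun G ids hids => ?_⟩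
  · cases cm with
    | localModel => trivial
    | congestModel => exact hA
  · have e : ∀ rnd : List (Fin δ) → ℕ → Bool, ((A G.size).randomize _).result G ids rnd (T G.size) =
        (A G.size).result G ids (fun _ => ()) (T G.size) := fun rnd => funext fun v => by
      unfold DistAlg.result
      rw [DistAlg.randomize_run]
      rfl
    simp only [e]
    refine ⟨fun v hv a => MeasurableSet.const _, ?_⟩
    simp only [hs G ids hids, Set.ofPred_true, probReal_univ]
    have : (0 : ℝ) ≤ 1 / G.size := by positivity
    linarith

theorem solvableIn_of_strongest {δ : ℕ} {L : Type} {P : LCL δ L} {c : ℕ} {T : ℕ → ℕ}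
    (h : P.SolvableIn .congestModel .deterministic c T) (cm : Communication) (rm : Randomness) :
    P.SolvableIn cm rm c T := by
  cases rm with
  | deterministic => exact solvableIn_of_congest h cm
  | randomized => exact solvableIn_randomized (solvableIn_of_congest h cm)

theorem solvableIn_weakest {δ : ℕ} {L : Type} {P : LCL δ L} {c : ℕ} {T : ℕ → ℕ}
    {cm : Communication} {rm : Randomness} (h : P.SolvableIn cm rm c T) :
    P.SolvableIn .localModel .randomized c T := by
  cases rm with
  | deterministic => exact solvableIn_randomized (solvableIn_local h)
  | randomized => exact solvableIn_local h

/-- A labelling with labels of a restricted problem also solves the problem itself. -/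
theorem allows_of_restrict {δ : ℕ} {L : Type} [DecidableEq L] {P : LCL δ L} {S : Finset L} {a : L}
    {b : Fin δ → L} (h : (P.restrict S).Allows a b) : P.Allows a b := by
  obtain ⟨ρ, h⟩ := h
  exact ⟨ρ, (Finset.mem_filter.1 h).1⟩

theorem SolvableIn.of_restrict {δ : ℕ} {L : Type} [DecidableEq L] {P : LCL δ L} {S : Finset L}
    {cm : Communication} {c : ℕ} {T : ℕ → ℕ}
    (h : (P.restrict S).SolvableIn cm .deterministic c T) : P.SolvableIn cm .deterministic c T := by
  obtain ⟨A, hA, hs⟩ := h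
  refine ⟨A, hA, fun G ids hids => ⟨fun v hv => ?_, fun v hv hl => ?_⟩⟩
  · exact (Finset.mem_inter.1 ((hs G ids hids).1 v hv)).1
  · exact allows_of_restrict ((hs G ids hids).2 v hv hl)

theorem eventually_treeSizes {δ : ℕ} {p : ℕ → Prop} (h : ∀ᶠ n in atTop, p n) :
    ∀ᶠ n in treeSizes δ, p n :=
  h.filter_mono inf_le_left

theorem complexityO_of_isSome {δ : ℕ} {L : Type} [DecidableEq L] (P : LCL δ L)
    (h : P.findCertificate.isSome = true) (cm : Communication) (rm : Randomness) (c : ℕ) :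
    P.ComplexityO cm rm c fun n => (logStar n : ℝ) := by
  obtain ⟨S, hS, hR, hc⟩ := (findCertificate_isSome_iff P).1 h
  have hR' : Reach (P.restrict S) (P.restrict S).labels := by rwa [restrict_labels_eq P hS]
  obtain ⟨C⟩ := exists_certificate hR' hc
  obtain ⟨K, hK⟩ := C.solvable_congest c
  refine ⟨_, solvableIn_of_strongest (SolvableIn.of_restrict hK) cm rm, ?_⟩
  refine Asymptotics.IsBigO.of_bound (2 * (K + 1)) (eventually_treeSizes ?_)
  filter_upwards [eventually_ge_atTop 2] with n hn
  have h1 : (1 : ℝ) ≤ logStar n := by exact_mod_cast logStar_pos hn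
  rw [Real.norm_of_nonneg (by positivity), Real.norm_of_nonneg (by positivity)]
  push_cast
  nlinarith [show (0 : ℝ) ≤ K by positivity]

/-! ### Trees of a given size that contain a complete tree -/

/-- The lists of length at most `H`. -/
noncomputable def listsLE (δ H : ℕ) : Finset (List (Fin δ)) :=
  (List.finite_length_le (Fin δ) H).toFinset

theorem mem_listsLE {δ H : ℕ} {v : List (Fin δ)} : v ∈ listsLE δ H ↔ v.length ≤ H := by
  simp [listsLE]

theorem card_listsLE_le (δ H : ℕ) : (listsLE δ H).card ≤ (δ + 1) ^ (H + 1) := by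
  have : (listsLE δ H).card ≤ (Finset.univ : Finset (Fin (H + 1) → Option (Fin δ))).card := by
    refine Finset.card_le_card_of_injOn (fun v i => v[(i : ℕ)]?) (fun _ _ => Finset.mem_univ _) ?_
    intro v hv w hw h
    have hv' := mem_listsLE.1 hv
    have hw' := mem_listsLE.1 hw
    refine List.ext_getElem? fun i => ?_
    rcases Nat.lt_or_ge i (H + 1) with hi | hi
    · exact congrFun h ⟨i, hi⟩
    · rw [List.getElem?_eq_none (by omega), List.getElem?_eq_none (by omega)]
  simpa using this

/-- The complete tree of depth `H`. -/
noncomputable def completeTree (δ H : ℕ) : FullTree δ where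
  nodes := listsLE δ H
  root_mem := by simp [mem_listsLE]
  parent_mem i p h := by
    rw [mem_listsLE, List.length_cons] at *
    omega
  sibling_mem i j p h := by
    rw [mem_listsLE, List.length_cons] at *
    omega

theorem FullTree.exists_isLeaf {δ : ℕ} (G : FullTree δ) : ∃ v ∈ G.nodes, G.IsLeaf v := by
  obtain ⟨v, hv, hmax⟩ := G.nodes.exists_max_image List.length ⟨[], G.root_mem⟩
  refine ⟨v, hv, fun i hi => ?_⟩
  have := hmax _ hi
  simp at this

/-- A leaf receives all its δ children. -/
theorem FullTree.exists_grow {δ : ℕ} (G : FullTree δ) :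
    ∃ G' : FullTree δ, G.nodes ⊆ G'.nodes ∧ G'.size = G.size + δ := by
  classical
  obtain ⟨v, hv, hl⟩ := G.exists_isLeaf
  refine ⟨⟨G.nodes ∪ Finset.univ.image (· :: v), ?_, ?_, ?_⟩, Finset.subset_union_left, ?_⟩
  · exact Finset.mem_union_left _ G.root_mem
  · intro i p h
    simp only [Finset.mem_union, Finset.mem_image, Finset.mem_univ, true_and, List.cons.injEq,
      exists_eq_left] at h
    rcases h with h | h
    · exact Finset.mem_union_left _ (G.parent_mem i p h)
    · exact Finset.mem_union_left _ (h ▸ hv)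
  · intro i j p h
    simp only [Finset.mem_union, Finset.mem_image, Finset.mem_univ, true_and, List.cons.injEq,
      exists_eq_left] at h ⊢
    rcases h with h | h
    · exact Or.inl (G.sibling_mem i j p h)
    · exact Or.inr h
  · unfold FullTree.size
    simp only
    rw [Finset.card_union_of_disjoint, Finset.card_image_of_injective, Finset.card_univ,
      Fintype.card_fin]
    · intro i j h
      simpa using h
    · rw [Finset.disjoint_left]
      intro w hw hw'
      obtain ⟨i, -, rfl⟩ := Finset.mem_image.1 hw'
      exact hl i hw

/-- Every node except the root is one of the δ children of a unique inner node. -/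
theorem FullTree.size_eq {δ : ℕ} (G : FullTree δ) : ∃ m, G.size = 1 + m * δ := by
  classical
  set I := G.nodes.filter fun v => ∃ i, i :: v ∈ G.nodes with hI
  have h : G.nodes.erase [] = (I ×ˢ (Finset.univ : Finset (Fin δ))).image fun x => x.2 :: x.1 := by
    ext v
    simp only [Finset.mem_erase, Finset.mem_image, Finset.mem_product, Finset.mem_univ, and_true,
      Prod.exists]
    constructor
    · rintro ⟨h1, h2⟩
      cases v with
      | nil => exact absurd rfl h1
      | cons i v =>
        exact ⟨v, i, Finset.mem_filter.2 ⟨G.parent_mem i v h2, i, h2⟩, rfl⟩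
    · rintro ⟨w, i, hw, rfl⟩
      obtain ⟨j, hj⟩ := (Finset.mem_filter.1 hw).2
      exact ⟨by simp, G.sibling_mem j i w hj⟩
  have h2 := congrArg Finset.card h
  rw [Finset.card_image_of_injective, Finset.card_product, Finset.card_univ, Fintype.card_fin,
    Finset.card_erase_of_mem G.root_mem] at h2
  · have : 0 < G.nodes.card := Finset.card_pos.2 ⟨_, G.root_mem⟩
    exact ⟨I.card, by unfold FullTree.size; omega⟩
  · rintro ⟨v, i⟩ ⟨w, j⟩ h
    simp only [List.cons.injEq] at h
    exact Prod.ext h.2 h.1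

/-- Every possible size that is large enough is the size of a tree whose first levels are
complete. -/
theorem exists_tree_containing {δ : ℕ} (hδ : 0 < δ) (G₀ : FullTree δ) (H : ℕ)
    (h : (listsLE δ H).card ≤ G₀.size) :
    ∃ G : FullTree δ, G.size = G₀.size ∧ listsLE δ H ⊆ G.nodes := by
  obtain ⟨m, hm⟩ := G₀.size_eq
  obtain ⟨m', hm'⟩ := (completeTree δ H).size_eq
  have hc : (completeTree δ H).size = (listsLE δ H).card := rfl
  have hle : m' ≤ m := by
    by_contra hlt
    have : m * δ < m' * δ := Nat.mul_lt_mul_of_pos_right (by omega) hδ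
    omega
  obtain ⟨e, rfl⟩ := Nat.exists_eq_add_of_le hle
  rw [hm]
  clear hm hle h hc
  have : ∀ e, ∃ G : FullTree δ, G.size = 1 + (m' + e) * δ ∧ listsLE δ H ⊆ G.nodes := by
    intro e
    induction e with
    | zero => exact ⟨completeTree δ H, by simpa using hm', subset_rfl⟩
    | succ e ih =>
      obtain ⟨G, h1, h2⟩ := ih
      obtain ⟨G', h3, h4⟩ := G.exists_grow
      exact ⟨G', by rw [h4, h1]; ring, h2.trans h3⟩
  exact this e

/-! ### Locality -/

/-- The state of a node after `t` rounds depends only on the `t`-neighbourhood. -/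
theorem DistAlg.run_congr {δ : ℕ} {L R : Type} (A : DistAlg δ L R) (G : FullTree δ)
    {ids ids' : List (Fin δ) → ℕ} {rnd rnd' : List (Fin δ) → R} {q q' : List (Fin δ)} {b : ℕ}
    (hq : q ≠ []) (hq' : q' ≠ [])
    (hG : ∀ u : List (Fin δ), u.length ≤ b → ∀ i, i :: (u ++ q) ∈ G.nodes)
    (hG' : ∀ u : List (Fin δ), u.length ≤ b → ∀ i, i :: (u ++ q') ∈ G.nodes)
    (hδ : 0 < δ)
    (hids : ∀ u : List (Fin δ), u.length ≤ b → ids (u ++ q) = ids' (u ++ q'))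
    (hrnd : ∀ u : List (Fin δ), u.length ≤ b → rnd (u ++ q) = rnd' (u ++ q')) (t : ℕ) :
    ∀ u : List (Fin δ), t ≤ u.length → u.length + t ≤ b →
      A.run G ids rnd t (u ++ q) = A.run G ids' rnd' t (u ++ q') := by
  induction t with
  | zero =>
    intro u _ hu
    rw [DistAlg.run, DistAlg.run, hids u hu, hrnd u hu]
    -- No node of the region is a root or a leaf, so the initial knowledge is the same apart from
    -- identifiers and random bits.
    have h1 : ¬ G.IsLeaf (u ++ q) := fun h => h ⟨0, hδ⟩ (hG u hu _)
    have h2 : ¬ G.IsLeaf (u ++ q') := fun h => h ⟨0, hδ⟩ (hG' u hu _)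
    simp [hq, hq', h1, h2]
  | succ t ih =>
    intro u hu hub
    rw [DistAlg.run, DistAlg.run, ih u (by omega) (by omega)]
    congr 1
    funext port
    cases port with
    | none =>
      cases u with
      -- The depth of u below q is at least the number of rounds, so information from above q cannot
      -- arrive.
      | nil => simp at hu
      | cons i u =>
        simp only [List.length_cons] at hu hub
        simp only [DistAlg.inbox, List.cons_append]
        rw [ih u (by omega) (by omega)]
    | some i =>
      simp only [DistAlg.inbox]
      rw [if_pos (hG u (by omega) i), if_pos (hG' u (by omega) i)]
      have := ih (i :: u) (by simp; omega) (by simp; omega)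
      simp only [List.cons_append] at this
      rw [this]

/-- Distinct identifiers for some of the nodes can be extended to the whole tree. -/
theorem exists_validIds {δ : ℕ} (G : FullTree δ) {c : ℕ} (hc : 1 ≤ c) {B : Finset (List (Fin δ))}
    (hB : B ⊆ G.nodes) (f : List (Fin δ) → Fin G.size) (hf : Set.InjOn f B) :
    ∃ ids, ValidIds c G ids ∧ ∀ v ∈ B, ids v = f v + 1 := by
  classical
  obtain ⟨g, hg⟩ := Finset.exists_equiv_extend_of_card_eq (α := G.nodes) (β := Fin G.size)
    (t := Finset.univ) (by
      rw [Fintype.card_coe, Finset.card_univ, Fintype.card_fin, FullTree.size]) (s := B.subtype (· ∈ G.nodes))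
    (f := fun v => f v) (Finset.subset_univ _) (by
      intro v hv w hw h
      exact Subtype.ext (hf (by simpa using hv) (by simpa using hw) h))
  refine ⟨fun v => if h : v ∈ G.nodes then (g ⟨v, h⟩ : Fin G.size) + 1 else 0, ⟨?_, ?_⟩, ?_⟩
  · intro v hv w hw h
    have hv' : v ∈ G.nodes := hv
    have hw' : w ∈ G.nodes := hw
    simp only [hv', hw', dif_pos, Nat.add_right_cancel_iff] at h
    exact congrArg Subtype.val (g.injective (Subtype.ext (Fin.ext h)))
  · intro v hv
    simp only [hv, dif_pos]
    refine ⟨by omega, ?_⟩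
    have h1 : ((g ⟨v, hv⟩ : Fin G.size) : ℕ) + 1 ≤ G.size := (g ⟨v, hv⟩ : Fin G.size).2
    exact h1.trans (Nat.le_self_pow (by omega) _)
  · intro v hv
    have h := hg ⟨v, hB hv⟩ (by simpa using hv)
    simp only [hB hv, dif_pos, h]

/-! ### From probable labels to reachable sets -/

section Probable

variable {δ : ℕ} {X : Type}

/-- The coordinates of the sample space: two for every node. -/
abbrev Coord (δ : ℕ) := List (Fin δ) ⊕ List (Fin δ)

/-- The node of a coordinate. -/
def Coord.node : Coord δ → List (Fin δ)
  | .inl v => v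
  | .inr v => v

/-- The sample, seen from the node `q`. -/
def shift (q : List (Fin δ)) (ω : Coord δ → X) : Coord δ → X :=
  fun i => ω (Sum.map (· ++ q) (· ++ q) i)

theorem shift_append (p q : List (Fin δ)) (ω : Coord δ → X) :
    shift (p ++ q) ω = shift p (shift q ω) := by
  funext i
  rcases i with i | i <;> simp [shift]

variable [MeasurableSpace X]

/-- A shift selects coordinates of an i.i.d. family along an injection. -/
theorem measurePreserving_shift (ρ : Measure X) [IsProbabilityMeasure ρ] (q : List (Fin δ)) :
    MeasurePreserving (shift q) (Measure.infinitePi fun _ : Coord δ => ρ)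
      (Measure.infinitePi fun _ : Coord δ => ρ) := by
  refine ⟨measurable_pi_lambda _ fun i => measurable_pi_apply _, ?_⟩
  exact Measure.map_infinitePi_infinitePi_of_inj (P := fun _ : Coord δ => ρ)
    (f := Sum.map (· ++ q) (· ++ q))
    ((List.append_left_injective q).sumMap (List.append_left_injective q))

/-- The coordinates of the nodes at the levels from `a` to `b`. -/
noncomputable def levels (δ a b : ℕ) : Finset (Coord δ) :=
  ((listsLE δ b).filter fun v => a ≤ v.length).disjSum
    ((listsLE δ b).filter fun v => a ≤ v.length)

theorem mem_levels {a b : ℕ} {i : Coord δ} :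
    i ∈ levels δ a b ↔ a ≤ i.node.length ∧ i.node.length ≤ b := by
  unfold levels
  rcases i with v | v <;> simp [Finset.inl_mem_disjSum, mem_listsLE, Coord.node, and_comm]

/-- Both events are preimages under restrictions to disjoint finite sets of coordinates, and these
restrictions are independent. -/
theorem measure_inter_eq_mul {ι : Type*} (ρ : Measure X) [IsProbabilityMeasure ρ]
    {S T : Finset ι} (hST : Disjoint S T) {A B : Set (ι → X)} (hA : MeasurableSet A)
    (hB : MeasurableSet B) (hAS : ∀ ω ω', (∀ i ∈ S, ω i = ω' i) → ω ∈ A → ω' ∈ A)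
    (hBT : ∀ ω ω', (∀ i ∈ T, ω i = ω' i) → ω ∈ B → ω' ∈ B) :
    (Measure.infinitePi fun _ : ι => ρ).real (A ∩ B) =
      (Measure.infinitePi fun _ : ι => ρ).real A * (Measure.infinitePi fun _ : ι => ρ).real B := by
  classical
  obtain ⟨x₀⟩ : Nonempty X := ρ.nonempty_of_neZero
  -- Extending a partial sample by a constant is measurable; pulling an event back along it gives
  -- the event on finitely many coordinates.
  set ext : ∀ U : Finset ι, (U → X) → ι → X := fun U a i =>
    if h : i ∈ U then a ⟨i, h⟩ else x₀ with hext
  have hm : ∀ U, Measurable (ext U) := by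
    intro U
    refine measurable_pi_lambda _ fun i => ?_
    by_cases h : i ∈ U
    · simp only [hext, h, dif_pos]; exact measurable_pi_apply _
    · simp only [hext, h, dif_neg, not_false_eq_true]; exact measurable_const
  have key : ∀ (U : Finset ι) (E : Set (ι → X)),
      (∀ ω ω', (∀ i ∈ U, ω i = ω' i) → ω ∈ E → ω' ∈ E) →
      E = (fun (ω : ι → X) (i : U) => ω i) ⁻¹' (ext U ⁻¹' E) := by
    intro U E hE
    ext ω
    simp only [Set.mem_preimage]
    constructor
    · exact hE _ _ fun i hi => by simp [hext, hi]
    · exact hE _ _ fun i hi => by simp [hext, hi]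
  have hind := (ProbabilityTheory.iIndepFun_infinitePi (P := fun _ : ι => ρ)
    (X := fun _ x => x) (fun _ => measurable_id)).indepFun_finset S T hST
    (fun i => measurable_pi_apply i)
  have h2 := hind.measure_inter_preimage_eq_mul (ext S ⁻¹' A) (ext T ⁻¹' B) (hm S hA) (hm T hB)
  have hA' := key S A hAS
  have hB' := key T B hBT
  rw [← hA', ← hB'] at h2
  simp only [Measure.real, h2, ENNReal.toReal_mul]

/-- A chain of sets of labels that is longer than the number of labels repeats a set. -/
theorem exists_eq_succ_of_chain {L : Type} [Fintype L] (A : ℕ → Finset L)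
    (hA : ∀ i, A i ⊆ A (i + 1)) : ∃ i ≤ Fintype.card L, A i = A (i + 1) := by
  by_contra h
  push Not at h
  have key : ∀ i ≤ Fintype.card L + 1, i ≤ (A i).card := by
    intro i
    induction i with
    | zero => intro _; omega
    | succ i ih =>
      intro hi
      have := Finset.card_lt_card ((hA i).ssubset_of_ne (h i (by omega)))
      have := ih (by omega)
      omega
  have h1 := key _ le_rfl
  have h2 := (A (Fintype.card L + 1)).card_le_univ
  omega

theorem LCL.Allows.restrict {L : Type} [DecidableEq L] {P : LCL δ L} {S : Finset L} {a : L}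
    {b : Fin δ → L} (h : P.Allows a b) (ha : a ∈ S) (hb : ∀ i, b i ∈ S) :
    (P.restrict S).Allows a b := by
  obtain ⟨ρ, h⟩ := h
  exact ⟨ρ, Finset.mem_filter.2 ⟨h, ha, fun i => hb _⟩⟩

/-- Correctly labelled trees with all root labels and the same leaf labels make a set of labels
reachable. -/
theorem reach_of_trees {L : Type} [DecidableEq L] {P : LCL δ L} {S : Finset L}
    (hS : S.Nonempty) (hSP : S ⊆ P.labels) {d : ℕ} (hd : 0 < d) (T : L → List (Fin δ) → L)
    (Lf : List (Fin δ) → L) (hroot : ∀ σ ∈ S, T σ [] = σ)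
    (hleaf : ∀ σ ∈ S, ∀ x, x.length = d → T σ x = Lf x)
    (hmem : ∀ σ ∈ S, ∀ x, x.length ≤ d → T σ x ∈ S)
    (hall : ∀ σ ∈ S, ∀ x, x.length < d → P.Allows (T σ x) fun i => T σ (i :: x)) :
    Reach (P.restrict S) S ∧ (P.restrict S).configs.Nonempty := by
  have hlab := restrict_labels_eq P hSP
  have hall' : ∀ σ ∈ S, ∀ x, x.length < d →
      (P.restrict S).Allows (T σ x) fun i => T σ (i :: x) := fun σ hσ x hx =>
    (hall σ hσ x hx).restrict (hmem σ hσ x hx.le) fun i => hmem σ hσ _ (by simp; omega)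
  -- For each node x of the tree, from the leaves upwards, one reachable set contains the labels of
  -- x in all the trees. At a leaf the common label makes this set a singleton.
  have key : ∀ j, ∀ x : List (Fin δ), j + x.length = d →
      ∃ E, Reach (P.restrict S) E ∧ ∀ σ ∈ S, T σ x ∈ E := by
    intro j
    induction j with
    | zero =>
      intro x hx
      refine ⟨{Lf x}, .single _ ?_, fun σ hσ => by simp [hleaf σ hσ x (by omega)]⟩
      obtain ⟨σ, hσ⟩ := hS
      rw [hlab, ← hleaf σ hσ x (by omega)]
      exact hmem σ hσ x (by omega)
    | succ j ih =>
      intro x hx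
      choose E hE hTE using fun i => ih (i :: x) (by simp; omega)
      have hT : ∀ σ ∈ S, T σ x ∈ (P.restrict S).rootLabels E := fun σ hσ =>
        mem_rootLabels.2 ⟨(hall' σ hσ x (by omega)).mem_labels.1, _, fun i => hTE i σ hσ,
          hall' σ hσ x (by omega)⟩
      obtain ⟨σ, hσ⟩ := hS
      exact ⟨_, .step E hE (Finset.ne_empty_of_mem (hT σ hσ)), hT⟩
  obtain ⟨E, hE, hT⟩ := key d [] (by simp)
  -- The set at the root contains all root labels, that is S, and the restricted problem has no
  -- labels outside S.
  have : E = S := by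
    refine Finset.Subset.antisymm (hE.subset_labels.trans hlab.subset) fun σ hσ => ?_
    have := hT σ hσ
    rwa [hroot σ hσ] at this
  refine ⟨this ▸ hE, ?_⟩
  obtain ⟨σ, hσ⟩ := hS
  obtain ⟨_, h⟩ := hall' σ hσ [] (by simpa using hd)
  exact ⟨_, h⟩

variable {L : Type} (t : ℕ)
  (Φ : List (Fin δ) → (Coord δ → X) → L)

/-- The random label of the node `v`, if `Φ w` gives the label of a node in terms of the sample
seen from its ancestor at distance `t`, where `w` is the path to this ancestor. -/
def randLabel (ω : Coord δ → X) (v : List (Fin δ)) : L := Φ (v.take t) (shift (v.drop t) ω)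

/-- The shift to the ancestor at distance t preserves the law, so only the path from this ancestor
matters. -/
theorem measure_randLabel (ρ : Measure X) [IsProbabilityMeasure ρ]
    (hmeas : ∀ w a, w.length = t → MeasurableSet {η | Φ w η = a}) {v : List (Fin δ)}
    (hv : t ≤ v.length) (a : L) :
    (Measure.infinitePi fun _ : Coord δ => ρ).real {ω | randLabel t Φ ω v = a} =
      (Measure.infinitePi fun _ : Coord δ => ρ).real {η | Φ (v.take t) η = a} := by
  have h := (measurePreserving_shift ρ (v.drop t)).measure_preimage
    (hmeas (v.take t) a (by simp [hv])).nullMeasurableSet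
  exact congrArg ENNReal.toReal h

theorem measurableSet_randLabel
    (hmeas : ∀ w a, w.length = t → MeasurableSet {η | Φ w η = a}) {v : List (Fin δ)}
    (hv : t ≤ v.length) (a : L) : MeasurableSet {ω | randLabel t Φ ω v = a} :=
  (measurable_pi_lambda _ fun _ => measurable_pi_apply _ : Measurable (shift (X := X) (v.drop t)))
    (hmeas (v.take t) a (by simp [hv]))

omit [MeasurableSpace X] in
theorem randLabel_congr
    (hloc : ∀ w η η', w.length = t → (∀ i ∈ levels δ 0 (2 * t), η i = η' i) → Φ w η = Φ w η')
    {v : List (Fin δ)} (hv : t ≤ v.length) {ω ω' : Coord δ → X}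
    (h : ∀ i ∈ levels δ (v.length - t) (v.length + t), ω i = ω' i) :
    randLabel t Φ ω v = randLabel t Φ ω' v := by
  refine hloc _ _ _ (by simp [hv]) fun i hi => h _ ?_
  rw [mem_levels] at hi ⊢
  rcases i with u | u <;>
    simp only [Sum.map_inl, Sum.map_inr, Coord.node, List.length_append, List.length_drop] at hi ⊢ <;>
    omega

/-- The probability that a node below the path `w` has label `a`. -/
noncomputable def labelProb (ρ : Measure X) [IsProbabilityMeasure ρ] (w : List (Fin δ)) (a : L) :
    ℝ :=
  (Measure.infinitePi fun _ : Coord δ => ρ).real {η | Φ w η = a}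

variable {t Φ} [Fintype L] [DecidableEq L]

/-- An averaging argument over leaf patterns. For each σ in S, take a node that has label σ with
probability at least θ and the complete tree of depth 2t+1 below it. The root label is independent
of the leaf labels, and these have the same law for all σ. By a union bound, failures and labels
outside S are so rare that for some pattern f and all σ the event "root σ and leaves f" is more
likely than "leaves f and something is wrong". One good sample for every σ then yields trees for
`reach_of_trees`. -/
theorem reach_of_gap (z : Fin δ) {P : LCL δ L} (hP : P.labels = Finset.univ) (ρ : Measure X)
    [IsProbabilityMeasure ρ] (hmeas : ∀ w a, w.length = t → MeasurableSet {η | Φ w η = a})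
    (hloc : ∀ w η η', w.length = t → (∀ i ∈ levels δ 0 (2 * t), η i = η' i) → Φ w η = Φ w η')
    {ε θ θ' : ℝ} (hθ0 : 0 ≤ θ') (hfail : (Measure.infinitePi fun _ : Coord δ => ρ).real
      {ω | ∃ v : List (Fin δ), t + 1 ≤ v.length ∧ v.length ≤ 3 * t + 1 ∧
        ¬ P.Allows (randLabel t Φ ω v) fun i => randLabel t Φ ω (i :: v)} ≤ ε)
    {S : Finset L} (hS : S.Nonempty)
    (hSθ : ∀ σ ∈ S, ∃ w, w.length = t ∧ θ ≤ labelProb Φ ρ w σ)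
    (hSθ' : ∀ σ ∉ S, ∀ w, w.length = t → labelProb Φ ρ w σ ≤ θ')
    (hθ : Fintype.card L * (ε + (listsLE δ (2 * t + 1)).card * (Fintype.card L * θ')) < θ) :
    Reach (P.restrict S) S ∧ (P.restrict S).configs.Nonempty := by
  classical
  set μ := Measure.infinitePi fun _ : Coord δ => ρ with hμ
  have hw : ∀ σ, ∃ w : List (Fin δ), w.length = t ∧ (σ ∈ S → θ ≤ labelProb Φ ρ w σ) := fun σ => by
    by_cases hσ : σ ∈ S
    · obtain ⟨w, h1, h2⟩ := hSθ σ hσ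
      exact ⟨w, h1, fun _ => h2⟩
    · exact ⟨List.replicate t z, by simp, fun h => absurd h hσ⟩
  choose w hwt hwθ using hw
  -- The additional index `z` puts the ancestor at distance t strictly below the root of the whole
  -- tree, so r σ has depth t + 1, where the failure event starts.
  set r : L → List (Fin δ) := fun σ => w σ ++ [z] with hr
  have hrlen : ∀ σ, (r σ).length = t + 1 := fun σ => by simp [hr, hwt]
  set lab := randLabel t Φ with hlab
  set bad : L → Set (Coord δ → X) := fun σ =>
    {ω | ∃ v : List (Fin δ), t + 1 ≤ v.length ∧ v.length ≤ 3 * t + 1 ∧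
        ¬ P.Allows (lab ω v) fun i => lab ω (i :: v)} ∪
      ⋃ x ∈ listsLE δ (2 * t + 1), ⋃ a ∈ Finset.univ \ S, {ω | lab ω (x ++ r σ) = a} with hbad
  have hbadle : ∀ σ, μ.real (bad σ) ≤
      ε + (listsLE δ (2 * t + 1)).card * (Fintype.card L * θ') := by
    intro σ
    refine (measureReal_union_le _ _).trans (add_le_add hfail ?_)
    refine (measureReal_biUnion_finset_le _ _).trans ?_
    rw [← nsmul_eq_mul, ← nsmul_eq_mul]
    refine Finset.sum_le_card_nsmul _ _ _ fun x hx => ?_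
    refine (measureReal_biUnion_finset_le _ _).trans ?_
    refine (Finset.sum_le_card_nsmul _ _ θ' fun a ha => ?_).trans ?_
    · have h1 : t ≤ (x ++ r σ).length := by simp [hrlen]; omega
      rw [measure_randLabel t Φ ρ hmeas h1 a]
      exact hSθ' a (Finset.mem_sdiff.1 ha).2 _ (by simp [hrlen]; omega)
    · exact nsmul_le_nsmul_left hθ0 (Finset.card_le_univ _)
  -- Depth 2t+1 is the least one that separates the samples: the root label uses the levels 1 to
  -- 2t+1, the leaf labels use 2t+2 to 4t+2.
  set T := {x // x ∈ (listsLE δ (2 * t + 1)).filter fun x => x.length = 2 * t + 1} with hT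
  have hTlen : ∀ x : T, x.1.length = 2 * t + 1 := fun x => (Finset.mem_filter.1 x.2).2
  set leaves : L → (Coord δ → X) → T → L := fun σ ω x => lab ω (x.1 ++ r σ) with hleaves
  have hEset : ∀ σ f, leaves σ ⁻¹' {f} = ⋂ x : T, {ω | lab ω (x.1 ++ r σ) = f x} := by
    intro σ f
    ext ω
    simp [hleaves, funext_iff]
  have hEmeas : ∀ σ f, MeasurableSet (leaves σ ⁻¹' {f}) := by
    intro σ f
    rw [hEset]
    exact MeasurableSet.iInter fun x => measurableSet_randLabel t Φ hmeas
      (by simp [hrlen]; omega) _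
  -- The ancestor of a leaf at distance t still lies inside the tree, so the leaf pattern is a
  -- function of the sample shifted to the root of the tree.
  have hEeq : ∀ σ σ' f, μ.real (leaves σ ⁻¹' {f}) = μ.real (leaves σ' ⁻¹' {f}) := by
    have key : ∀ σ f, μ.real (leaves σ ⁻¹' {f}) =
        μ.real (⋂ x : T, {η | lab η x.1 = f x}) := by
      intro σ f
      rw [← (measurePreserving_shift ρ (r σ)).measureReal_preimage (MeasurableSet.iInter fun x =>
        measurableSet_randLabel t Φ hmeas (by rw [hTlen]; omega) _).nullMeasurableSet, hEset]
      congr 1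
      ext ω
      simp only [Set.mem_iInter, Set.mem_preimage, Set.mem_ofPred_eq]
      refine forall_congr' fun x => ?_
      have h1 : t ≤ x.1.length := by rw [hTlen]; omega
      simp only [hlab, randLabel, List.take_append_of_le_length h1, List.drop_append_of_le_length h1,
        shift_append]
    intro σ σ' f
    rw [key, key]
  have hrootmeas : ∀ σ, MeasurableSet {ω | lab ω (r σ) = σ} := fun σ =>
    measurableSet_randLabel t Φ hmeas (by rw [hrlen]; omega) _
  have hindep : ∀ σ f, μ.real ({ω | lab ω (r σ) = σ} ∩ leaves σ ⁻¹' {f}) =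
      μ.real {ω | lab ω (r σ) = σ} * μ.real (leaves σ ⁻¹' {f}) := by
    intro σ f
    refine measure_inter_eq_mul ρ (S := levels δ 1 (2 * t + 1))
      (T := levels δ (2 * t + 2) (4 * t + 2)) ?_ (hrootmeas σ) (hEmeas σ f) ?_ ?_
    · rw [Finset.disjoint_left]
      intro i h1 h2
      rw [mem_levels] at h1 h2
      omega
    · intro ω ω' h h1
      rw [Set.mem_ofPred_eq] at h1 ⊢
      refine (randLabel_congr t Φ hloc (by rw [hrlen]; omega) fun i hi => (h i ?_).symm).trans h1
      rw [mem_levels, hrlen] at *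
      omega
    · intro ω ω' h h1
      rw [Set.mem_preimage, Set.mem_singleton_iff] at h1 ⊢
      rw [← h1]
      funext x
      symm
      refine randLabel_congr t Φ hloc (by simp [hrlen]; omega) fun i hi => h i ?_
      rw [mem_levels, List.length_append, hrlen, hTlen] at *
      omega
  have hrootθ : ∀ σ ∈ S, θ ≤ μ.real {ω | lab ω (r σ) = σ} := by
    intro σ hσ
    rw [measure_randLabel t Φ ρ hmeas (by rw [hrlen]; omega)]
    have : (r σ).take t = w σ := by
      rw [hr]
      simp only [List.take_append_of_le_length (hwt σ).ge]
      exact List.take_of_length_le (hwt σ).le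
    rw [this]
    exact hwθ σ hσ
  have hsum1 : ∀ σ, ∑ f : T → L, μ.real (leaves σ ⁻¹' {f}) = 1 := by
    intro σ
    rw [sum_measureReal_preimage_singleton _ fun f _ => hEmeas σ f]
    simp
  have hsum2 : ∀ σ, ∑ f : T → L, μ.real (leaves σ ⁻¹' {f} ∩ bad σ) = μ.real (bad σ) := by
    intro σ
    have := sum_measureReal_preimage_singleton (μ := μ.restrict (bad σ)) Finset.univ
      fun f _ => hEmeas σ f
    simp only [measureReal_restrict_apply (hEmeas σ _), Finset.coe_univ, Set.preimage_univ,
      measureReal_restrict_apply MeasurableSet.univ, Set.univ_inter] at this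
    exact this
  obtain ⟨σ₀, hσ₀⟩ := hS
  -- Summed over all f, the left side is the sum of the probabilities of `bad σ`, which the
  -- hypothesis on θ bounds below θ, and the right side is θ itself.
  obtain ⟨f, -, hf⟩ : ∃ f ∈ (Finset.univ : Finset (T → L)),
      ∑ σ ∈ S, μ.real (leaves σ ⁻¹' {f} ∩ bad σ) < θ * μ.real (leaves σ₀ ⁻¹' {f}) := by
    refine Finset.exists_lt_of_sum_lt ?_
    rw [Finset.sum_comm, ← Finset.mul_sum, hsum1, mul_one]
    simp only [hsum2]
    refine lt_of_le_of_lt ?_ hθ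
    rw [← nsmul_eq_mul]
    refine (Finset.sum_le_card_nsmul _ _ _ fun σ _ => hbadle σ).trans ?_
    exact nsmul_le_nsmul_left (measureReal_nonneg.trans (hbadle σ₀)) (Finset.card_le_univ _)
  have hex : ∀ σ, ∃ ω : Coord δ → X, σ ∈ S →
      lab ω (r σ) = σ ∧ leaves σ ω = f ∧ ω ∉ bad σ := by
    intro σ
    by_cases hσ : σ ∈ S
    · by_contra hc
      push Not at hc
      have hsub : {ω | lab ω (r σ) = σ} ∩ leaves σ ⁻¹' {f} ⊆ leaves σ ⁻¹' {f} ∩ bad σ :=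
        fun ω hω => ⟨hω.2, (hc ω).2 hω.1 hω.2⟩
      have h1 := measureReal_mono (μ := μ) hsub
      rw [hindep, hEeq σ σ₀] at h1
      have h2 : μ.real (leaves σ ⁻¹' {f} ∩ bad σ) ≤
          ∑ σ ∈ S, μ.real (leaves σ ⁻¹' {f} ∩ bad σ) :=
        Finset.single_le_sum (f := fun σ => μ.real (leaves σ ⁻¹' {f} ∩ bad σ))
          (fun _ _ => measureReal_nonneg) hσ
      have h3 := mul_le_mul_of_nonneg_right (hrootθ σ hσ)
        (measureReal_nonneg (μ := μ) (s := leaves σ₀ ⁻¹' {f}))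
      linarith
    · obtain ⟨x₀⟩ : Nonempty X := ρ.nonempty_of_neZero
      exact ⟨fun _ => x₀, fun h => absurd h hσ⟩
  choose ω hω using hex
  refine reach_of_trees ⟨σ₀, hσ₀⟩ (by rw [hP]; exact Finset.subset_univ _)
    (d := 2 * t + 1) (by omega) (fun σ x => lab (ω σ) (x ++ r σ))
    (fun x => if h : x ∈ (listsLE δ (2 * t + 1)).filter fun x => x.length = 2 * t + 1
      then f ⟨x, h⟩ else σ₀) ?_ ?_ ?_ ?_
  · intro σ hσ
    simpa using (hω σ hσ).1
  · intro σ hσ x hx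
    have h : x ∈ (listsLE δ (2 * t + 1)).filter fun x => x.length = 2 * t + 1 :=
      Finset.mem_filter.2 ⟨mem_listsLE.2 hx.le, hx⟩
    rw [dif_pos h, ← (hω σ hσ).2.1]
  · intro σ hσ x hx
    by_contra hc
    refine (hω σ hσ).2.2 (Or.inr ?_)
    simp only [Set.mem_iUnion]
    exact ⟨x, mem_listsLE.2 hx, _, Finset.mem_sdiff.2 ⟨Finset.mem_univ _, hc⟩, rfl⟩
  · intro σ hσ x hx
    by_contra hc
    refine (hω σ hσ).2.2 (Or.inl ⟨x ++ r σ, ?_, ?_, hc⟩)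
    · simp [hrlen]
    · simp [hrlen]; omega

/-- If a labelling with local randomness rarely fails, then some set of labels is reachable. -/
theorem reach_of_probable (z : Fin δ) {P : LCL δ L} (hP : P.labels = Finset.univ) (ρ : Measure X)
    [IsProbabilityMeasure ρ] (hmeas : ∀ w a, w.length = t → MeasurableSet {η | Φ w η = a})
    (hloc : ∀ w η η', w.length = t → (∀ i ∈ levels δ 0 (2 * t), η i = η' i) → Φ w η = Φ w η')
    {ε M : ℝ} (hfail : (Measure.infinitePi fun _ : Coord δ => ρ).real
      {ω | ∃ v : List (Fin δ), t + 1 ≤ v.length ∧ v.length ≤ 3 * t + 1 ∧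
        ¬ P.Allows (randLabel t Φ ω v) fun i => randLabel t Φ ω (i :: v)} ≤ ε)
    (hM : 4 * Fintype.card L ^ 2 * (listsLE δ (2 * t + 1)).card ≤ M) (hM1 : 1 ≤ M)
    (hε : Fintype.card L * ε * 2 < (M⁻¹) ^ (Fintype.card L + 1)) :
    ∃ S : Finset L, Reach (P.restrict S) S ∧ (P.restrict S).configs.Nonempty := by
  classical
  -- These sets increase with i, so two consecutive ones agree for some i ≤ |L|. Then every label
  -- outside `A i` is less likely than M⁻¹ ^ (i + 2) everywhere: a gap by the factor M.
  set A : ℕ → Finset L := fun i => Finset.univ.filter fun σ =>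
    ∃ w, w.length = t ∧ (M⁻¹) ^ (i + 1) ≤ labelProb Φ ρ w σ with hA
  have hM0 : 0 < M := by linarith
  have hMi : M⁻¹ ≤ 1 := inv_le_one_of_one_le₀ hM1
  obtain ⟨i, hi, hAi⟩ := exists_eq_succ_of_chain A (by
    intro i σ hσ
    obtain ⟨w, h1, h2⟩ := (Finset.mem_filter.1 hσ).2
    refine Finset.mem_filter.2 ⟨Finset.mem_univ _, w, h1, le_trans ?_ h2⟩
    exact pow_le_pow_of_le_one (by positivity) hMi (by omega))
  have hpos : 0 < (M⁻¹) ^ (i + 1) := by positivity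
  have hcard : 1 ≤ (listsLE δ (2 * t + 1)).card := Finset.card_pos.2 ⟨[], by simp [mem_listsLE]⟩
  set w₀ : List (Fin δ) := List.replicate t z
  have hw₀ : w₀.length = t := by simp [w₀]
  have hsum : ∑ σ : L, labelProb Φ ρ w₀ σ = 1 := by
    have := sum_measureReal_preimage_singleton (μ := Measure.infinitePi fun _ : Coord δ => ρ)
      Finset.univ (f := Φ w₀) fun a _ => hmeas w₀ a hw₀
    simp only [Finset.coe_univ, Set.preimage_univ, probReal_univ] at this
    exact this
  have hL : 1 ≤ Fintype.card L := by
    by_contra hc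
    have : IsEmpty L := Fintype.card_eq_zero_iff.1 (by omega)
    simp at hsum
  have hLr : (1 : ℝ) ≤ Fintype.card L := by exact_mod_cast hL
  have hcr : (1 : ℝ) ≤ (listsLE δ (2 * t + 1)).card := by exact_mod_cast hcard
  -- The label probabilities at `w₀` add up to 1, so not all of them are below M⁻¹, as M is larger
  -- than the number of labels.
  have hne : (A i).Nonempty := by
    by_contra hc
    rw [Finset.not_nonempty_iff_eq_empty] at hc
    have h1 : ∀ σ ∈ (Finset.univ : Finset L), labelProb Φ ρ w₀ σ < M⁻¹ := by
      intro σ _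
      by_contra h
      have : σ ∈ A i := Finset.mem_filter.2 ⟨Finset.mem_univ _, w₀, hw₀, le_trans
        (pow_le_of_le_one (by positivity) hMi (by omega)) (not_lt.1 h)⟩
      rw [hc] at this
      simp at this
    have h2 := Finset.sum_lt_sum_of_nonempty (Finset.univ_nonempty_iff.2
      (Fintype.card_pos_iff.1 hL)) h1
    rw [hsum, Finset.sum_const, Finset.card_univ, nsmul_eq_mul, ← div_eq_mul_inv, lt_div_iff₀ hM0,
      one_mul] at h2
    nlinarith
  refine ⟨A i, reach_of_gap z hP ρ hmeas hloc (ε := ε) (θ := (M⁻¹) ^ (i + 1))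
    (θ' := (M⁻¹) ^ (i + 2)) (by positivity) hfail hne ?_ ?_ ?_⟩
  · exact fun σ hσ => (Finset.mem_filter.1 hσ).2
  · intro σ hσ w hw
    rw [hAi] at hσ
    by_contra hc
    exact hσ (Finset.mem_filter.2 ⟨Finset.mem_univ _, w, hw, (not_le.1 hc).le⟩)
  -- The failures contribute less than half of θ by the choice of ε, the labels outside the set at
  -- most a quarter by the choice of M.
  · have h1 : (M⁻¹) ^ (Fintype.card L + 1) ≤ (M⁻¹) ^ (i + 1) :=
      pow_le_pow_of_le_one (by positivity) hMi (by omega)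
    have h2 : (Fintype.card L : ℝ) * ((listsLE δ (2 * t + 1)).card * (Fintype.card L *
        (M⁻¹) ^ (i + 2))) ≤ (M⁻¹) ^ (i + 1) / 4 := by
      have h3 : (4 * (Fintype.card L : ℝ) ^ 2 * (listsLE δ (2 * t + 1)).card) * M⁻¹ ≤ 1 := by
        rw [← div_eq_mul_inv, div_le_one hM0]
        exact hM
      have h4 := mul_le_mul_of_nonneg_right h3 hpos.le
      rw [pow_succ M⁻¹ (i + 1)]
      nlinarith
    nlinarith

end Probable

/-! ### The lower bound -/

section Lower

variable {δ : ℕ} {L : Type} (A : DistAlg δ L (ℕ → Bool)) (G : FullTree δ) (t : ℕ)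

instance (G : FullTree δ) : NeZero G.size := ⟨(Finset.card_pos.2 ⟨_, G.root_mem⟩).ne'⟩

/-- A random identifier together with a stream of random bits. -/
abbrev Sample (n : ℕ) := Fin n × (ℕ → Bool)

noncomputable def sampleLaw (n : ℕ) [NeZero n] : Measure (Sample n) :=
  (PMF.uniformOfFintype (Fin n)).toMeasure.prod coinStream

instance (n : ℕ) [NeZero n] : IsProbabilityMeasure (sampleLaw n) := by
  unfold sampleLaw
  infer_instance

/-- The joint law of the samples at all coordinates. -/
noncomputable def jointLaw (δ n : ℕ) [NeZero n] : Measure (Coord δ → Sample n) :=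
  Measure.infinitePi fun _ => sampleLaw n

instance (δ n : ℕ) [NeZero n] : IsProbabilityMeasure (jointLaw δ n) := by
  unfold jointLaw
  infer_instance

variable {n : ℕ}

/-- Each coordinate carries an identifier and a bit stream, but identifiers are read only from left
coordinates and streams only from right ones. So the two depend on disjoint coordinates and are
independent. -/
def idOf (ω : Coord δ → Sample n) (v : List (Fin δ)) : Fin n := (ω (.inl v)).1

def bitsOf (ω : Coord δ → Sample n) (v : List (Fin δ)) : ℕ → Bool := (ω (.inr v)).2

theorem measurable_bitsOf : Measurable (bitsOf : (Coord δ → Sample n) → List (Fin δ) → ℕ → Bool) :=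
  measurable_pi_lambda _ fun v => measurable_snd.comp (measurable_pi_apply (Sum.inr v))

theorem measurableSet_idOf (v : List (Fin δ)) (a : Fin n) :
    MeasurableSet {ω : Coord δ → Sample n | idOf ω v = a} :=
  (measurable_fst.comp (measurable_pi_apply (Sum.inl v)) : Measurable fun ω => idOf ω v)
    (measurableSet_singleton a)

theorem measurePreserving_bitsOf [NeZero n] :
    MeasurePreserving bitsOf (jointLaw δ n) (nodeStreams δ) := by
  refine ⟨measurable_bitsOf, ?_⟩
  have h1 := Measure.map_infinitePi_infinitePi_of_inj (P := fun _ : Coord δ => sampleLaw n)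
    (f := (Sum.inr : List (Fin δ) → Coord δ)) Sum.inr_injective
  have h2 := Measure.infinitePi_map_pi (fun _ : List (Fin δ) => sampleLaw n)
    (f := fun _ x => x.2) (fun _ => measurable_snd)
  have h3 : (sampleLaw n).map Prod.snd = coinStream := by
    unfold sampleLaw
    rw [Measure.map_snd_prod]
    simp
  simp only [h3] at h2
  unfold nodeStreams
  rw [← h2, ← h1, Measure.map_map]
  · rfl
  · exact measurable_pi_lambda _ fun v => measurable_snd.comp (measurable_pi_apply _)
  · exact measurable_pi_lambda _ fun v => measurable_pi_apply _

theorem measure_idOf [NeZero n] (v : List (Fin δ)) (a : Fin n) :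
    (jointLaw δ n).real {ω | idOf ω v = a} = 1 / n := by
  have h := (measurePreserving_eval_infinitePi (fun _ : Coord δ => sampleLaw n)
    (Sum.inl v)).measureReal_preimage (s := {x | x.1 = a})
    (measurable_fst (measurableSet_singleton a)).nullMeasurableSet
  refine h.trans ?_
  have e : {x : Sample n | x.1 = a} = {a} ×ˢ Set.univ := by ext; simp
  rw [e]
  unfold sampleLaw
  rw [measureReal_prod_prod]
  simp [Measure.real]

/-- Two random identifiers agree with probability `1 / n`. -/
theorem measure_idOf_eq [NeZero n] {u v : List (Fin δ)} (huv : u ≠ v) :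
    (jointLaw δ n).real {ω | idOf ω u = idOf ω v} ≤ 1 / n := by
  have e : {ω : Coord δ → Sample n | idOf ω u = idOf ω v} =
      ⋃ a ∈ (Finset.univ : Finset (Fin n)), {ω | idOf ω u = a} ∩ {ω | idOf ω v = a} := by
    ext ω
    simp [eq_comm]
  rw [e]
  refine (measureReal_biUnion_finset_le _ _).trans ?_
  have h : ∀ a : Fin n, (jointLaw δ n).real ({ω | idOf ω u = a} ∩ {ω | idOf ω v = a}) =
      1 / n * (1 / n) := by
    intro a
    have := measure_inter_eq_mul (sampleLaw n) (S := {Sum.inl u}) (T := {Sum.inl v})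
      (by simpa using huv) (measurableSet_idOf u a) (measurableSet_idOf v a)
      (fun ω ω' h hω => by simpa [idOf, h] using hω) (fun ω ω' h hω => by simpa [idOf, h] using hω)
    rw [← measure_idOf u a]
    nth_rw 2 [measure_idOf u a]
    rw [← measure_idOf v a]
    exact this
  simp only [h, Finset.sum_const, Finset.card_univ, Fintype.card_fin, nsmul_eq_mul]
  have hn : (n : ℝ) ≠ 0 := by exact_mod_cast NeZero.ne n
  rw [← mul_assoc, mul_one_div_cancel hn, one_mul]

open scoped Classical in
/-- The label that a node outputs after `t` rounds, in terms of the sample seen from its ancestor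
at distance `t`; the path to this ancestor is `w`. The label is `a₀` if identifiers collide. -/
noncomputable def localLabel (z : Fin δ) (a₀ : L) (w : List (Fin δ))
    (η : Coord δ → Sample G.size) : L :=
  if Set.InjOn (idOf η) (listsLE δ (2 * t)) then
    A.result G (fun v => idOf η v.dropLast + 1) (fun v => bitsOf η v.dropLast) t (w ++ [z])
  else a₀

variable {A G t}

/-- The node is t levels below `[z]`, so its t-neighbourhood stays within the first 2t levels below
`[z]`. -/
theorem localLabel_congr (hG : listsLE δ (4 * t + 3) ⊆ G.nodes) (z : Fin δ) (a₀ : L)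
    (w : List (Fin δ)) (η η' : Coord δ → Sample G.size) (hw : w.length = t)
    (h : ∀ i ∈ levels δ 0 (2 * t), η i = η' i) :
    localLabel A G t z a₀ w η = localLabel A G t z a₀ w η' := by
  have h1 : ∀ u : List (Fin δ), u.length ≤ 2 * t → idOf η u = idOf η' u := fun u hu => by
    unfold idOf
    rw [h (Sum.inl u) (mem_levels.2 ⟨Nat.zero_le _, hu⟩)]
  have h2 : ∀ u : List (Fin δ), u.length ≤ 2 * t → bitsOf η u = bitsOf η' u := fun u hu => by
    unfold bitsOf
    rw [h (Sum.inr u) (mem_levels.2 ⟨Nat.zero_le _, hu⟩)]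
  have h3 : Set.InjOn (idOf η) (listsLE δ (2 * t)) ↔ Set.InjOn (idOf η') (listsLE δ (2 * t)) :=
    Set.EqOn.injOn_iff fun u hu => h1 u (mem_listsLE.1 hu)
  have hn : ∀ u : List (Fin δ), u.length ≤ 2 * t → ∀ i, i :: (u ++ [z]) ∈ G.nodes :=
    fun u hu i => hG (mem_listsLE.2 (by simp; omega))
  have h4 := A.run_congr G (q := [z]) (q' := [z]) (b := 2 * t)
    (ids := fun v => idOf η v.dropLast + 1) (ids' := fun v => idOf η' v.dropLast + 1)
    (rnd := fun v => bitsOf η v.dropLast) (rnd' := fun v => bitsOf η' v.dropLast)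
    (by simp) (by simp) hn hn z.pos (fun u hu => by simp [h1 u hu])
    (fun u hu => by simp [h2 u hu]) t w (by omega) (by omega)
  unfold localLabel DistAlg.result
  simp only [h3, h4]

/-- Measurability in the random bits is given only for fixed valid identifiers. So the space is cut
into finitely many cells by the identifiers on the relevant levels. On a cell with distinct
identifiers the run agrees with the run for a fixed valid extension; on the other cells the label is
constant. -/
theorem measurableSet_localLabel (hG : listsLE δ (4 * t + 3) ⊆ G.nodes) {c : ℕ} (hc : 1 ≤ c)
    (hA : ∀ ids, ValidIds c G ids → ∀ v ∈ G.nodes, ∀ a : L,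
      MeasurableSet {rnd | A.result G ids rnd t v = a})
    (z : Fin δ) (a₀ : L) (w : List (Fin δ)) (a : L) (hw : w.length = t) :
    MeasurableSet {η | localLabel A G t z a₀ w η = a} := by
  classical
  set D := listsLE δ (2 * t) with hD
  have e : {η : Coord δ → Sample G.size | localLabel A G t z a₀ w η = a} =
      ⋃ f : D → Fin G.size, {η | (∀ u : D, idOf η u = f u) ∧ localLabel A G t z a₀ w η = a} := by
    ext η
    simp only [Set.mem_ofPred_eq, Set.mem_iUnion]
    exact ⟨fun h => ⟨fun u => idOf η u, fun _ => rfl, h⟩, fun ⟨_, _, h⟩ => h⟩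
  rw [e]
  refine MeasurableSet.iUnion fun f => ?_
  have hcyl : MeasurableSet {η : Coord δ → Sample G.size | ∀ u : D, idOf η u = f u} := by
    have : {η : Coord δ → Sample G.size | ∀ u : D, idOf η u = f u} =
        ⋂ u : D, {η | idOf η u = f u} := by ext; simp
    rw [this]
    exact MeasurableSet.iInter fun u => measurableSet_idOf _ _
  by_cases hf : Function.Injective f
  · obtain ⟨ids, hids, hids'⟩ := exists_validIds G hc (B := D.image (· ++ [z]))
      (by
        intro v hv
        obtain ⟨u, hu, rfl⟩ := Finset.mem_image.1 hv
        have := mem_listsLE.1 hu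
        exact hG (mem_listsLE.2 (by simp; omega)))
      (fun v => if h : v.dropLast ∈ D then f ⟨_, h⟩ else 0) (by
        intro v hv v' hv' h
        obtain ⟨u, hu, rfl⟩ := Finset.mem_image.1 hv
        obtain ⟨u', hu', rfl⟩ := Finset.mem_image.1 hv'
        simp only [List.dropLast_concat, hu, hu', dif_pos] at h
        have := congrArg Subtype.val (hf h)
        simp only at this
        rw [this])
    have : {η | (∀ u : D, idOf η u = f u) ∧ localLabel A G t z a₀ w η = a} =
        {η : Coord δ → Sample G.size | ∀ u : D, idOf η u = f u} ∩
          {η | A.result G ids (fun v => bitsOf η v.dropLast) t (w ++ [z]) = a} := by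
      ext η
      simp only [Set.mem_ofPred_eq, Set.mem_inter_iff]
      refine and_congr_right fun hη => ?_
      have hinj : Set.InjOn (idOf η) D := by
        intro u hu u' hu' h
        rw [hη ⟨u, hu⟩, hη ⟨u', hu'⟩] at h
        exact congrArg Subtype.val (hf h)
      have hn : ∀ u : List (Fin δ), u.length ≤ 2 * t → ∀ i, i :: (u ++ [z]) ∈ G.nodes :=
        fun u hu i => hG (mem_listsLE.2 (by simp; omega))
      have h4 := A.run_congr G (q := [z]) (q' := [z]) (b := 2 * t)
        (ids := fun v => idOf η v.dropLast + 1) (ids' := ids)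
        (rnd := fun v => bitsOf η v.dropLast) (rnd' := fun v => bitsOf η v.dropLast)
        (by simp) (by simp) hn hn z.pos (fun u hu => by
          have hu' : u ∈ D := mem_listsLE.2 hu
          rw [hids' _ (Finset.mem_image_of_mem _ hu')]
          simp only [List.dropLast_concat, hu', dif_pos]
          rw [hη ⟨u, hu'⟩])
        (fun u hu => rfl) t w (by omega) (by omega)
      unfold localLabel DistAlg.result
      rw [if_pos hinj, h4]
    rw [this]
    refine hcyl.inter ?_
    have hm : Measurable fun (η : Coord δ → Sample G.size) (v : List (Fin δ)) =>
        bitsOf η v.dropLast :=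
      measurable_pi_lambda _ fun v => measurable_snd.comp (measurable_pi_apply (Sum.inr v.dropLast))
    exact hm (hA ids hids (w ++ [z]) (hG (mem_listsLE.2 (by simp; omega))) a)
  · have : {η | (∀ u : D, idOf η u = f u) ∧ localLabel A G t z a₀ w η = a} =
        {η : Coord δ → Sample G.size | ∀ u : D, idOf η u = f u} ∩ {_η | a₀ = a} := by
      ext η
      simp only [Set.mem_ofPred_eq, Set.mem_inter_iff]
      refine and_congr_right fun hη => ?_
      have hinj : ¬ Set.InjOn (idOf η) D := by
        intro h
        refine hf fun u u' huu => Subtype.ext (h u.2 u'.2 ?_)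
        rw [hη u, hη u', huu]
      unfold localLabel
      rw [if_neg hinj]
    rw [this]
    exact hcyl.inter (MeasurableSet.const _)

/-- What matters for v lies in the first 2t levels below its ancestor at distance t. For depths from
t+1 to 3t+2 this region avoids the root, and it stays within 4t+3 levels together with the children
of its nodes. So it looks like the region below `[z]` in which the local label is computed. -/
theorem randLabel_localLabel (hG : listsLE δ (4 * t + 3) ⊆ G.nodes) (z : Fin δ) (a₀ : L)
    {ω : Coord δ → Sample G.size} (hω : Set.InjOn (idOf ω) (listsLE δ (4 * t + 3)))
    {v : List (Fin δ)} (hv1 : t + 1 ≤ v.length) (hv2 : v.length ≤ 3 * t + 2) :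
    randLabel t (localLabel A G t z a₀) ω v =
      A.result G (fun v => idOf ω v + 1) (bitsOf ω) t v := by
  have hid : ∀ u, idOf (shift (v.drop t) ω) u = idOf ω (u ++ v.drop t) := fun u => rfl
  have hbit : ∀ u, bitsOf (shift (v.drop t) ω) u = bitsOf ω (u ++ v.drop t) := fun u => rfl
  have hinj : Set.InjOn (idOf (shift (v.drop t) ω)) (listsLE δ (2 * t)) := by
    intro u hu u' hu' h
    rw [hid, hid] at h
    have h1 := mem_listsLE.1 hu
    have h2 := mem_listsLE.1 hu'
    exact List.append_cancel_right (hω (mem_listsLE.2 (by simp; omega))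
      (mem_listsLE.2 (by simp; omega)) h)
  have h4 := A.run_congr G (q := [z]) (q' := v.drop t) (b := 2 * t)
    (ids := fun v' => idOf (shift (v.drop t) ω) v'.dropLast + 1) (ids' := fun v => idOf ω v + 1)
    (rnd := fun v' => bitsOf (shift (v.drop t) ω) v'.dropLast) (rnd' := bitsOf ω)
    (by simp) (by
      intro h
      have := congrArg List.length h
      simp at this
      omega)
    (fun u hu i => hG (mem_listsLE.2 (by simp; omega)))
    (fun u hu i => hG (mem_listsLE.2 (by simp; omega))) z.pos
    (fun u hu => by rw [List.dropLast_concat, hid])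
    (fun u hu => by rw [List.dropLast_concat, hbit]) t (v.take t) (by simp; omega)
    (by simp; omega)
  unfold randLabel localLabel
  rw [if_pos hinj, DistAlg.result, h4, List.take_append_drop]
  rfl

/-- The region where the outputs are compared fails with probability at most `1 / n`, for fixed
valid identifiers. -/
theorem measure_fail_le [Fintype L] {P : LCL δ L} (hG : listsLE δ (4 * t + 3) ⊆ G.nodes) {c : ℕ}
    (hA : ∀ ids, ValidIds c G ids → (∀ v ∈ G.nodes, ∀ a : L,
      MeasurableSet {rnd | A.result G ids rnd t v = a}) ∧
      1 - 1 / (G.size : ℝ) ≤ (nodeStreams δ).real {rnd | P.IsSolution G (A.result G ids rnd t)})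
    {ids : List (Fin δ) → ℕ} (hids : ValidIds c G ids) (hδ : 0 < δ) :
    MeasurableSet {rnd | ∃ v : List (Fin δ), t + 1 ≤ v.length ∧ v.length ≤ 3 * t + 1 ∧
      ¬ P.Allows (A.result G ids rnd t v) fun i => A.result G ids rnd t (i :: v)} ∧
    (nodeStreams δ).real {rnd | ∃ v : List (Fin δ), t + 1 ≤ v.length ∧ v.length ≤ 3 * t + 1 ∧
      ¬ P.Allows (A.result G ids rnd t v) fun i => A.result G ids rnd t (i :: v)} ≤
        1 / G.size := by
  obtain ⟨hm, hs⟩ := hA ids hids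
  set D := {rnd | ∃ v : List (Fin δ), t + 1 ≤ v.length ∧ v.length ≤ 3 * t + 1 ∧
      ¬ P.Allows (A.result G ids rnd t v) fun i => A.result G ids rnd t (i :: v)} with hD
  have hDm : MeasurableSet D := by
    -- There are finitely many labels, so finitely many outputs together are measurable for the
    -- discrete structure.
    let _ : MeasurableSpace L := ⊤
    have hmeas : ∀ v : List (Fin δ), v.length ≤ 4 * t + 3 →
        Measurable fun rnd => A.result G ids rnd t v := fun v hv =>
      measurable_to_countable' fun a => hm v (hG (mem_listsLE.2 hv)) a
    have : D = ⋃ v ∈ (listsLE δ (3 * t + 1)).filter fun v => t + 1 ≤ v.length,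
        (fun rnd => ((A.result G ids rnd t v, fun i => A.result G ids rnd t (i :: v)) :
          L × (Fin δ → L))) ⁻¹' {x | ¬ P.Allows x.1 x.2} := by
      ext rnd
      simp only [hD, Set.mem_ofPred_eq, Set.mem_iUnion, Set.mem_preimage, Finset.mem_filter,
        mem_listsLE, exists_prop]
      exact ⟨fun ⟨v, h1, h2, h3⟩ => ⟨v, ⟨h2, h1⟩, h3⟩, fun ⟨v, ⟨h2, h1⟩, h3⟩ => ⟨v, h1, h2, h3⟩⟩
    rw [this]
    refine Finset.measurableSet_biUnion _ fun v hv => ?_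
    have hv' := mem_listsLE.1 (Finset.mem_filter.1 hv).1
    have h1 : Measurable fun rnd => ((A.result G ids rnd t v,
        fun i => A.result G ids rnd t (i :: v)) : L × (Fin δ → L)) :=
      (hmeas v (by omega)).prodMk
        (measurable_pi_lambda _ fun i => hmeas (i :: v) (by simp; omega))
    exact h1 (Set.toFinite _).measurableSet
  refine ⟨hDm, ?_⟩
  have hdisj : Disjoint {rnd | P.IsSolution G (A.result G ids rnd t)} D := by
    rw [Set.disjoint_left]
    rintro rnd hsol ⟨v, h1, h2, h3⟩
    refine h3 (hsol.2 v (hG (mem_listsLE.2 (by omega))) fun hl => hl ⟨0, hδ⟩ ?_)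
    exact hG (mem_listsLE.2 (by simp; omega))
  have h1 := measureReal_union (μ := nodeStreams δ) hdisj hDm
  have h2 : (nodeStreams δ).real ({rnd | P.IsSolution G (A.result G ids rnd t)} ∪ D) ≤ 1 :=
    measureReal_le_one
  linarith

/-- Identifiers collide with small probability. -/
theorem measure_not_injOn [NeZero n] (J : Finset (List (Fin δ))) :
    (jointLaw δ n).real {ω | ¬ Set.InjOn (idOf ω) J} ≤ J.card ^ 2 / n := by
  classical
  have hsub : {ω : Coord δ → Sample n | ¬ Set.InjOn (idOf ω) J} ⊆
      ⋃ p ∈ J.offDiag, {ω | idOf ω p.1 = idOf ω p.2} := by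
    intro ω hω
    simp only [Set.mem_ofPred_eq, Set.InjOn] at hω
    push Not at hω
    obtain ⟨u, hu, v, hv, h, hne⟩ := hω
    simp only [Set.mem_iUnion]
    exact ⟨(u, v), Finset.mem_offDiag.2 ⟨hu, hv, hne⟩, h⟩
  refine (measureReal_mono hsub (measure_ne_top _ _)).trans ((measureReal_biUnion_finset_le _ _).trans ?_)
  refine (Finset.sum_le_card_nsmul _ _ (1 / (n : ℝ)) fun p hp =>
    measure_idOf_eq (Finset.mem_offDiag.1 hp).2.2).trans ?_
  rw [nsmul_eq_mul, mul_one_div]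
  gcongr
  rw [Finset.offDiag_card, ← pow_two]
  exact_mod_cast Nat.sub_le _ _

/-- Either two identifiers collide, which the union bound controls, or the identifiers on the region
extend to valid ones. Given such identifiers, the random bits are still distributed as in the model,
and the algorithm fails with probability at most 1/n. -/
theorem measure_randLabel_fail [Fintype L] {P : LCL δ L} (hG : listsLE δ (4 * t + 3) ⊆ G.nodes)
    {c : ℕ} (hc : 1 ≤ c)
    (hA : ∀ ids, ValidIds c G ids → (∀ v ∈ G.nodes, ∀ a : L,
      MeasurableSet {rnd | A.result G ids rnd t v = a}) ∧
      1 - 1 / (G.size : ℝ) ≤ (nodeStreams δ).real {rnd | P.IsSolution G (A.result G ids rnd t)})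
    (z : Fin δ) (a₀ : L) :
    (jointLaw δ G.size).real {ω | ∃ v : List (Fin δ), t + 1 ≤ v.length ∧ v.length ≤ 3 * t + 1 ∧
      ¬ P.Allows (randLabel t (localLabel A G t z a₀) ω v)
        fun i => randLabel t (localLabel A G t z a₀) ω (i :: v)} ≤
      ((listsLE δ (4 * t + 3)).card ^ 2 + 1) / G.size := by
  classical
  set J := listsLE δ (4 * t + 3) with hJ
  set μ := jointLaw δ G.size with hμ
  have hext : ∀ f : J → Fin G.size, ∃ ids, Function.Injective f →
      ValidIds c G ids ∧ ∀ v : J, ids v = f v + 1 := by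
    intro f
    by_cases hf : Function.Injective f
    · obtain ⟨ids, h1, h2⟩ := exists_validIds G hc hG
        (fun v => if h : v ∈ J then f ⟨v, h⟩ else 0) (by
          intro v hv v' hv' h
          have hv2 : v ∈ J := hv
          have hv2' : v' ∈ J := hv'
          simp only [hv2, hv2', dif_pos] at h
          exact congrArg Subtype.val (hf h))
      refine ⟨ids, fun _ => ⟨h1, fun v => ?_⟩⟩
      rw [h2 v v.2]
      simp
    · exact ⟨fun _ => 0, fun h => absurd h hf⟩
  choose ids hids using hext
  set fail : (List (Fin δ) → ℕ) → (List (Fin δ) → ℕ → Bool) → Prop := fun i rnd =>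
    ∃ v : List (Fin δ), t + 1 ≤ v.length ∧ v.length ≤ 3 * t + 1 ∧
      ¬ P.Allows (A.result G i rnd t v) fun j => A.result G i rnd t (j :: v) with hfail
  have hcongr : ∀ (i i' : List (Fin δ) → ℕ) (rnd rnd' : List (Fin δ) → ℕ → Bool),
      (∀ v ∈ J, i v = i' v) → (∀ v ∈ J, rnd v = rnd' v) → fail i rnd → fail i' rnd' := by
    rintro i i' rnd rnd' hi hr ⟨v, h1, h2, h3⟩
    refine ⟨v, h1, h2, ?_⟩
    have key : ∀ u : List (Fin δ), t + 1 ≤ u.length → u.length ≤ 3 * t + 2 →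
        A.result G i rnd t u = A.result G i' rnd' t u := by
      intro u hu1 hu2
      have hne : u.drop t ≠ [] := by
        intro h
        have := congrArg List.length h
        simp at this
        omega
      have h4 := A.run_congr G (q := u.drop t) (q' := u.drop t) (b := 2 * t) (ids := i)
        (ids' := i') (rnd := rnd) (rnd' := rnd') hne hne
        (fun x hx j => hG (mem_listsLE.2 (by simp; omega)))
        (fun x hx j => hG (mem_listsLE.2 (by simp; omega))) z.pos
        (fun x hx => hi _ (mem_listsLE.2 (by simp; omega)))
        (fun x hx => hr _ (mem_listsLE.2 (by simp; omega))) t (u.take t) (by simp; omega)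
        (by simp; omega)
      rw [List.take_append_drop] at h4
      unfold DistAlg.result
      rw [h4]
    rw [← key v h1 (by omega)]
    simp only [← key (_ :: v) (by simp; omega) (by simp; omega)]
    exact h3
  set cyl : (J → Fin G.size) → Set (Coord δ → Sample G.size) := fun f =>
    (fun ω (v : J) => idOf ω v) ⁻¹' {f} with hcyl
  have hcylm : ∀ f, MeasurableSet (cyl f) := by
    intro f
    have : cyl f = ⋂ u : J, {ω | idOf ω u = f u} := by ext; simp [hcyl, funext_iff]
    rw [this]
    exact MeasurableSet.iInter fun u => measurableSet_idOf _ _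
  have hsub : {ω | ∃ v : List (Fin δ), t + 1 ≤ v.length ∧ v.length ≤ 3 * t + 1 ∧
      ¬ P.Allows (randLabel t (localLabel A G t z a₀) ω v)
        fun i => randLabel t (localLabel A G t z a₀) ω (i :: v)} ⊆
      {ω | ¬ Set.InjOn (idOf ω) J} ∪
        ⋃ f ∈ Finset.univ.filter fun f : J → Fin G.size => Function.Injective f,
          (cyl f ∩ bitsOf ⁻¹' {rnd | fail (ids f) rnd}) := by
    rintro ω ⟨v, h1, h2, h3⟩
    by_cases hω : Set.InjOn (idOf ω) J
    · right
      simp only [Set.mem_iUnion]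
      have hinj : Function.Injective fun v : J => idOf ω v :=
        fun u u' h => Subtype.ext (hω u.2 u'.2 h)
      refine ⟨fun v => idOf ω v, Finset.mem_filter.2 ⟨Finset.mem_univ _, hinj⟩, rfl, ?_⟩
      have h4 : fail (fun v => idOf ω v + 1) (bitsOf ω) := by
        refine ⟨v, h1, h2, ?_⟩
        rw [randLabel_localLabel hG z a₀ hω h1 (by omega)] at h3
        simp only [randLabel_localLabel hG z a₀ hω (v := _ :: v) (by simp; omega)
          (by simp; omega)] at h3
        exact h3
      exact hcongr _ _ _ _ (fun u hu => ((hids _ hinj).2 ⟨u, hu⟩).symm) (fun _ _ => rfl) h4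
    · exact Or.inl hω
  refine (measureReal_mono hsub (measure_ne_top _ _)).trans ((measureReal_union_le _ _).trans ?_)
  rw [add_div]
  refine add_le_add (measure_not_injOn J) ?_
  refine (measureReal_biUnion_finset_le _ _).trans ?_
  -- The cell is an event of the left coordinates and the failure for fixed identifiers one of the
  -- right coordinates.
  have hind : ∀ f ∈ Finset.univ.filter fun f : J → Fin G.size => Function.Injective f,
      μ.real (cyl f ∩ bitsOf ⁻¹' {rnd | fail (ids f) rnd}) ≤ μ.real (cyl f) * (1 / G.size) := by
    intro f hf
    have hf' := (Finset.mem_filter.1 hf).2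
    obtain ⟨h1, h2⟩ := measure_fail_le hG hA (hids f hf').1 z.pos
    have h3 := measure_inter_eq_mul (sampleLaw G.size) (S := J.map Function.Embedding.inl)
      (T := J.map Function.Embedding.inr) (A := cyl f)
      (B := bitsOf ⁻¹' {rnd | fail (ids f) rnd}) (by
        rw [Finset.disjoint_left]
        intro i hi hi'
        simp only [Finset.mem_map, Function.Embedding.inl_apply, Function.Embedding.inr_apply]
          at hi hi'
        obtain ⟨u, -, rfl⟩ := hi
        obtain ⟨u', -, h⟩ := hi'
        cases h) (hcylm f) (measurable_bitsOf h1) (by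
        intro ω ω' h hω
        have hω' : (fun v : J => idOf ω v) = f := hω
        show (fun v : J => idOf ω' v) = f
        rw [← hω']
        funext v
        unfold idOf
        rw [h (Sum.inl ↑v) (Finset.mem_map_of_mem Function.Embedding.inl v.2)]) (by
        intro ω ω' h hω
        refine hcongr _ _ _ _ (fun _ _ => rfl) (fun v hv => ?_) hω
        unfold bitsOf
        rw [h (Sum.inr v) (Finset.mem_map_of_mem Function.Embedding.inr hv)])
    refine h3.le.trans ?_
    refine mul_le_mul_of_nonneg_left ?_ measureReal_nonneg
    have h4 := (measurePreserving_bitsOf (δ := δ) (n := G.size)).measureReal_preimage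
      h1.nullMeasurableSet
    exact h4.le.trans h2
  refine (Finset.sum_le_sum hind).trans ?_
  rw [← Finset.sum_mul]
  refine mul_le_of_le_one_left (by positivity) ?_
  refine (Finset.sum_le_sum_of_subset_of_nonneg (Finset.subset_univ _)
    fun _ _ _ => measureReal_nonneg).trans ?_
  rw [sum_measureReal_preimage_singleton _ fun f _ => hcylm f]
  exact measureReal_le_one

end Lower

/-- An algorithm that is fast on one tree of large size makes the search succeed. -/
theorem isSome_of_fast {δ : ℕ} (hδ : 0 < δ) {L : Type} [Fintype L] [DecidableEq L] {P : LCL δ L}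
    (hP : P.labels = Finset.univ) {c : ℕ} (hc : 1 ≤ c) {T : ℕ → ℕ}
    (h : P.SolvableIn .localModel .randomized c T) (G₀ : FullTree δ) {K : ℕ}
    (hK : K = 4 * (Fintype.card L + 1) * (4 * (Fintype.card L + 1) ^ 2) ^ (Fintype.card L + 1) *
      (δ + 1) ^ (4 * (Fintype.card L + 3)))
    (hn : K * ((δ + 1) ^ (4 * (Fintype.card L + 3))) ^ T G₀.size < G₀.size) :
    P.findCertificate.isSome = true := by
  obtain ⟨A, -, hA⟩ := h
  set k := Fintype.card L with hk
  set t := T G₀.size with ht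
  set Q := (δ + 1) ^ (4 * t + 4) with hQ
  have hQ1 : 1 ≤ Q := Nat.one_le_pow _ _ (by omega)
  -- All powers of δ + 1 are collected: (4t + 4)(k + 3) = 4(k + 3) + 4(k + 3) t, so one factor
  -- belongs to K and the other is exponential in t.
  have hKn : 4 * (k + 1) * (4 * (k + 1) ^ 2 * Q) ^ (k + 1) * Q ^ 2 < G₀.size := by
    refine lt_of_le_of_lt (le_of_eq ?_) hn
    rw [hK, hQ]
    have : ((δ + 1) ^ (4 * t + 4)) ^ (k + 1) * ((δ + 1) ^ (4 * t + 4)) ^ 2 =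
        (δ + 1) ^ (4 * (k + 3)) * ((δ + 1) ^ (4 * (k + 3))) ^ t := by
      rw [← pow_mul, ← pow_mul, ← pow_mul, ← pow_add, ← pow_add]
      congr 1
      ring
    rw [mul_pow (4 * (k + 1) ^ 2), ← mul_assoc, mul_assoc _ (_ ^ (k + 1)), this, ← mul_assoc]
  have hMQ : 1 ≤ (4 * (k + 1) ^ 2 * Q) ^ (k + 1) := Nat.one_le_pow _ _ (by positivity)
  have hQn : Q ≤ G₀.size := by
    refine le_trans ?_ hKn.le
    calc Q ≤ Q ^ 2 := Nat.le_self_pow (by norm_num) _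
      _ ≤ _ := Nat.le_mul_of_pos_left _ (by positivity)
  have hJ : (listsLE δ (4 * t + 3)).card ≤ Q := card_listsLE_le δ (4 * t + 3)
  obtain ⟨G, hGs, hG⟩ := exists_tree_containing hδ G₀ (4 * t + 3) (hJ.trans hQn)
  rw [← hGs] at ht hKn
  have hA' : ∀ ids, ValidIds c G ids → (∀ v ∈ G.nodes, ∀ a : L,
      MeasurableSet {rnd | (A G.size).result G ids rnd t v = a}) ∧
      1 - 1 / (G.size : ℝ) ≤
        (nodeStreams δ).real {rnd | P.IsSolution G ((A G.size).result G ids rnd t)} := by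
    rw [ht]
    exact hA G
  clear_value t
  have z : Fin δ := ⟨0, hδ⟩
  -- The default label after a collision is arbitrary; the algorithm itself shows that one exists.
  set a₀ : L := (A G.size).output ((A G.size).init ⟨0, False, False⟩ fun _ => false)
  have hfail := measure_randLabel_fail hG hc hA' z a₀
  obtain ⟨S, hS, hSc⟩ := reach_of_probable z hP (sampleLaw G.size)
    (fun w a hw => measurableSet_localLabel hG hc (fun ids hids => (hA' ids hids).1) z a₀ w a hw)
    (fun w η η' hw h => localLabel_congr hG z a₀ w η η' hw h) hfail
    (M := 4 * (k + 1) ^ 2 * Q) (by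
      have h1 : (listsLE δ (2 * t + 1)).card ≤ Q :=
        (Finset.card_le_card fun v hv => mem_listsLE.2
          ((mem_listsLE.1 hv).trans (by omega))).trans hJ
      have h2 : 4 * k ^ 2 * (listsLE δ (2 * t + 1)).card ≤ 4 * (k + 1) ^ 2 * Q := by gcongr; omega
      exact_mod_cast h2) (by
      have : 1 ≤ 4 * (k + 1) ^ 2 * Q := Nat.one_le_iff_ne_zero.2 (by positivity)
      exact_mod_cast this) (by
      have hn0 : (0 : ℝ) < G.size := by exact_mod_cast Nat.pos_of_ne_zero (NeZero.ne G.size)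
      rw [inv_pow, mul_assoc, div_mul_eq_mul_div, ← mul_div_assoc, div_lt_iff₀ hn0,
        ← div_eq_inv_mul, lt_div_iff₀ (by positivity)]
      have h1 : k * (((listsLE δ (4 * t + 3)).card ^ 2 + 1) * 2) *
          (4 * (k + 1) ^ 2 * Q) ^ (k + 1) < G.size := by
        refine lt_of_le_of_lt ?_ hKn
        have h2 : (listsLE δ (4 * t + 3)).card ^ 2 + 1 ≤ 2 * Q ^ 2 := by
          have := Nat.pow_le_pow_left hJ 2
          have := Nat.one_le_pow 2 Q hQ1
          omega
        calc k * (((listsLE δ (4 * t + 3)).card ^ 2 + 1) * 2) * (4 * (k + 1) ^ 2 * Q) ^ (k + 1)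
            ≤ (k + 1) * (2 * Q ^ 2 * 2) * (4 * (k + 1) ^ 2 * Q) ^ (k + 1) := by gcongr; omega
          _ = _ := by ring
      exact_mod_cast h1)
  exact (findCertificate_isSome_iff P).2 ⟨S, by rw [hP]; exact Finset.subset_univ _, hS, hSc⟩

/-- If log n > 2 T log a, then a ^ (2T) ≤ n, and n > K² gives K a ^ T < n. By `isSome_of_fast` a
single such size would let the search succeed. -/
theorem complexityOmega_of_isNone {δ : ℕ} (hδ : 0 < δ) {L : Type} [Fintype L] [DecidableEq L]
    {P : LCL δ L} (hP : P.labels = Finset.univ) (h : P.findCertificate.isSome = false)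
    (cm : Communication) (rm : Randomness) {c : ℕ} (hc : 1 ≤ c) :
    P.ComplexityOmega cm rm c fun n => Real.log n := by
  intro T hT
  set a := (δ + 1) ^ (4 * (Fintype.card L + 3)) with ha
  set K := 4 * (Fintype.card L + 1) * (4 * (Fintype.card L + 1) ^ 2) ^ (Fintype.card L + 1) * a
    with hK
  refine Asymptotics.IsBigO.of_bound (2 * Real.log a) ?_
  unfold treeSizes
  rw [eventually_inf_principal]
  filter_upwards [eventually_gt_atTop (K ^ 2)] with n hn hG
  obtain ⟨G₀, rfl⟩ := hG
  by_contra hlog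
  have ha1 : 1 ≤ a := Nat.one_le_pow _ _ (by omega)
  have hn0 : 0 < G₀.size := by omega
  have hn1 : (0 : ℝ) < G₀.size := by exact_mod_cast hn0
  have hn2 : (1 : ℝ) ≤ G₀.size := by exact_mod_cast hn0
  rw [not_le, Real.norm_of_nonneg (by positivity), Real.norm_of_nonneg (Real.log_nonneg hn2)] at hlog
  have h1 : (a ^ T G₀.size) ^ 2 ≤ G₀.size := by
    have h2 : Real.log (((a : ℝ) ^ T G₀.size) ^ 2) ≤ Real.log G₀.size := by
      rw [Real.log_pow, Real.log_pow]
      push_cast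
      linarith
    have h3 := (Real.log_le_log_iff (by positivity) hn1).1 h2
    exact_mod_cast h3
  have h2 : K * a ^ T G₀.size < G₀.size := by
    refine lt_of_pow_lt_pow_left₀ 2 (Nat.zero_le _) ?_
    rw [mul_pow]
    calc K ^ 2 * (a ^ T G₀.size) ^ 2 ≤ K ^ 2 * G₀.size := Nat.mul_le_mul_left _ h1
      _ < G₀.size * G₀.size := Nat.mul_lt_mul_of_pos_right hn hn0
      _ = G₀.size ^ 2 := by ring
  have := isSome_of_fast hδ hP hc (solvableIn_weakest hT) G₀ hK h2
  rw [h] at this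
  simp at this

/-! ### The two cases exclude each other -/

theorem logStar_le_of_le_tower {n k : ℕ} (h : n ≤ tower k) : logStar n ≤ k := Nat.sInf_le h

theorem treeSizes_neBot {δ : ℕ} (hδ : 0 < δ) : (treeSizes δ).NeBot := by
  unfold treeSizes
  rw [inf_principal_neBot_iff]
  intro U hU
  obtain ⟨N, hN⟩ := mem_atTop_sets.1 hU
  refine ⟨(completeTree δ N).size, hN _ ?_, completeTree δ N, rfl⟩
  -- A single path to the lowest level has N + 1 nodes; this covers δ = 1 as well.
  have : ((Finset.range (N + 1)).image fun i => List.replicate i (⟨0, hδ⟩ : Fin δ)).card ≤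
      (listsLE δ N).card := by
    refine Finset.card_le_card fun v hv => ?_
    obtain ⟨i, hi, rfl⟩ := Finset.mem_image.1 hv
    rw [mem_listsLE, List.length_replicate]
    exact Nat.lt_succ_iff.1 (Finset.mem_range.1 hi)
  rw [Finset.card_image_of_injective _ (List.replicate_left_injective _), Finset.card_range] at this
  exact (Nat.le_succ N).trans this

/-- Two applications of `Nat.clog` lower log* by at most two, so log* n is at most clog (clog n) +
2, an iterated logarithm of order two. -/
theorem logStar_isLittleO_log :
    (fun n : ℕ => (logStar n : ℝ)) =o[atTop] fun n : ℕ => Real.log n := by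
  have hclog : (fun n : ℕ => (Nat.clog 2 n : ℝ)) =O[atTop] fun n : ℕ => Real.log n := by
    refine Asymptotics.IsBigO.of_bound (1 / Real.log 2 + 1 / Real.log 2) ?_
    filter_upwards [eventually_ge_atTop 2] with n hn
    have h2 : 0 < Real.log 2 := Real.log_pos (by norm_num)
    have hn2 : Real.log 2 ≤ Real.log n := Real.log_le_log (by norm_num) (by exact_mod_cast hn)
    rw [Real.norm_of_nonneg (by positivity), Real.norm_of_nonneg (h2.le.trans hn2)]
    have h3 : Nat.clog 2 n ≤ Nat.log 2 n + 1 :=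
      Nat.clog_le_of_le_pow (Nat.lt_pow_succ_log_self (by norm_num) n).le
    have h4 : (Nat.log 2 n : ℝ) * Real.log 2 ≤ Real.log n := by
      rw [← Real.log_pow]
      exact Real.log_le_log (by positivity) (by exact_mod_cast Nat.pow_log_le_self 2 (by omega))
    have h5 : (Nat.clog 2 n : ℝ) ≤ Nat.log 2 n + 1 := by exact_mod_cast h3
    rw [← add_div, div_mul_eq_mul_div, le_div_iff₀ h2]
    nlinarith
  have hstep : ∀ n, logStar n ≤ logStar (Nat.clog 2 n) + 1 := fun n =>
    logStar_le_of_le_tower ((Nat.le_pow_clog (by norm_num) n).trans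
      (Nat.pow_le_pow_right (by norm_num) (le_tower_logStar _)))
  have hself : ∀ n, logStar n ≤ n := fun n => logStar_le_of_le_tower (lt_tower n).le
  have hlog : Tendsto (fun n : ℕ => Real.log n) atTop atTop :=
    Real.tendsto_log_atTop.comp tendsto_natCast_atTop_atTop
  have hone : ∀ c : ℝ, (fun _ : ℕ => c) =o[atTop] fun n : ℕ => Real.log n := fun c =>
    Asymptotics.isLittleO_const_left.2 (Or.inr (tendsto_norm_atTop_atTop.comp hlog))
  have hclog2 : (fun n : ℕ => (Nat.clog 2 (Nat.clog 2 n) : ℝ)) =o[atTop]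
      fun n : ℕ => Real.log n := by
    have ht : Tendsto (fun n : ℕ => Nat.clog 2 n) atTop atTop :=
      tendsto_atTop_atTop_of_monotone (fun _ _ h => Nat.clog_mono_right 2 h)
        fun b => ⟨2 ^ b, (Nat.clog_pow 2 b (by norm_num)).ge⟩
    have h1 : (fun m : ℕ => (Nat.clog 2 m : ℝ)) =o[atTop] fun m : ℕ => (m : ℝ) :=
      hclog.trans_isLittleO (Real.isLittleO_log_id_atTop.comp_tendsto tendsto_natCast_atTop_atTop)
    exact (h1.comp_tendsto ht).trans_isBigO hclog
  refine Asymptotics.IsBigO.trans_isLittleO (Asymptotics.IsBigO.of_bound 1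
    (Eventually.of_forall fun n => ?_)) (hclog2.add (hone 2))
  have : logStar n ≤ Nat.clog 2 (Nat.clog 2 n) + 2 :=
    (hstep n).trans (by have := hstep (Nat.clog 2 n); have := hself (Nat.clog 2 (Nat.clog 2 n)); omega)
  rw [one_mul, Real.norm_of_nonneg (by positivity), Real.norm_of_nonneg (by positivity)]
  exact_mod_cast this

theorem not_complexityO_and_complexityOmega {δ : ℕ} (hδ : 0 < δ) {L : Type} {P : LCL δ L}
    {cm : Communication} {rm : Randomness} {c : ℕ}
    (hO : P.ComplexityO cm rm c fun n => (logStar n : ℝ))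
    (hΩ : P.ComplexityOmega cm rm c fun n => Real.log n) : False := by
  obtain ⟨T, hT, hTO⟩ := hO
  have := treeSizes_neBot hδ
  -- Along the sizes of trees, log = O(T) = O(log*) = o(log), which is absurd since the sizes are
  -- unbounded.
  have h1 : (fun n : ℕ => Real.log n) =o[treeSizes δ] fun n : ℕ => Real.log n :=
    ((hΩ T hT).trans hTO).trans_isLittleO (logStar_isLittleO_log.mono inf_le_left)
  have h2 := h1.bound (show (0 : ℝ) < 1 / 2 by norm_num)
  obtain ⟨n, h3, h4⟩ := (h2.and (eventually_treeSizes (eventually_ge_atTop 2))).exists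
  have h5 : 0 < Real.log n := Real.log_pos (by exact_mod_cast h4)
  rw [Real.norm_of_nonneg h5.le] at h3
  linarith

/-! ### A while language over stacks of bits -/

/-- Programs that work on stacks of bits, one for every element of `K`. The conditions of `cond`
and `loop` are tests of the top of a stack. -/
inductive StackProg (K : Type) : Type
  | skip
  | push (k : K) (b : Bool)
  | pop (k : K)
  | seq (p q : StackProg K)
  | cond (k : K) (test : Option Bool → Bool) (p q : StackProg K)
  | loop (k : K) (test : Option Bool → Bool) (p : StackProg K)

namespace StackProg

variable {K : Type} [DecidableEq K]

/-- `p.Exec t s s'` says that `p` turns the stacks `s` into `s'` within `t` steps. -/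
inductive Exec : StackProg K → ℕ → (K → List Bool) → (K → List Bool) → Prop
  | skip {t s} (ht : 1 ≤ t) : Exec .skip t s s
  | push {k b t s} (ht : 1 ≤ t) : Exec (.push k b) t s (Function.update s k (b :: s k))
  | pop {k t s} (ht : 1 ≤ t) : Exec (.pop k) t s (Function.update s k (s k).tail)
  | seq {p q t₁ t₂ t s s₁ s₂} (h₁ : Exec p t₁ s s₁) (h₂ : Exec q t₂ s₁ s₂) (ht : t₁ + t₂ ≤ t) :
      Exec (.seq p q) t s s₂
  | cond_true {k test p q t₁ t s s₁} (hk : test (s k).head? = true) (h : Exec p t₁ s s₁)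
      (ht : t₁ + 1 ≤ t) : Exec (.cond k test p q) t s s₁
  | cond_false {k test p q t₁ t s s₁} (hk : test (s k).head? = false) (h : Exec q t₁ s s₁)
      (ht : t₁ + 1 ≤ t) : Exec (.cond k test p q) t s s₁
  | loop_false {k test p t s} (hk : test (s k).head? = false) (ht : 1 ≤ t) :
      Exec (.loop k test p) t s s
  | loop_true {k test p t₁ t₂ t s s₁ s₂} (hk : test (s k).head? = true) (h₁ : Exec p t₁ s s₁)
      (h₂ : Exec (.loop k test p) t₂ s₁ s₂) (ht : t₁ + t₂ + 1 ≤ t) :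
      Exec (.loop k test p) t s s₂

theorem Exec.mono {p : StackProg K} {t t' : ℕ} {s s' : K → List Bool} (h : p.Exec t s s')
    (ht : t ≤ t') : p.Exec t' s s' := by
  cases h with
  | skip h => exact .skip (h.trans ht)
  | push h => exact .push (h.trans ht)
  | pop h => exact .pop (h.trans ht)
  | seq h₁ h₂ h => exact .seq h₁ h₂ (h.trans ht)
  | cond_true hk h₁ h => exact .cond_true hk h₁ (h.trans ht)
  | cond_false hk h₁ h => exact .cond_false hk h₁ (h.trans ht)
  | loop_false hk h => exact .loop_false hk (h.trans ht)
  | loop_true hk h₁ h₂ h => exact .loop_true hk h₁ h₂ (h.trans ht)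

/-- A loop that makes `n` passes through the states `F 0, …, F n`. -/
theorem Exec.loop {k : K} {test : Option Bool → Bool} {p : StackProg K} {n t : ℕ}
    (F : ℕ → K → List Bool) (h : ∀ i < n, test (F i k).head? = true ∧ p.Exec t (F i) (F (i + 1)))
    (hn : test (F n k).head? = false) :
    (StackProg.loop k test p).Exec (n * (t + 1) + 1) (F 0) (F n) := by
  induction n generalizing F with
  | zero => exact .loop_false hn (by omega)
  | succ n ih =>
    refine .loop_true (h 0 (by omega)).1 (h 0 (by omega)).2
      (ih (fun i => F (i + 1)) (fun i hi => h (i + 1) (by omega)) hn) ?_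
    rw [Nat.succ_mul]
    omega

/-- The labels of the machine for a program. -/
def Lab : StackProg K → Type
  | .skip => Unit
  | .push _ _ => Unit
  | .pop _ => Unit
  | .seq p q => Lab p ⊕ Lab q
  | .cond _ _ p q => Option (Lab p ⊕ Lab q)
  | .loop _ _ p => Option (Lab p)

instance Lab.fintype : (p : StackProg K) → Fintype (Lab p)
  | .skip => inferInstanceAs (Fintype Unit)
  | .push _ _ => inferInstanceAs (Fintype Unit)
  | .pop _ => inferInstanceAs (Fintype Unit)
  | .seq p q =>
    have := Lab.fintype p
    have := Lab.fintype q
    inferInstanceAs (Fintype (Lab p ⊕ Lab q))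
  | .cond _ _ p q =>
    have := Lab.fintype p
    have := Lab.fintype q
    inferInstanceAs (Fintype (Option (Lab p ⊕ Lab q)))
  | .loop _ _ p =>
    have := Lab.fintype p
    inferInstanceAs (Fintype (Option (Lab p)))

/-- The label at which a program starts. -/
def entry : (p : StackProg K) → Lab p
  | .skip => ()
  | .push _ _ => ()
  | .pop _ => ()
  | .seq p _ => Sum.inl (entry p)
  | .cond _ _ _ _ => none
  | .loop _ _ _ => none

/-- The statement that goes to one of two labels according to a test of the top of a stack. -/
def branchTo {Λ : Type} (k : K) (test : Option Bool → Bool) (l l' : Λ) :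
    Turing.TM2.Stmt (fun _ : K => Bool) Λ (Option Bool) :=
  -- The internal state is reset before the jump, so every label is entered with state `none`.
  .peek k (fun _ o => o) (.branch test (.load (fun _ => none) (.goto fun _ => l))
    (.load (fun _ => none) (.goto fun _ => l')))

/-- The statements of the machine for a program, where the labels are embedded into `Λ` and the
program goes to the label `out` at its end. -/
def code {Λ : Type} : (p : StackProg K) → (Lab p → Λ) → Λ → Lab p →
    Turing.TM2.Stmt (fun _ : K => Bool) Λ (Option Bool)
  | .skip, _, out, _ => .goto fun _ => out
  | .push k b, _, out, _ => .push k (fun _ => b) (.goto fun _ => out)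
  | .pop k, _, out, _ => .pop k (fun v _ => v) (.goto fun _ => out)
  | .seq p q, emb, out, l =>
    match l with
    | .inl l => code p (fun l => emb (.inl l)) (emb (.inr (entry q))) l
    | .inr l => code q (fun l => emb (.inr l)) out l
  | .cond k test p q, emb, out, l =>
    match l with
    | none => branchTo k test (emb (some (.inl (entry p)))) (emb (some (.inr (entry q))))
    | some (.inl l) => code p (fun l => emb (some (.inl l))) out l
    | some (.inr l) => code q (fun l => emb (some (.inr l))) out l
  | .loop k test p, emb, out, l =>
    match l with
    | none => branchTo k test (emb (some (entry p))) out
    | some l => code p (fun l => emb (some l)) (emb none) l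

/-- `m` can get from the label `l` and the stacks `s` to `l'` and `s'` within `t` steps. -/
def Leads {Λ : Type} (m : Λ → Turing.TM2.Stmt (fun _ : K => Bool) Λ (Option Bool)) (t : ℕ) (l : Λ)
    (s : K → List Bool) (l' : Λ) (s' : K → List Bool) : Prop :=
  ∃ u ≤ t, (flip Bind.bind (Turing.TM2.step m))^[u] (some ⟨some l, none, s⟩) = some ⟨some l', none, s'⟩

theorem Leads.trans {Λ : Type} {m : Λ → Turing.TM2.Stmt (fun _ : K => Bool) Λ (Option Bool)}
    {t t' : ℕ} {l l' l'' : Λ} {s s' s'' : K → List Bool} (h : Leads m t l s l' s')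
    (h' : Leads m t' l' s' l'' s'') : Leads m (t + t') l s l'' s'' := by
  obtain ⟨u, hu, h⟩ := h
  obtain ⟨u', hu', h'⟩ := h'
  refine ⟨u' + u, by omega, ?_⟩
  rw [Function.iterate_add_apply, h, h']

theorem Leads.mono {Λ : Type} {m : Λ → Turing.TM2.Stmt (fun _ : K => Bool) Λ (Option Bool)}
    {t t' : ℕ} {l l' : Λ} {s s' : K → List Bool} (h : Leads m t l s l' s') (ht : t ≤ t') :
    Leads m t' l s l' s' := by
  obtain ⟨u, hu, h⟩ := h
  exact ⟨u, hu.trans ht, h⟩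

theorem leads_of_step {Λ : Type} {m : Λ → Turing.TM2.Stmt (fun _ : K => Bool) Λ (Option Bool)}
    {l l' : Λ} {s s' : K → List Bool}
    (h : Turing.TM2.stepAux (m l) none s = ⟨some l', none, s'⟩) : Leads m 1 l s l' s' := by
  refine ⟨1, le_rfl, ?_⟩
  rw [Function.iterate_one]
  exact congrArg some h

theorem leads_branchTo {Λ : Type} {m : Λ → Turing.TM2.Stmt (fun _ : K => Bool) Λ (Option Bool)}
    {l l₁ l₂ : Λ} {k : K} {test : Option Bool → Bool} (h : m l = branchTo k test l₁ l₂)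
    (s : K → List Bool) : Leads m 1 l s (if test (s k).head? then l₁ else l₂) s := by
  refine leads_of_step ?_
  rw [h]
  cases ht : test (s k).head? <;> simp [branchTo, Turing.TM2.stepAux, ht]

/-- The machine for a program does what the program does. -/
theorem Exec.leads {Λ : Type} {m : Λ → Turing.TM2.Stmt (fun _ : K => Bool) Λ (Option Bool)}
    {p : StackProg K} {t : ℕ} {s s' : K → List Bool} (h : p.Exec t s s') :
    ∀ {emb : Lab p → Λ} {out : Λ}, (∀ l, m (emb l) = code p emb out l) →
      Leads m t (emb (entry p)) s out s' := by
  induction h with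
  | skip ht =>
    intro emb out hm
    refine (leads_of_step ?_).mono ht
    rw [hm]
    rfl
  | push ht =>
    intro emb out hm
    refine (leads_of_step ?_).mono ht
    rw [hm]
    rfl
  | pop ht =>
    intro emb out hm
    refine (leads_of_step ?_).mono ht
    rw [hm]
    rfl
  | @seq p q t₁ t₂ t s s₁ s₂ h₁ h₂ ht ih₁ ih₂ =>
    intro emb out hm
    exact ((ih₁ (emb := fun l => emb (.inl l)) fun l => hm (.inl l)).trans
      (ih₂ (emb := fun l => emb (.inr l)) fun l => hm (.inr l))).mono ht
  | @cond_true k test p q t₁ t s s₁ hk h ht ih =>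
    intro emb out hm
    have h₁ := leads_branchTo (hm none) s
    rw [if_pos hk] at h₁
    exact (h₁.trans (ih (emb := fun l => emb (some (.inl l))) fun l => hm (some (.inl l)))).mono
      (by omega)
  | @cond_false k test p q t₁ t s s₁ hk h ht ih =>
    intro emb out hm
    have h₁ := leads_branchTo (hm none) s
    rw [if_neg (by simp [hk])] at h₁
    exact (h₁.trans (ih (emb := fun l => emb (some (.inr l))) fun l => hm (some (.inr l)))).mono
      (by omega)
  | @loop_false k test p t s hk ht =>
    intro emb out hm
    have h₁ := leads_branchTo (hm none) s
    rw [if_neg (by simp [hk])] at h₁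
    exact h₁.mono ht
  | @loop_true k test p t₁ t₂ t s s₁ s₂ hk h₁ h₂ ht ih₁ ih₂ =>
    intro emb out hm
    have h := leads_branchTo (hm none) s
    rw [if_pos hk] at h
    exact ((h.trans (ih₁ (emb := fun l => emb (some l)) fun l => hm (some l))).trans
      (ih₂ hm)).mono (by omega)

/-- The machine that runs a program and halts, with input stack `k₀` and output stack `k₁`. -/
def machine [Fintype K] (p : StackProg K) (k₀ k₁ : K) : Turing.FinTM2 where
  k₀ := k₀
  k₁ := k₁
  Γ _ := Bool
  Λ := Option (Lab p)
  main := some (entry p)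
  σ := Option Bool
  initialState := none
  m l := match l with
    | none => .halt
    | some l => code p some none l

/-- The stacks that are empty with the exception of the stack `k`. -/
def single (k : K) (l : List Bool) : K → List Bool := Function.update (fun _ => []) k l

theorem Exec.outputs [Fintype K] {p : StackProg K} {k₀ k₁ : K} {t : ℕ} {l l' : List Bool}
    (h : p.Exec t (single k₀ l) (single k₁ l')) :
    Nonempty (Turing.TM2OutputsInTime (p.machine k₀ k₁) l (some l') (t + 1)) := by
  obtain ⟨u, hu, h⟩ := h.leads (m := (p.machine k₀ k₁).m) (emb := some) (out := none) fun _ => rfl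
  have hst (k : K) (l : List Bool) : single k l k = l := Function.update_self _ _ _
  have hst' (k k' : K) (l : List Bool) (h : k' ≠ k) : single k l k' = [] :=
    Function.update_of_ne h _ _
  have hi : Turing.initList (p.machine k₀ k₁) l = ⟨some (some (entry p)), none, single k₀ l⟩ := by
    refine congrArg (Turing.TM2.Cfg.mk _ _) (funext fun k => ?_)
    by_cases hk : k = k₀
    · replace hk := hk.symm
      subst hk
      exact (dif_pos rfl).trans (hst k₀ l).symm
    · exact (dif_neg hk).trans (hst' _ _ l hk).symm
  have ho : Turing.haltList (p.machine k₀ k₁) l' = ⟨none, none, single k₁ l'⟩ := by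
    refine congrArg (Turing.TM2.Cfg.mk _ _) (funext fun k => ?_)
    by_cases hk : k = k₁
    · replace hk := hk.symm
      subst hk
      exact (dif_pos rfl).trans (hst k₁ l').symm
    · exact (dif_neg hk).trans (hst' _ _ l' hk).symm
  -- The additional step executes the halting statement at the final label.
  refine ⟨⟨⟨u + 1, ?_⟩, Nat.succ_le_succ hu⟩⟩
  rw [Function.iterate_succ_apply', hi]
  exact (congrArg _ h).trans (congrArg some ho).symm

end StackProg

/-! ### Expressions and commands -/

/-- The entry at a position of an array; beyond its end an array is `false`. -/
def rd (l : List Bool) (n : ℕ) : Bool := l.getD n false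

/-- The array with a new entry at position `n`. -/
def wr (l : List Bool) (n : ℕ) (b : Bool) : List Bool :=
  (List.range n).map (rd l) ++ b :: l.drop (n + 1)

theorem rd_wr (l : List Bool) (n i : ℕ) (b : Bool) :
    rd (wr l n b) i = if i = n then b else rd l i := by
  unfold wr
  rcases lt_trichotomy i n with h | h | h
  · rw [if_neg h.ne, rd, List.getD_append _ _ _ _ (by simpa using h)]
    simp [List.getD_eq_getElem?_getD, h]
  · subst h
    rw [if_pos rfl, rd, List.getD_append_right _ _ _ _ (by simp)]
    simp
  · rw [if_neg h.ne', rd, List.getD_append_right _ _ _ _ (by simpa using h.le)]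
    obtain ⟨j, rfl⟩ := Nat.exists_eq_add_of_lt h
    simp [rd, List.getD_eq_getElem?_getD, show n + j + 1 - n = j + 1 by omega,
      show n + 1 + j = n + j + 1 by omega]

/-- Expressions for numbers. In `loop x n a b`, the expression `b` is evaluated for every value of
`x` below `n`, and the variable `x + 1` has the value `a` before the first pass and the last value of
`b` after that. The arrays are the input and the memory. -/
inductive Expr : Type
  | zero
  | succ (e : Expr)
  | var (x : ℕ)
  | ite (e e₁ e₂ : Expr)
  | read (memory : Bool) (e : Expr)
  | bind (x : ℕ) (a b : Expr)
  | loop (x : ℕ) (n a b : Expr)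

/-- Commands that change the memory. -/
inductive Cmd : Type
  | assign (e : Expr) (b : Bool)
  | seq (c c' : Cmd)
  | when (e : Expr) (c : Cmd)
  | bind (x : ℕ) (e : Expr) (c : Cmd)
  | loop (x : ℕ) (n : Expr) (c : Cmd)

/-- The environment with new values for `x` and `x + 1`. -/
def upd (ρ : ℕ → ℕ) (x i v : ℕ) : ℕ → ℕ := Function.update (Function.update ρ x i) (x + 1) v

section Semantics

variable (N : ℕ) (inp : List Bool)

/-- `Ev N inp mem e ρ v` says that `e` has the value `v`, where all numbers on the way are at
most `N`. -/
inductive Ev (mem : List Bool) : Expr → (ℕ → ℕ) → ℕ → Prop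
  | zero {ρ} : Ev mem .zero ρ 0
  | succ {e ρ v} (h : Ev mem e ρ v) (hN : v + 1 ≤ N) : Ev mem (.succ e) ρ (v + 1)
  | var {x ρ} (hN : ρ x ≤ N) : Ev mem (.var x) ρ (ρ x)
  | ite_pos {e e₁ e₂ ρ v w} (h : Ev mem e ρ v) (hv : v ≠ 0) (h₁ : Ev mem e₁ ρ w) :
      Ev mem (.ite e e₁ e₂) ρ w
  | ite_zero {e e₁ e₂ ρ w} (h : Ev mem e ρ 0) (h₂ : Ev mem e₂ ρ w) : Ev mem (.ite e e₁ e₂) ρ w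
  | read {a e ρ v} (h : Ev mem e ρ v) (hN : 1 ≤ N) :
      Ev mem (.read a e) ρ (rd (bif a then mem else inp) v).toNat
  | bind {x a b ρ v w} (h : Ev mem a ρ v) (h' : Ev mem b (Function.update ρ x v) w) :
      Ev mem (.bind x a b) ρ w
  | loop {x n a b ρ k} (F : ℕ → ℕ) (hn : Ev mem n ρ k) (ha : Ev mem a ρ (F 0))
      (hb : ∀ i < k, Ev mem b (upd ρ x i (F i)) (F (i + 1))) : Ev mem (.loop x n a b) ρ (F k)

theorem Ev.le {N : ℕ} {inp mem : List Bool} {e : Expr} {ρ : ℕ → ℕ} {v : ℕ}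
    (h : Ev N inp mem e ρ v) : v ≤ N := by
  induction h with
  | zero => exact Nat.zero_le _
  | succ _ h _ => exact h
  | var h => exact h
  | ite_pos _ _ _ _ h => exact h
  | ite_zero _ _ _ h => exact h
  | read _ h _ => exact (Bool.toNat_le _).trans h
  | bind _ _ _ h => exact h
  | @loop x n a b ρ k F hn ha hb ihn iha ihb =>
    cases k with
    | zero => exact iha
    | succ k => exact ihb k (Nat.lt_succ_self k)

/-- `Run N inp c ρ mem mem'` says that `c` changes the memory from `mem` to `mem'`, where all
numbers on the way are at most `N`. -/
inductive Run : Cmd → (ℕ → ℕ) → List Bool → List Bool → Prop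
  | assign {e b ρ mem v} (h : Ev N inp mem e ρ v) : Run (.assign e b) ρ mem (wr mem v b)
  | seq {c c' ρ mem mem₁ mem₂} (h : Run c ρ mem mem₁) (h' : Run c' ρ mem₁ mem₂) :
      Run (.seq c c') ρ mem mem₂
  | when_pos {e c ρ mem mem₁ v} (h : Ev N inp mem e ρ v) (hv : v ≠ 0) (h' : Run c ρ mem mem₁) :
      Run (.when e c) ρ mem mem₁
  | when_zero {e c ρ mem} (h : Ev N inp mem e ρ 0) : Run (.when e c) ρ mem mem
  | bind {x e c ρ mem mem₁ v} (h : Ev N inp mem e ρ v)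
      (h' : Run c (Function.update ρ x v) mem mem₁) : Run (.bind x e c) ρ mem mem₁
  | loop {x n c ρ k} (F : ℕ → List Bool) (hn : Ev N inp (F 0) n ρ k)
      (h : ∀ i < k, Run c (Function.update ρ x i) (F i) (F (i + 1))) :
      Run (.loop x n c) ρ (F 0) (F k)

end Semantics

/-- The variables of the expression are numbered by their depth, where the first `d` variables are
free. -/
def Expr.wf : ℕ → Expr → Bool
  | _, .zero => true
  | d, .succ e => e.wf d
  | d, .var x => x < d
  | d, .ite e e₁ e₂ => e.wf d && e₁.wf d && e₂.wf d
  | d, .read _ e => e.wf d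
  | d, .bind x a b => x == d && a.wf d && b.wf (d + 1)
  | d, .loop x n a b => x == d && n.wf d && a.wf d && b.wf (d + 2)

def Cmd.wf : ℕ → Cmd → Bool
  | d, .assign e _ => e.wf d
  | d, .seq c c' => c.wf d && c'.wf d
  | d, .when e c => e.wf d && c.wf d
  | d, .bind x e c => x == d && e.wf d && c.wf (d + 1)
  | d, .loop x n c => x == d && n.wf d && c.wf (d + 1)

/-! ### Translation into stack programs -/

/-- The stacks: for every variable one that holds its value and one that counts the remaining
passes of its loop, a stack `acc` for values, the auxiliary stacks `aux` and `zip`, and the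
arrays. -/
inductive Stk (V : Type) : Type
  | reg (x : V)
  | cnt (x : V)
  | acc
  | aux
  | zip
  | arr (memory : Bool)
  deriving DecidableEq

/-- Unary numbers. -/
def ones (n : ℕ) : List Bool := List.replicate n true

theorem ones_succ (n : ℕ) : ones (n + 1) = true :: ones n := rfl

namespace StackProg

variable {K : Type}

def topOne (o : Option Bool) : Bool := o == some true

/-- Remove the ones from the top of `k`. -/
def clear (k : K) : StackProg K := .loop k topOne (.pop k)

/-- Move the ones from the top of `k` to `k'`. -/
def move (k k' : K) : StackProg K := .loop k topOne (.seq (.pop k) (.push k' true))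

/-- Move one bit from `k` to `k'`, if there is one, and otherwise do `p`. -/
def moveBit (k k' : K) (p : StackProg K) : StackProg K :=
  .cond k topOne (.seq (.pop k) (.push k' true))
    (.cond k Option.isSome (.seq (.pop k) (.push k' false)) p)

/-- Move everything from `k` to `k'`. -/
def moveAll (k k' : K) : StackProg K := .loop k Option.isSome (moveBit k k' .skip)

/-- Move as many bits from `k` to `k'` as there are ones on top of `c`. -/
def walk (c k k' : K) (p : StackProg K) : StackProg K :=
  .loop c topOne (.seq (.pop c) (moveBit k k' p))

variable [DecidableEq K]

theorem Exec.congr {p : StackProg K} {t : ℕ} {s s₁ s₂ : K → List Bool} (h : p.Exec t s s₁)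
    (hs : s₁ = s₂) : p.Exec t s s₂ := hs ▸ h

theorem Exec.congr_left {p : StackProg K} {t : ℕ} {s s₁ s₂ : K → List Bool} (h : p.Exec t s s₁)
    (hs : s₂ = s) : p.Exec t s₂ s₁ := hs ▸ h

theorem exec_clear {k : K} {s : K → List Bool} {n : ℕ} {r : List Bool} (hk : s k = ones n ++ r)
    (hr : topOne r.head? = false) : (clear k).Exec (n * 2 + 1) s (Function.update s k r) := by
  have h := Exec.loop (k := k) (test := topOne) (p := .pop k) (n := n) (t := 1)
    (fun i => Function.update s k (ones (n - i) ++ r)) (fun i hi => ?_) (by simpa [ones] using hr)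
  · have h0 : Function.update s k (ones (n - 0) ++ r) = s := by
      rw [Nat.sub_zero, ← hk, Function.update_eq_self]
    have hn : Function.update s k (ones (n - n) ++ r) = Function.update s k r := by simp [ones]
    rw [← hn]
    nth_rw 1 [← h0]
    exact h
  · obtain ⟨j, hj⟩ : ∃ j, n - i = j + 1 := ⟨n - i - 1, by omega⟩
    have hj' : n - (i + 1) = j := by omega
    refine ⟨by simp [hj, ones_succ, topOne], ?_⟩
    convert Exec.pop (K := K) le_rfl using 1
    simp [hj, hj', ones_succ]

theorem exec_move {k k' : K} (hne : k ≠ k') {s : K → List Bool} {n : ℕ} {r : List Bool}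
    (hk : s k = ones n ++ r) (hr : topOne r.head? = false) :
    (move k k').Exec (n * 3 + 1) s
      (Function.update (Function.update s k r) k' (ones n ++ s k')) := by
  have h := Exec.loop (k := k) (test := topOne) (p := .seq (.pop k) (.push k' true)) (n := n)
    (t := 2)
    (fun i => Function.update (Function.update s k (ones (n - i) ++ r)) k' (ones i ++ s k'))
    (fun i hi => ?_) (by simpa [ones, hne] using hr)
  · have h0 : Function.update (Function.update s k (ones (n - 0) ++ r)) k' (ones 0 ++ s k') = s := by
      rw [Nat.sub_zero, ← hk, Function.update_eq_self]
      exact Function.update_eq_self _ _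
    have hn : Function.update (Function.update s k (ones (n - n) ++ r)) k' (ones n ++ s k') =
      Function.update (Function.update s k r) k' (ones n ++ s k') := by simp [ones]
    rw [← hn]
    nth_rw 1 [← h0]
    exact h
  · obtain ⟨j, hj⟩ : ∃ j, n - i = j + 1 := ⟨n - i - 1, by omega⟩
    have hj' : n - (i + 1) = j := by omega
    refine ⟨by simp [hj, ones_succ, topOne, hne], ?_⟩
    refine .seq (.pop le_rfl) (t₂ := 1) ?_ le_rfl
    convert Exec.push (K := K) le_rfl using 1
    funext l
    by_cases h1 : l = k' <;> by_cases h2 : l = k <;>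
      simp_all [Function.update_apply, ones_succ]

theorem exec_moveBit {k k' : K} {p : StackProg K} (hne : k ≠ k') {s : K → List Bool} {b : Bool}
    {r : List Bool} (hk : s k = b :: r) :
    (moveBit k k' p).Exec 4 s (Function.update (Function.update s k r) k' (b :: s k')) := by
  have h : (StackProg.seq (.pop k) (.push k' b)).Exec 2 s
      (Function.update (Function.update s k r) k' (b :: s k')) := by
    refine .seq (.pop le_rfl) (t₂ := 1) ?_ le_rfl
    convert Exec.push (K := K) le_rfl using 1
    simp [hk, hne.symm]
  cases b with
  | true => exact .cond_true (by simp [hk, topOne]) h (by norm_num)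
  | false =>
    exact .cond_false (t₁ := 3) (by simp [hk, topOne]) (.cond_true (by simp [hk]) h le_rfl) le_rfl

theorem exec_moveBit_nil {k k' : K} {p : StackProg K} {s s' : K → List Bool} {t : ℕ}
    (hk : s k = []) (hp : p.Exec t s s') : (moveBit k k' p).Exec (t + 2) s s' :=
  .cond_false (t₁ := t + 1) (by simp [hk, topOne]) (.cond_false (by simp [hk]) hp le_rfl) le_rfl

theorem exec_moveAll {k k' : K} (hne : k ≠ k') (z : List Bool) : ∀ {s : K → List Bool},
    s k = z → (moveAll k k').Exec (z.length * 5 + 1) s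
      (Function.update (Function.update s k []) k' (z.reverse ++ s k')) := by
  induction z with
  | nil =>
    intro s hk
    refine Exec.congr (p := moveAll k k')
      (Exec.loop_false (by simp [hk]) (Nat.le_add_left _ _)) ?_
    have h : Function.update s k ([] : List Bool) = s := by rw [← hk, Function.update_eq_self]
    rw [h]
    exact (Function.update_eq_self k' s).symm
  | cons b z ih =>
    intro s hk
    refine (Exec.loop_true (by simp [hk]) (exec_moveBit hne hk)
      (ih (s := Function.update (Function.update s k z) k' (b :: s k')) (by simp [hne]))
      (t := (z.length + 1) * 5 + 1) (by omega)).congr ?_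
    funext l
    by_cases h1 : l = k' <;> by_cases h2 : l = k <;> simp_all

/-- Beyond the end of the array there is nothing to move, but the counter is still used up. -/
theorem exec_walk {c k k' : K} (hck : c ≠ k) (hck' : c ≠ k') (hkk' : k ≠ k') {r : List Bool}
    (hr : topOne r.head? = false) (n : ℕ) : ∀ {s : K → List Bool} {l : List Bool},
    s c = ones n ++ r → s k = l → (walk c k k' .skip).Exec (n * 6 + 1) s
      (Function.update (Function.update (Function.update s c r) k (l.drop n)) k'
        ((l.take n).reverse ++ s k')) := by
  induction n with
  | zero =>
    intro s l hc hk
    refine (Exec.loop_false (by simpa [hc, ones] using hr) (Nat.le_add_left _ _)).congr ?_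
    funext x
    by_cases h1 : x = k' <;> by_cases h2 : x = k <;> by_cases h3 : x = c <;> simp_all [ones]
  | succ n ih =>
    intro s l hc hk
    rw [ones_succ] at hc
    have hk1 : Function.update s c (ones n ++ r) k = l := by simp [hck.symm, hk]
    have hpop : (StackProg.pop c).Exec 1 s (Function.update s c (ones n ++ r)) :=
      (Exec.pop le_rfl).congr (by simp [hc])
    cases l with
    | nil =>
      refine (Exec.loop_true (by simp [hc, topOne])
        (Exec.seq hpop (exec_moveBit_nil hk1 (.skip le_rfl)) (t := 4) (by norm_num))
        (ih (by simp) hk1) (t := (n + 1) * 6 + 1) (by omega)).congr ?_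
      funext x
      by_cases h1 : x = k' <;> by_cases h2 : x = k <;> by_cases h3 : x = c <;> simp_all
    | cons b l =>
      refine (Exec.loop_true (by simp [hc, topOne])
        (Exec.seq hpop (exec_moveBit hkk' hk1) (t := 5) (by norm_num))
        (ih (by simp [hck, hck']) (l := l) (by simp [hkk']))
        (t := (n + 1) * 6 + 1) (by omega)).congr ?_
      funext x
      by_cases h1 : x = k' <;> by_cases h2 : x = k <;> by_cases h3 : x = c <;> simp_all

/-- Beyond the end of the array the missing bits are supplied as `false`, so a write at a large
position finds the array extended up to it. -/
theorem exec_walk_pad {c k k' : K} (hck : c ≠ k) (hck' : c ≠ k') (hkk' : k ≠ k') {r : List Bool}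
    (hr : topOne r.head? = false) (n : ℕ) : ∀ {s : K → List Bool} {l : List Bool},
    s c = ones n ++ r → s k = l → (walk c k k' (.push k' false)).Exec (n * 6 + 1) s
      (Function.update (Function.update (Function.update s c r) k (l.drop n)) k'
        (((List.range n).map (rd l)).reverse ++ s k')) := by
  induction n with
  | zero =>
    intro s l hc hk
    refine (Exec.loop_false (by simpa [hc, ones] using hr) (Nat.le_add_left _ _)).congr ?_
    funext x
    by_cases h1 : x = k' <;> by_cases h2 : x = k <;> by_cases h3 : x = c <;> simp_all [ones]
  | succ n ih =>
    intro s l hc hk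
    rw [ones_succ] at hc
    have hk1 : Function.update s c (ones n ++ r) k = l := by simp [hck.symm, hk]
    have hpop : (StackProg.pop c).Exec 1 s (Function.update s c (ones n ++ r)) :=
      (Exec.pop le_rfl).congr (by simp [hc])
    have hrange : ∀ b (l : List Bool), (List.range (n + 1)).map (rd (b :: l)) =
        b :: (List.range n).map (rd l) := by
      intro b l
      rw [List.range_succ_eq_map, List.map_cons, List.map_map]
      rfl
    cases l with
    | nil =>
      refine (Exec.loop_true (by simp [hc, topOne])
        (Exec.seq hpop (exec_moveBit_nil hk1 (.push le_rfl)) (t := 4) (by norm_num))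
        (ih (by simp [hck']) (by simpa [hkk'] using hk1)) (t := (n + 1) * 6 + 1) (by omega)).congr ?_
      have hnil : (List.range (n + 1)).map (rd []) = false :: (List.range n).map (rd []) := by
        rw [List.range_succ_eq_map, List.map_cons, List.map_map]
        rfl
      rw [hnil]
      funext x
      by_cases h1 : x = k' <;> by_cases h2 : x = k <;> by_cases h3 : x = c <;> simp_all
    | cons b l =>
      rw [hrange]
      refine (Exec.loop_true (by simp [hc, topOne])
        (Exec.seq hpop (exec_moveBit hkk' hk1) (t := 5) (by norm_num))
        (ih (by simp [hck, hck']) (l := l) (by simp [hkk']))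
        (t := (n + 1) * 6 + 1) (by omega)).congr ?_
      funext x
      by_cases h1 : x = k' <;> by_cases h2 : x = k <;> by_cases h3 : x = c <;> simp_all

end StackProg

open StackProg

/-- Put a copy of the variable `x` onto the stack of values. -/
def copyVar (x : ℕ) : StackProg (Stk ℕ) :=
  .seq (.push .acc false) (.seq (move (.reg x) .aux)
    (.loop .aux topOne (.seq (.pop .aux) (.seq (.push (.reg x) true) (.push .acc true)))))

/-- Move the value on top of the stack of values to `k`. -/
def store (k : Stk ℕ) : StackProg (Stk ℕ) := .seq (move .acc k) (.pop .acc)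

/-- The stack program that puts the value of an expression onto the stack of values, as a block of
ones above a zero. -/
def Expr.comp : Expr → StackProg (Stk ℕ)
  | .zero => .push .acc false
  | .succ e => .seq e.comp (.push .acc true)
  | .var x => copyVar x
  | .ite e e₁ e₂ => .seq e.comp (.cond .acc topOne
      (.seq (.seq (clear .acc) (.pop .acc)) e₁.comp) (.seq (.pop .acc) e₂.comp))
  -- The index is used up while the array is moved aside, and its remaining separator becomes that
  -- of the result, above which at most a single one is put. Then the array is restored.
  | .read a e => .seq (.seq (.seq e.comp (walk .acc (.arr a) .zip .skip))
      (.cond (.arr a) topOne (.push .acc true) .skip)) (moveAll .zip (.arr a))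
  | .bind x a b => .seq (.seq (.seq a.comp (store (.reg x))) b.comp) (clear (.reg x))
  -- The remaining passes are counted down on a stack of their own, while the register of `x` counts
  -- up and can be read by the body.
  | .loop x n a b => .seq (.seq (.seq (.seq (.seq n.comp a.comp) (store (.reg (x + 1))))
      (store (.cnt x)))
      (.loop (.cnt x) topOne (.seq (.seq (.seq (.seq (.pop (.cnt x)) b.comp)
        (clear (.reg (x + 1)))) (store (.reg (x + 1)))) (.push (.reg x) true))))
      (.seq (clear (.reg x)) (.seq (.push .acc false) (move (.reg (x + 1)) .acc)))

/-- A bound for the running time if all numbers are at most `N`. -/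
def Expr.cost (N : ℕ) : Expr → ℕ
  | .zero => 1
  | .succ e => e.cost N + 1
  | .var _ => 7 * N + 3
  | .ite e e₁ e₂ => e.cost N + e₁.cost N + e₂.cost N + (2 * N + 3)
  | .read _ e => e.cost N + (11 * N + 4)
  | .bind _ a b => a.cost N + b.cost N + (5 * N + 3)
  | .loop _ n a b => n.cost N + a.cost N + N * (b.cost N + (5 * N + 6)) + (11 * N + 8)

/-- The stacks contain the values of the first `d` variables, and the arrays. -/
structure Rep (inp mem : List Bool) (d : ℕ) (ρ : ℕ → ℕ) (s : Stk ℕ → List Bool) : Prop where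
  aux : s .aux = []
  zip : s .zip = []
  inp : s (.arr false) = inp
  mem : s (.arr true) = mem
  reg : ∀ x < d, s (.reg x) = ones (ρ x)
  reg_nil : ∀ x ≥ d, s (.reg x) = []
  cnt_nil : ∀ x ≥ d, s (.cnt x) = []

theorem exec_copyVar {s : Stk ℕ → List Bool} {x v N : ℕ} (hx : s (.reg x) = ones v)
    (ha : s .aux = []) (hv : v ≤ N) :
    (copyVar x).Exec (7 * N + 3) s (Function.update s .acc (ones v ++ false :: s .acc)) := by
  have h1 := exec_move (K := Stk ℕ) (k := .reg x) (k' := .aux) (by simp)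
    (s := Function.update s .acc (false :: s .acc)) (n := v) (r := []) (by simp [hx]) rfl
  have h2 := Exec.loop (K := Stk ℕ) (k := .aux) (test := topOne)
    (p := .seq (.pop .aux) (.seq (.push (.reg x) true) (.push .acc true))) (n := v) (t := 3)
    (fun i => Function.update (Function.update (Function.update s .acc (ones i ++ false :: s .acc))
      (.reg x) (ones i)) .aux (ones (v - i))) (fun i hi => ?_) (by simp [ones, StackProg.topOne])
  · refine (Exec.seq (.push le_rfl) (Exec.seq (h1.congr ?_) h2 le_rfl) (by omega)).congr ?_
    · funext k
      by_cases h1 : k = .reg x <;> by_cases h2 : k = .aux <;> by_cases h3 : k = .acc <;>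
        simp_all [ones]
    · funext k
      by_cases h1 : k = .reg x <;> by_cases h2 : k = .aux <;> by_cases h3 : k = .acc <;>
        simp_all [ones]
  · obtain ⟨j, hj⟩ : ∃ j, v - i = j + 1 := ⟨v - i - 1, by omega⟩
    have hj' : v - (i + 1) = j := by omega
    refine ⟨by simp [hj, ones_succ, topOne], ?_⟩
    refine (Exec.seq (.pop le_rfl) (Exec.seq (.push le_rfl) (.push le_rfl) (t := 2) le_rfl)
      le_rfl).congr ?_
    funext k
    by_cases h1 : k = .reg x <;> by_cases h2 : k = .aux <;> by_cases h3 : k = .acc <;>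
      simp_all [ones_succ]

theorem exec_store {s : Stk ℕ → List Bool} {k : Stk ℕ} (hk : k ≠ .acc) {v N : ℕ} {r : List Bool}
    (hs : s .acc = ones v ++ false :: r) (hv : v ≤ N) :
    (store k).Exec (3 * N + 2) s
      (Function.update (Function.update s .acc r) k (ones v ++ s k)) := by
  refine (Exec.seq (exec_move hk.symm hs rfl) (.pop le_rfl) (by omega)).congr ?_
  funext l
  by_cases h1 : l = k <;> by_cases h2 : l = .acc <;> simp_all

theorem Rep.update_acc {inp mem : List Bool} {d : ℕ} {ρ : ℕ → ℕ} {s : Stk ℕ → List Bool}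
    (h : Rep inp mem d ρ s) (l : List Bool) : Rep inp mem d ρ (Function.update s .acc l) where
  aux := by simpa using h.aux
  zip := by simpa using h.zip
  inp := by simpa using h.inp
  mem := by simpa using h.mem
  reg x hx := by simpa using h.reg x hx
  reg_nil x hx := by simpa using h.reg_nil x hx
  cnt_nil x hx := by simpa using h.cnt_nil x hx

theorem Rep.update_mem {inp mem : List Bool} {d : ℕ} {ρ : ℕ → ℕ} {s : Stk ℕ → List Bool}
    (h : Rep inp mem d ρ s) (mem' : List Bool) :
    Rep inp mem' d ρ (Function.update s (.arr true) mem') where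
  aux := by simpa using h.aux
  zip := by simpa using h.zip
  inp := by simpa using h.inp
  mem := by simp
  reg x hx := by simpa using h.reg x hx
  reg_nil x hx := by simpa using h.reg_nil x hx
  cnt_nil x hx := by simpa using h.cnt_nil x hx

theorem Rep.update_reg {inp mem : List Bool} {d : ℕ} {ρ : ℕ → ℕ} {s : Stk ℕ → List Bool}
    (h : Rep inp mem d ρ s) (v : ℕ) (c : List Bool) : Rep inp mem (d + 1) (Function.update ρ d v)
      (Function.update (Function.update s (.reg d) (ones v)) (.cnt d) c) where
  aux := by simpa using h.aux
  zip := by simpa using h.zip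
  inp := by simpa using h.inp
  mem := by simpa using h.mem
  reg x hx := by
    rcases Nat.lt_succ_iff_lt_or_eq.1 hx with hx | rfl
    · simpa [hx.ne] using h.reg x hx
    · simp
  reg_nil x hx := by simpa [show x ≠ d by omega] using h.reg_nil x (by omega)
  cnt_nil x hx := by simpa [show x ≠ d by omega] using h.cnt_nil x (by omega)

theorem Rep.update_reg₂ {inp mem : List Bool} {d : ℕ} {ρ : ℕ → ℕ} {s : Stk ℕ → List Bool}
    (h : Rep inp mem d ρ s) (i v : ℕ) (c : List Bool) : Rep inp mem (d + 2) (upd ρ d i v)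
      (Function.update (Function.update (Function.update s (.reg d) (ones i)) (.reg (d + 1))
        (ones v)) (.cnt d) c) := by
  have := (h.update_reg i c).update_reg v (s (.cnt (d + 1)))
  unfold upd
  convert this using 1
  funext k
  by_cases h1 : k = .reg (d + 1) <;> by_cases h2 : k = .cnt d <;> by_cases h3 : k = .cnt (d + 1) <;>
    simp_all [Function.update_apply]

/-- The stack program of an expression computes its value. -/
theorem Ev.exec {N : ℕ} {inp mem : List Bool} {e : Expr} {ρ : ℕ → ℕ} {v : ℕ}
    (h : Ev N inp mem e ρ v) : ∀ {d : ℕ} {s : Stk ℕ → List Bool}, e.wf d = true →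
      Rep inp mem d ρ s →
      e.comp.Exec (e.cost N) s (Function.update s .acc (ones v ++ false :: s .acc)) := by
  induction h with
  | zero =>
    intro d s hw hs
    exact .push le_rfl
  | succ h hN ih =>
    intro d s hw hs
    refine (Exec.seq (ih hw hs) (.push le_rfl) le_rfl).congr ?_
    simp [ones_succ]
  | @var x ρ hN =>
    intro d s hw hs
    exact exec_copyVar (hs.reg x (by simpa [Expr.wf] using hw)) hs.aux hN
  | @ite_pos e e₁ e₂ ρ v w h hv h₁ ih ih₁ =>
    intro d s hw hs
    simp only [Expr.wf, Bool.and_eq_true] at hw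
    have hle := h.le
    obtain ⟨u, rfl⟩ := Nat.exists_eq_succ_of_ne_zero hv
    have hc : (StackProg.seq (clear .acc) (.pop .acc)).Exec (2 * N + 2)
        (Function.update s .acc (ones (u + 1) ++ false :: s .acc)) s :=
      (Exec.seq (exec_clear (n := u + 1) (r := false :: s .acc) (by simp) rfl) (.pop le_rfl)
        (by omega)).congr (by simp)
    refine (Exec.seq (ih hw.1.1 hs) (.cond_true (by simp [ones_succ, topOne])
      (Exec.seq hc (ih₁ hw.1.2 hs) le_rfl) le_rfl) ?_)
    simp only [Expr.cost]
    omega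
  | @ite_zero e e₁ e₂ ρ w h h₂ ih ih₂ =>
    intro d s hw hs
    simp only [Expr.wf, Bool.and_eq_true] at hw
    have hc : (StackProg.pop .acc).Exec 1
        (Function.update s .acc (ones 0 ++ false :: s .acc)) s :=
      (Exec.pop le_rfl).congr (by simp [ones])
    refine (Exec.seq (ih hw.1.1 hs) (.cond_false (by simp [ones, topOne])
      (Exec.seq hc (ih₂ hw.2 hs) le_rfl) le_rfl) ?_)
    simp only [Expr.cost]
    omega
  | @read a e ρ v h hN ih =>
    intro d s hw hs
    have hle := h.le
    set l := bif a then mem else inp with hl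
    have hsl : s (.arr a) = l := by
      cases a
      · exact hs.inp
      · exact hs.mem
    have h1 := exec_walk (K := Stk ℕ) (c := .acc) (k := .arr a) (k' := .zip) (by simp) (by simp)
      (by simp) (r := false :: s .acc) rfl v (l := l)
      (s := Function.update s .acc (ones v ++ false :: s .acc)) (by simp) (by simpa using hsl)
    have h2 : (StackProg.cond (.arr a) topOne (.push .acc true) .skip).Exec 2
        (Function.update (Function.update (Function.update s .acc (false :: s .acc)) (.arr a)
          (l.drop v)) .zip (l.take v).reverse)
        (Function.update (Function.update (Function.update s .acc
          (ones (rd l v).toNat ++ false :: s .acc)) (.arr a) (l.drop v)) .zip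
            (l.take v).reverse) := by
      have hd : (l.drop v).head? = l[v]? := by simp
      have hr : rd l v = topOne l[v]? := by
        unfold rd topOne
        rw [List.getD_eq_getElem?_getD]
        rcases l[v]? with _ | _ | _ <;> rfl
      cases hb : rd l v with
      | true =>
        refine Exec.cond_true (by simpa [hd, hb] using hr.symm)
          ((Exec.push le_rfl).congr ?_) le_rfl
        funext k
        by_cases h1 : k = .arr a <;> by_cases h2 : k = .zip <;> by_cases h3 : k = .acc <;>
          simp_all [ones]
      | false =>
        exact Exec.cond_false (by simpa [hd, hb] using hr.symm) (.skip le_rfl) le_rfl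
    have h3 := exec_moveAll (K := Stk ℕ) (k := .zip) (k' := .arr a) (by simp) (l.take v).reverse
      (s := Function.update (Function.update (Function.update s .acc
          (ones (rd l v).toNat ++ false :: s .acc)) (.arr a) (l.drop v)) .zip
            (l.take v).reverse) (by simp)
    refine (Exec.seq (Exec.seq (Exec.seq (ih hw hs) h1 le_rfl) (h2.congr_left ?_) le_rfl)
      h3 ?_).congr ?_
    · funext k
      have := hs.zip
      by_cases h1 : k = .arr a <;> by_cases h2 : k = .zip <;> by_cases h3 : k = .acc <;>
        simp_all
    · have := List.length_take_le v l
      simp only [Expr.cost, List.length_reverse]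
      omega
    · funext k
      have := hs.zip
      by_cases h1 : k = .arr a <;> by_cases h2 : k = .zip <;> by_cases h3 : k = .acc <;>
        simp_all
  | @bind x a b ρ v w h h' ih ih' =>
    intro d s hw hs
    simp only [Expr.wf, Bool.and_eq_true, beq_iff_eq] at hw
    obtain ⟨⟨rfl, hwa⟩, hwb⟩ := hw
    have hx := hs.reg_nil x le_rfl
    have hle := h.le
    have h1 : (store (.reg x)).Exec (3 * N + 2)
        (Function.update s .acc (ones v ++ false :: s .acc)) (Function.update s (.reg x) (ones v)) := by
      refine (exec_store (by simp) (r := s .acc) (by simp) hle).congr ?_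
      simp [hx]
    have h2 := ih' (s := Function.update s (.reg x) (ones v)) hwb (by
      have h0 := hs.update_reg v (Function.update s (.reg x) (ones v) (.cnt x))
      rwa [Function.update_eq_self] at h0)
    refine (Exec.seq (Exec.seq (Exec.seq (ih hwa hs) h1 le_rfl) h2 le_rfl)
      (exec_clear (n := v) (r := []) (by simp) rfl) ?_).congr ?_
    · simp only [Expr.cost]
      omega
    · funext k
      by_cases h1 : k = .reg x <;> by_cases h2 : k = .acc <;> simp_all
  | @loop x n a b ρ k F hn ha hb ihn iha ihb =>
    intro d s hw hs
    simp only [Expr.wf, Bool.and_eq_true, beq_iff_eq] at hw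
    obtain ⟨⟨⟨rfl, hwn⟩, hwa⟩, hwb⟩ := hw
    have hx := hs.reg_nil x le_rfl
    have hx' := hs.reg_nil (x + 1) (by omega)
    have hc := hs.cnt_nil x le_rfl
    have hk := hn.le
    have hF : ∀ i ≤ k, F i ≤ N := fun i hi => by
      cases i with
      | zero => exact ha.le
      | succ i => exact (hb i hi).le
    set S : ℕ → Stk ℕ → List Bool := fun i => Function.update (Function.update
      (Function.update s (.reg x) (ones i)) (.reg (x + 1)) (ones (F i))) (.cnt x) (ones (k - i))
      with hS
    have hSa : ∀ i, S i .acc = s .acc := fun i => by simp [hS]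
    have h1 := ihn hwn hs
    have h2 := iha hwa (hs.update_acc (ones k ++ false :: s .acc))
    have h3 := exec_store (k := .reg (x + 1)) (by simp) (v := F 0) (N := N)
      (r := ones k ++ false :: s .acc)
      (s := Function.update s .acc (ones (F 0) ++ false :: (ones k ++ false :: s .acc)))
      (by simp) ha.le
    have h4 := exec_store (k := .cnt x) (by simp) (v := k) (N := N) (r := s .acc)
      (s := Function.update (Function.update s .acc (ones k ++ false :: s .acc)) (.reg (x + 1))
        (ones (F 0))) (by simp) hk
    have hbody : ∀ i < k, topOne (S i (.cnt x)).head? = true ∧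
        (StackProg.seq (.seq (.seq (.seq (.pop (.cnt x)) b.comp)
        (clear (.reg (x + 1)))) (store (.reg (x + 1)))) (.push (.reg x) true)).Exec
          (b.cost N + (5 * N + 5)) (S i) (S (i + 1)) := by
      intro i hi
      obtain ⟨j, hj⟩ : ∃ j, k - i = j + 1 := ⟨k - i - 1, by omega⟩
      have hj' : k - (i + 1) = j := by omega
      refine ⟨by simp [hS, hj, ones_succ, topOne], ?_⟩
      have hpop : (StackProg.pop (.cnt x)).Exec 1 (S i) (Function.update (Function.update
          (Function.update s (.reg x) (ones i)) (.reg (x + 1)) (ones (F i))) (.cnt x) (ones j)) :=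
        (Exec.pop le_rfl).congr (by simp [hS, hj, ones_succ])
      have hb' := ihb i hi hwb (hs.update_reg₂ i (F i) (ones j))
      have hcl := exec_clear (k := Stk.reg (x + 1)) (n := F i) (r := [])
        (s := Function.update (Function.update (Function.update (Function.update s (.reg x) (ones i))
          (.reg (x + 1)) (ones (F i))) (.cnt x) (ones j)) .acc (ones (F (i + 1)) ++ false :: s .acc))
        (by simp) rfl
      have hst := exec_store (k := .reg (x + 1)) (by simp) (v := F (i + 1)) (N := N) (r := s .acc)
        (s := Function.update (Function.update (Function.update (Function.update s (.reg x) (ones i))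
          (.reg (x + 1)) []) (.cnt x) (ones j)) .acc (ones (F (i + 1)) ++ false :: s .acc))
        (by simp) (hF _ hi)
      have hFi := hF i hi.le
      refine (Exec.seq (Exec.seq (Exec.seq (Exec.seq hpop hb' le_rfl) (hcl.congr_left ?_) le_rfl)
        (hst.congr_left ?_) le_rfl) (.push le_rfl) (by omega)).congr ?_
      · simp
      · funext l
        by_cases h1 : l = .reg (x + 1) <;> by_cases h2 : l = .cnt x <;> by_cases h3 : l = .acc <;>
          simp_all
      · funext l
        by_cases h1 : l = .reg (x + 1) <;> by_cases h2 : l = .cnt x <;> by_cases h3 : l = .acc <;>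
          by_cases h4 : l = .reg x <;> simp_all [ones_succ]
    have h5 := Exec.loop S hbody (by simp [hS, ones, topOne])
    have h6 := exec_clear (k := Stk.reg x) (s := S k) (n := k) (r := []) (by simp [hS]) rfl
    have h7 := exec_move (K := Stk ℕ) (k := .reg (x + 1)) (k' := .acc) (by simp) (n := F k) (r := [])
      (s := Function.update (Function.update (S k) (.reg x) []) .acc (false :: s .acc))
      (by simp [hS]) rfl
    have hFk := hF k le_rfl
    refine (Exec.seq (Exec.seq (Exec.seq (Exec.seq (Exec.seq h1 h2 le_rfl) (h3.congr_left ?_) le_rfl)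
      (h4.congr_left ?_) le_rfl) (h5.congr_left ?_) le_rfl) (Exec.seq h6
        (Exec.seq (.push le_rfl) (h7.congr_left ?_) le_rfl) le_rfl) ?_).congr ?_
    · simp
    · simp [hx']
    · clear hbody ihn iha ihb hn ha hb h1 h2 h3 h4 h5 h6 h7 hF hs hwn hwa hwb
      funext l
      by_cases h1 : l = .reg (x + 1) <;> by_cases h2 : l = .cnt x <;> by_cases h3 : l = .acc <;>
        by_cases h4 : l = .reg x <;> simp_all [ones]
    · rw [Function.update_of_ne (by simp), hSa]
    · have := Nat.mul_le_mul_right (b.cost N + (5 * N + 5) + 1) hk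
      simp only [Expr.cost]
      rw [show b.cost N + (5 * N + 6) = b.cost N + (5 * N + 5) + 1 by omega]
      omega
    · clear hbody ihn iha ihb hn ha hb h1 h2 h3 h4 h5 h6 h7 hF hs hwn hwa hwb
      funext l
      by_cases h1 : l = .reg (x + 1) <;> by_cases h2 : l = .cnt x <;> by_cases h3 : l = .acc <;>
        by_cases h4 : l = .reg x <;> simp_all [ones]

/-! ### Translation of commands -/

open StackProg

/-- The stack program that changes the memory as the command says. -/
def Cmd.comp : Cmd → StackProg (Stk ℕ)
  | .assign e b => .seq (.seq (.seq e.comp (walk .acc (.arr true) .zip (.push .zip false)))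
      (.seq (.pop .acc) (.seq (.pop (.arr true)) (.push (.arr true) b)))) (moveAll .zip (.arr true))
  | .seq c c' => .seq c.comp c'.comp
  | .when e c => .seq e.comp (.cond .acc topOne
      (.seq (.seq (clear .acc) (.pop .acc)) c.comp) (.pop .acc))
  | .bind x e c => .seq (.seq (.seq e.comp (store (.reg x))) c.comp) (clear (.reg x))
  | .loop x n c => .seq (.seq (.seq n.comp (store (.cnt x)))
      (.loop (.cnt x) topOne (.seq (.seq (.pop (.cnt x)) c.comp) (.push (.reg x) true))))
      (clear (.reg x))

def Cmd.cost (N : ℕ) : Cmd → ℕ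
  | .assign e _ => e.cost N + (11 * N + 5)
  | .seq c c' => c.cost N + c'.cost N
  | .when e c => e.cost N + c.cost N + (2 * N + 3)
  | .bind _ e c => e.cost N + c.cost N + (5 * N + 3)
  | .loop _ n c => n.cost N + N * (c.cost N + 3) + (5 * N + 4)

/-- Every command restores all stacks other than the memory, so the stacks of out-of-scope variables
are empty whenever a new scope is entered. -/
theorem Run.exec {N : ℕ} {inp : List Bool} {c : Cmd} {ρ : ℕ → ℕ} {mem mem' : List Bool}
    (h : Run N inp c ρ mem mem') : ∀ {d : ℕ} {s : Stk ℕ → List Bool}, c.wf d = true →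
      Rep inp mem d ρ s → c.comp.Exec (c.cost N) s (Function.update s (.arr true) mem') := by
  induction h with
  | @assign e b ρ mem v h =>
    intro d s hw hs
    have hle := h.le
    have h1 := exec_walk_pad (K := Stk ℕ) (c := .acc) (k := .arr true) (k' := .zip) (by simp)
      (by simp) (by simp) (r := false :: s .acc) rfl v (l := mem)
      (s := Function.update s .acc (ones v ++ false :: s .acc)) (by simp) (by simpa using hs.mem)
    have h3 := exec_moveAll (K := Stk ℕ) (k := .zip) (k' := .arr true) (by simp)
      ((List.range v).map (rd mem)).reverse
      (s := Function.update (Function.update s (.arr true) (b :: mem.drop (v + 1))) .zip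
        ((List.range v).map (rd mem)).reverse) (by simp)
    refine (Exec.seq (Exec.seq (Exec.seq (h.exec hw hs) h1 le_rfl)
      (Exec.seq (.pop le_rfl) (Exec.seq (.pop le_rfl) (.push le_rfl) (t := 2) le_rfl)
        (t := 3) le_rfl) le_rfl) (h3.congr_left ?_) ?_).congr ?_
    · have := hs.zip
      clear h1 h3
      funext k
      by_cases h1 : k = .arr true <;> by_cases h2 : k = .zip <;> by_cases h3 : k = .acc <;>
        simp_all
    · simp only [Cmd.cost, List.length_reverse, List.length_map, List.length_range]
      omega
    · have := hs.zip
      clear h1 h3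
      funext k
      by_cases h1 : k = .arr true <;> by_cases h2 : k = .zip <;> by_cases h3 : k = .acc <;>
        simp_all [wr]
  | @seq c c' ρ mem mem₁ mem₂ h h' ih ih' =>
    intro d s hw hs
    simp only [Cmd.wf, Bool.and_eq_true] at hw
    exact (Exec.seq (ih hw.1 hs) (ih' hw.2 (hs.update_mem _)) le_rfl).congr (by simp)
  | @when_pos e c ρ mem mem₁ v h hv h' ih =>
    intro d s hw hs
    simp only [Cmd.wf, Bool.and_eq_true] at hw
    have hle := h.le
    obtain ⟨u, rfl⟩ := Nat.exists_eq_succ_of_ne_zero hv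
    have hc : (StackProg.seq (clear .acc) (.pop .acc)).Exec (2 * N + 2)
        (Function.update s .acc (ones (u + 1) ++ false :: s .acc)) s :=
      (Exec.seq (exec_clear (n := u + 1) (r := false :: s .acc) (by simp) rfl) (.pop le_rfl)
        (by omega)).congr (by simp)
    refine Exec.seq (h.exec hw.1 hs) (.cond_true (by simp [ones_succ, topOne])
      (Exec.seq hc (ih hw.2 hs) le_rfl) le_rfl) ?_
    simp only [Cmd.cost]
    omega
  | @when_zero e c ρ mem h =>
    intro d s hw hs
    simp only [Cmd.wf, Bool.and_eq_true] at hw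
    have hm := hs.mem
    refine (Exec.seq (h.exec hw.1 hs) (.cond_false (by simp [ones, topOne])
      (.pop le_rfl) le_rfl) ?_).congr ?_
    · simp only [Cmd.cost]
      omega
    · simp [← hm, ones]
  | @bind x e c ρ mem mem₁ v h h' ih =>
    intro d s hw hs
    simp only [Cmd.wf, Bool.and_eq_true, beq_iff_eq] at hw
    obtain ⟨⟨rfl, hwe⟩, hwc⟩ := hw
    have hx := hs.reg_nil x le_rfl
    have hle := h.le
    have h1 : (store (.reg x)).Exec (3 * N + 2)
        (Function.update s .acc (ones v ++ false :: s .acc))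
        (Function.update s (.reg x) (ones v)) := by
      refine (exec_store (by simp) (r := s .acc) (by simp) hle).congr ?_
      simp [hx]
    have h2 := ih (s := Function.update s (.reg x) (ones v)) hwc (by
      have h0 := hs.update_reg v (Function.update s (.reg x) (ones v) (.cnt x))
      rwa [Function.update_eq_self] at h0)
    refine (Exec.seq (Exec.seq (Exec.seq (h.exec hwe hs) h1 le_rfl) h2 le_rfl)
      (exec_clear (n := v) (r := []) (by simp) rfl) ?_).congr ?_
    · simp only [Cmd.cost]
      omega
    · funext k
      by_cases h1 : k = .reg x <;> by_cases h2 : k = .arr true <;> simp_all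
  | @loop x n c ρ k F hn h ih =>
    intro d s hw hs
    simp only [Cmd.wf, Bool.and_eq_true, beq_iff_eq] at hw
    obtain ⟨⟨rfl, hwn⟩, hwc⟩ := hw
    have hx := hs.reg_nil x le_rfl
    have hc := hs.cnt_nil x le_rfl
    have hm := hs.mem
    have hk := hn.le
    set S : ℕ → Stk ℕ → List Bool := fun i => Function.update (Function.update
      (Function.update s (.arr true) (F i)) (.reg x) (ones i)) (.cnt x) (ones (k - i)) with hS
    have h1 := exec_store (k := .cnt x) (by simp) (v := k) (N := N) (r := s .acc)
      (s := Function.update s .acc (ones k ++ false :: s .acc)) (by simp) hk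
    have hbody : ∀ i < k, topOne (S i (.cnt x)).head? = true ∧
        (StackProg.seq (.seq (.pop (.cnt x)) c.comp) (.push (.reg x) true)).Exec
          (c.cost N + 2) (S i) (S (i + 1)) := by
      intro i hi
      obtain ⟨j, hj⟩ : ∃ j, k - i = j + 1 := ⟨k - i - 1, by omega⟩
      have hj' : k - (i + 1) = j := by omega
      refine ⟨by simp [hS, hj, ones_succ, topOne], ?_⟩
      have hpop : (StackProg.pop (.cnt x)).Exec 1 (S i) (Function.update (Function.update
          (Function.update s (.arr true) (F i)) (.reg x) (ones i)) (.cnt x) (ones j)) :=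
        (Exec.pop le_rfl).congr (by simp [hS, hj, ones_succ])
      have hb := ih i hi hwc ((hs.update_mem (F i)).update_reg i (ones j))
      refine (Exec.seq (Exec.seq hpop hb le_rfl) (.push le_rfl) (by omega)).congr ?_
      clear h1 hb hpop
      funext l
      by_cases h1 : l = .reg x <;> by_cases h2 : l = .cnt x <;> by_cases h3 : l = .arr true <;>
        simp_all [ones_succ]
    have h2 := Exec.loop S hbody (by simp [hS, ones, topOne])
    have h3 := exec_clear (k := Stk.reg x) (s := S k) (n := k) (r := []) (by simp [hS]) rfl
    refine (Exec.seq (Exec.seq (Exec.seq (hn.exec hwn hs) h1 le_rfl) (h2.congr_left ?_) le_rfl)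
      h3 ?_).congr ?_
    · have h0 : Function.update s (.arr true) (F 0) = s := by rw [← hm, Function.update_eq_self]
      simp only [hS, h0]
      clear h1 h2 h3 hbody ih h
      funext l
      by_cases h1 : l = .reg x <;> by_cases h2 : l = .cnt x <;> by_cases h3 : l = .acc <;>
        simp_all [ones]
    · have := Nat.mul_le_mul_right (c.cost N + 2 + 1) hk
      simp only [Cmd.cost]
      rw [show c.cost N + 3 = c.cost N + 2 + 1 by omega]
      omega
    · clear h1 h2 h3 hbody ih h
      funext l
      by_cases h1 : l = .reg x <;> by_cases h2 : l = .cnt x <;> by_cases h3 : l = .arr true <;>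
        simp_all [ones]

theorem length_wr (l : List Bool) (n : ℕ) (b : Bool) :
    (wr l n b).length = max l.length (n + 1) := by
  simp only [wr, List.length_append, List.length_map, List.length_range, List.length_cons,
    List.length_drop]
  omega

/-- Only positions up to N are written. This bounds the time for emptying the memory at the end. -/
theorem Run.length_le {N : ℕ} {inp : List Bool} {c : Cmd} {ρ : ℕ → ℕ} {mem mem' : List Bool}
    (h : Run N inp c ρ mem mem') : mem.length ≤ N + 1 → mem'.length ≤ N + 1 := by
  induction h with
  | assign h =>
    intro hm
    have := h.le
    rw [length_wr]
    omega
  | seq _ _ ih ih' => exact fun hm => ih' (ih hm)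
  | when_pos _ _ _ ih => exact ih
  | when_zero _ => exact id
  | bind _ _ ih => exact ih
  | @loop x n c ρ k F hn h ih =>
    intro hm
    have : ∀ i ≤ k, (F i).length ≤ N + 1 := by
      intro i
      induction i with
      | zero => exact fun _ => hm
      | succ i ihi => exact fun hi => ih i hi (ihi (by omega))
    exact this k le_rfl

/-! ### The running time is polynomial in the bound for the numbers -/

theorem Expr.exists_cost_eq (e : Expr) : ∃ p : Polynomial ℕ, ∀ N, e.cost N = p.eval N := by
  induction e with
  | zero => exact ⟨1, fun N => by simp [Expr.cost]⟩
  | succ e ih =>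
    obtain ⟨p, hp⟩ := ih
    exact ⟨p + 1, fun N => by simp [Expr.cost, hp]⟩
  | var x => exact ⟨7 * Polynomial.X + 3, fun N => by simp [Expr.cost]⟩
  | ite e e₁ e₂ ih ih₁ ih₂ =>
    obtain ⟨p, hp⟩ := ih
    obtain ⟨p₁, hp₁⟩ := ih₁
    obtain ⟨p₂, hp₂⟩ := ih₂
    exact ⟨p + p₁ + p₂ + (2 * Polynomial.X + 3), fun N => by simp [Expr.cost, hp, hp₁, hp₂]⟩
  | read a e ih =>
    obtain ⟨p, hp⟩ := ih
    exact ⟨p + (11 * Polynomial.X + 4), fun N => by simp [Expr.cost, hp]⟩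
  | bind x a b iha ihb =>
    obtain ⟨p, hp⟩ := iha
    obtain ⟨q, hq⟩ := ihb
    exact ⟨p + q + (5 * Polynomial.X + 3), fun N => by simp [Expr.cost, hp, hq]⟩
  | loop x n a b ihn iha ihb =>
    obtain ⟨r, hr⟩ := ihn
    obtain ⟨p, hp⟩ := iha
    obtain ⟨q, hq⟩ := ihb
    exact ⟨r + p + Polynomial.X * (q + (5 * Polynomial.X + 6)) + (11 * Polynomial.X + 8),
      fun N => by simp [Expr.cost, hr, hp, hq]⟩

theorem Cmd.exists_cost_eq (c : Cmd) : ∃ p : Polynomial ℕ, ∀ N, c.cost N = p.eval N := by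
  induction c with
  | assign e b =>
    obtain ⟨p, hp⟩ := e.exists_cost_eq
    exact ⟨p + (11 * Polynomial.X + 5), fun N => by simp [Cmd.cost, hp]⟩
  | seq c c' ih ih' =>
    obtain ⟨p, hp⟩ := ih
    obtain ⟨q, hq⟩ := ih'
    exact ⟨p + q, fun N => by simp [Cmd.cost, hp, hq]⟩
  | when e c ih =>
    obtain ⟨p, hp⟩ := e.exists_cost_eq
    obtain ⟨q, hq⟩ := ih
    exact ⟨p + q + (2 * Polynomial.X + 3), fun N => by simp [Cmd.cost, hp, hq]⟩
  | bind x e c ih =>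
    obtain ⟨p, hp⟩ := e.exists_cost_eq
    obtain ⟨q, hq⟩ := ih
    exact ⟨p + q + (5 * Polynomial.X + 3), fun N => by simp [Cmd.cost, hp, hq]⟩
  | loop x n c ih =>
    obtain ⟨p, hp⟩ := n.exists_cost_eq
    obtain ⟨q, hq⟩ := ih
    exact ⟨p + Polynomial.X * (q + 3) + (5 * Polynomial.X + 4),
      fun N => by simp [Cmd.cost, hp, hq]⟩

/-- The base N + 2 is at least 2, so a coefficient a is absorbed by its a-th power. -/
theorem exists_eval_le_pow (p : Polynomial ℕ) : ∃ c, ∀ N : ℕ, p.eval N ≤ (N + 2) ^ c := by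
  induction p using Polynomial.induction_on' with
  | add p q hp hq =>
    obtain ⟨a, ha⟩ := hp
    obtain ⟨b, hb⟩ := hq
    refine ⟨a + b + 1, fun N => ?_⟩
    rw [Polynomial.eval_add]
    have h1 : (N + 2) ^ a ≤ (N + 2) ^ (a + b) := Nat.pow_le_pow_right (by omega) (by omega)
    have h2 : (N + 2) ^ b ≤ (N + 2) ^ (a + b) := Nat.pow_le_pow_right (by omega) (by omega)
    have h3 : (N + 2) ^ (a + b) * 2 ≤ (N + 2) ^ (a + b + 1) :=
      Nat.mul_le_mul_left _ (by omega)
    have := ha N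
    have := hb N
    omega
  | monomial n a =>
    refine ⟨a + n, fun N => ?_⟩
    rw [Polynomial.eval_monomial, pow_add]
    exact Nat.mul_le_mul (Nat.lt_two_pow_self.le.trans (Nat.pow_le_pow_left (by omega) _))
      (Nat.pow_le_pow_left (by omega) _)

/-! ### Programs that use finitely many stacks -/

def Stk.map {V W : Type} (f : V → W) : Stk V → Stk W
  | .reg x => .reg (f x)
  | .cnt x => .cnt (f x)
  | .acc => .acc
  | .aux => .aux
  | .zip => .zip
  | .arr a => .arr a

def StackProg.map {K K' : Type} (f : K → K') : StackProg K → StackProg K'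
  | .skip => .skip
  | .push k b => .push (f k) b
  | .pop k => .pop (f k)
  | .seq p q => .seq (p.map f) (q.map f)
  | .cond k test p q => .cond (f k) test (p.map f) (q.map f)
  | .loop k test p => .loop (f k) test (p.map f)

def StackProg.Uses {K : Type} (A : K → Prop) : StackProg K → Prop
  | .skip => True
  | .push k _ => A k
  | .pop k => A k
  | .seq p q => p.Uses A ∧ q.Uses A
  | .cond k _ p q => A k ∧ p.Uses A ∧ q.Uses A
  | .loop k _ p => A k ∧ p.Uses A

/-- The renaming is faithful on the stacks that are used, and along `g` every new stack has an old
one behind it. -/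
theorem StackProg.Exec.map {K K' : Type} [DecidableEq K] [DecidableEq K'] {f : K → K'} {g : K' → K}
    (hfg : ∀ k, f (g k) = k) {p : StackProg K} {t : ℕ} {s s' : K → List Bool}
    (h : p.Exec t s s') : p.Uses (fun k => g (f k) = k) →
      (p.map f).Exec t (fun k => s (g k)) fun k => s' (g k) := by
  have hupd : ∀ (s : K → List Bool) k l, g (f k) = k →
      Function.update (fun k => s (g k)) (f k) l = fun k' => Function.update s k l (g k') := by
    intro s k l hk
    funext k'
    by_cases h : k' = f k
    · subst h
      simp [hk]
    · have : g k' ≠ k := fun h' => h (by rw [← h', hfg])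
      simp [h, this]
  induction h with
  | skip ht => exact fun _ => .skip ht
  | push ht =>
    intro hk
    refine (Exec.push ht).congr ?_
    rw [hupd _ _ _ hk, hk]
  | pop ht =>
    intro hk
    refine (Exec.pop ht).congr ?_
    rw [hupd _ _ _ hk, hk]
  | seq _ _ ht ih ih' => exact fun hp => .seq (ih hp.1) (ih' hp.2) ht
  | cond_true hk _ ht ih => exact fun hp => .cond_true (by rw [hp.1, hk]) (ih hp.2.1) ht
  | cond_false hk _ ht ih => exact fun hp => .cond_false (by rw [hp.1, hk]) (ih hp.2.2) ht
  | loop_false hk ht => exact fun hp => .loop_false (by rw [hp.1, hk]) ht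
  | loop_true hk _ _ ht ih ih' =>
    exact fun hp => .loop_true (by rw [hp.1, hk]) (ih hp.2) (ih' hp) ht

theorem StackProg.Uses.mono {K : Type} {A B : K → Prop} (hAB : ∀ k, A k → B k) {p : StackProg K} :
    p.Uses A → p.Uses B := by
  induction p with
  | skip => exact id
  | push k b => exact hAB k
  | pop k => exact hAB k
  | seq p q ihp ihq => exact fun h => ⟨ihp h.1, ihq h.2⟩
  | cond k test p q ihp ihq => exact fun h => ⟨hAB k h.1, ihp h.2.1, ihq h.2.2⟩
  | loop k test p ih => exact fun h => ⟨hAB k h.1, ih h.2⟩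

/-- The stack belongs to a variable below `m`, or to none. -/
def Stk.Below (m : ℕ) : Stk ℕ → Prop
  | .reg x => x < m
  | .cnt x => x < m
  | _ => True

theorem Stk.Below.mono {m m' : ℕ} (h : m ≤ m') : ∀ k : Stk ℕ, k.Below m → k.Below m'
  | .reg _, hk => lt_of_lt_of_le hk h
  | .cnt _, hk => lt_of_lt_of_le hk h
  | .acc, _ => trivial
  | .aux, _ => trivial
  | .zip, _ => trivial
  | .arr _, _ => trivial

theorem StackProg.exists_uses_below (p : StackProg (Stk ℕ)) : ∃ m, p.Uses (Stk.Below m) := by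
  have hk : ∀ k : Stk ℕ, ∃ m, k.Below m := by
    rintro (x | x | _ | _ | _ | _)
    · exact ⟨x + 1, Nat.lt_succ_self x⟩
    · exact ⟨x + 1, Nat.lt_succ_self x⟩
    all_goals exact ⟨0, trivial⟩
  have hl : ∀ {m m' : ℕ} {p : StackProg (Stk ℕ)}, p.Uses (Stk.Below m) → m ≤ m' →
      p.Uses (Stk.Below m') := fun h hm => h.mono (Stk.Below.mono hm)
  induction p with
  | skip => exact ⟨0, trivial⟩
  | push k b => exact hk k
  | pop k => exact hk k
  | seq p q ihp ihq =>
    obtain ⟨m, hm⟩ := ihp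
    obtain ⟨m', hm'⟩ := ihq
    exact ⟨max m m', hl hm (le_max_left _ _), hl hm' (le_max_right _ _)⟩
  | cond k test p q ihp ihq =>
    obtain ⟨m, hm⟩ := ihp
    obtain ⟨m', hm'⟩ := ihq
    obtain ⟨m'', hm''⟩ := hk k
    exact ⟨max m'' (max m m'), Stk.Below.mono (le_max_left _ _) k hm'',
      hl hm ((le_max_left _ _).trans (le_max_right _ _)),
      hl hm' ((le_max_right _ _).trans (le_max_right _ _))⟩
  | loop k test p ih =>
    obtain ⟨m, hm⟩ := ih
    obtain ⟨m'', hm''⟩ := hk k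
    exact ⟨max m'' m, Stk.Below.mono (le_max_left _ _) k hm'', hl hm (le_max_right _ _)⟩

open scoped Classical in
noncomputable instance {V : Type} [Fintype V] : Fintype (Stk V) :=
  Fintype.ofSurjective (α := V ⊕ V ⊕ Option (Option (Option Bool)))
    (fun
      | .inl x => .reg x
      | .inr (.inl x) => .cnt x
      | .inr (.inr none) => .acc
      | .inr (.inr (some none)) => .aux
      | .inr (.inr (some (some none))) => .zip
      | .inr (.inr (some (some (some a)))) => .arr a)
    (by
      rintro (x | x | _ | _ | _ | a)
      · exact ⟨.inl x, rfl⟩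
      · exact ⟨.inr (.inl x), rfl⟩
      · exact ⟨.inr (.inr none), rfl⟩
      · exact ⟨.inr (.inr (some none)), rfl⟩
      · exact ⟨.inr (.inr (some (some none))), rfl⟩
      · exact ⟨.inr (.inr (some (some (some a)))), rfl⟩)

/-- The program that computes the length of the input as the variable `0`, runs a command, and
returns the first entry of the memory. -/
def Cmd.program (c : Cmd) : StackProg (Stk ℕ) :=
  .seq (.seq (.seq (.seq
    (.loop (.arr false) Option.isSome (.seq (moveBit (.arr false) .zip .skip) (.push (.reg 0) true)))
    (moveAll .zip (.arr false))) c.comp)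
    (.cond (.arr true) topOne (.push .acc true) (.push .acc false)))
    (.seq (clear (.reg 0)) (.seq (.loop (.arr false) Option.isSome (.pop (.arr false)))
      (.loop (.arr true) Option.isSome (.pop (.arr true)))))

theorem exec_drain {K : Type} [DecidableEq K] {k : K} (l : List Bool) : ∀ {s : K → List Bool},
    s k = l → (StackProg.loop k Option.isSome (.pop k)).Exec (l.length * 2 + 1) s
      (Function.update s k []) := by
  induction l with
  | nil =>
    intro s hk
    exact (Exec.loop_false (by simp [hk]) (Nat.le_add_left _ _)).congr
      (by rw [← hk, Function.update_eq_self])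
  | cons b l ih =>
    intro s hk
    refine (Exec.loop_true (by simp [hk]) (.pop le_rfl) (ih (by simp [hk]))
      (t := (l.length + 1) * 2 + 1) (by omega)).congr ?_
    simp

theorem exec_countInput (l : List Bool) : ∀ {s : Stk ℕ → List Bool},
    s (.arr false) = l → (StackProg.loop (.arr false) Option.isSome
      (.seq (moveBit (.arr false) .zip .skip) (.push (.reg 0) true))).Exec (l.length * 6 + 1) s
      (Function.update (Function.update (Function.update s (.arr false) []) .zip
        (l.reverse ++ s .zip)) (.reg 0) (ones l.length ++ s (.reg 0))) := by
  induction l with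
  | nil =>
    intro s hk
    refine (Exec.loop_false (by simp [hk]) (Nat.le_add_left _ _)).congr ?_
    have h : Function.update s (.arr false) ([] : List Bool) = s := by
      rw [← hk, Function.update_eq_self]
    rw [h]
    simp [ones]
  | cons b l ih =>
    intro s hk
    refine (Exec.loop_true (by simp [hk])
      (Exec.seq (exec_moveBit (by simp) hk) (.push le_rfl) (t := 5) le_rfl) (ih (by simp))
      (t := (l.length + 1) * 6 + 1) (by omega)).congr ?_
    have hone : ∀ r, ones l.length ++ true :: r = ones (l.length + 1) ++ r := fun r => by
      simp [ones, List.replicate_succ']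
    funext x
    by_cases h1 : x = .arr false <;> by_cases h2 : x = .zip <;> by_cases h3 : x = .reg 0 <;>
      simp_all

/-- The machine model demands that all stacks except the output are empty at the end, so the input,
its length and the memory are removed. -/
theorem Cmd.exec_program {N : ℕ} {inp mem : List Bool} {c : Cmd} (hc : c.wf 1 = true)
    (hN : inp.length ≤ N) (h : Run N inp c (fun _ => inp.length) [] mem) :
    c.program.Exec (c.cost N + (17 * N + 11)) (single (.arr false) inp)
      (single .acc [rd mem 0]) := by
  have h1 := exec_countInput inp (s := single (.arr false) inp) (by simp [single])
  have h2 := exec_moveAll (K := Stk ℕ) (k := .zip) (k' := .arr false) (by simp) inp.reverse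
    (s := Function.update (Function.update (Function.update (single (.arr false) inp) (.arr false)
      []) .zip (inp.reverse)) (.reg 0) (ones inp.length)) (by simp)
  set s : Stk ℕ → List Bool := Function.update (single (.arr false) inp) (.reg 0) (ones inp.length)
    with hs
  have hrep : Rep inp [] 1 (fun _ => inp.length) s :=
    { aux := by simp [hs, single]
      zip := by simp [hs, single]
      inp := by simp [hs, single]
      mem := by simp [hs, single]
      reg := fun x hx => by simp [hs, show x = 0 by omega]
      reg_nil := fun x hx => by simp [hs, single, show x ≠ 0 by omega]
      cnt_nil := fun x hx => by simp [hs, single] }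
  have h3 := h.exec hc hrep
  have hmem := h.length_le (Nat.zero_le _)
  have h4 : (StackProg.cond (.arr true) topOne (.push .acc true) (.push .acc false)).Exec 2
      (Function.update s (.arr true) mem)
      (Function.update (Function.update s (.arr true) mem) .acc [rd mem 0]) := by
    have hacc : s .acc = [] := by simp [hs, single]
    cases hb : rd mem 0 with
    | true =>
      refine Exec.cond_true ?_ ((Exec.push le_rfl).congr (by simp [hacc])) le_rfl
      cases mem <;> simp_all [rd, topOne]
    | false =>
      refine Exec.cond_false ?_ ((Exec.push le_rfl).congr (by simp [hacc])) le_rfl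
      cases mem <;> simp_all [rd, topOne]
  refine (Exec.seq (Exec.seq (Exec.seq (Exec.seq h1 (h2.congr_left ?_) le_rfl) (h3.congr_left ?_)
    le_rfl) h4 le_rfl) (Exec.seq (exec_clear (n := inp.length) (r := []) ?_ rfl) (Exec.seq
      (exec_drain inp ?_) (exec_drain mem ?_) le_rfl) le_rfl) ?_).congr ?_
  · simp [single]
  · clear h1 h2 h3 h4 hrep
    funext l
    by_cases h1 : l = .arr false <;> by_cases h2 : l = .zip <;> by_cases h3 : l = .reg 0 <;>
      simp_all [single]
  · simp [hs]
  · simp [hs, single]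
  · simp
  · rw [List.length_reverse]
    omega
  · clear h1 h2 h3 h4 hrep
    funext l
    by_cases h1 : l = .arr false <;> by_cases h2 : l = .arr true <;> by_cases h3 : l = .reg 0 <;>
      by_cases h4 : l = .acc <;> simp_all [single]

/-- A command whose result is the first entry of the memory gives a machine; its running time is
polynomial in the bound for the numbers. -/
theorem exists_machine {α : Type} {enc : α → List Bool} {f : α → Bool} (c : Cmd)
    (hc : c.wf 1 = true) (q : Polynomial ℕ)
    (h : ∀ a, (enc a).length ≤ 2 ^ q.eval (enc a).length ∧ ∃ mem,
      Run (2 ^ q.eval (enc a).length) (enc a) c (fun _ => (enc a).length) [] mem ∧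
        rd mem 0 = f a) :
    ∃ (p : Polynomial ℕ) (M : Turing.TM2ComputableInTime enc Computability.encodeBool f),
      ∀ n, M.time n ≤ 2 ^ p.eval n := by
  obtain ⟨r, hr⟩ := c.exists_cost_eq
  obtain ⟨d, hd⟩ := exists_eval_le_pow (r + (17 * Polynomial.X + 12))
  obtain ⟨m, hm⟩ := c.program.exists_uses_below
  have : NeZero (m + 1) := ⟨by omega⟩
  have hfg : ∀ k : Stk (Fin (m + 1)), Stk.map (Fin.ofNat (m + 1)) (Stk.map Fin.val k) = k := by
    rintro (x | x | _ | _ | _ | _) <;> simp [Stk.map]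
  have huse : c.program.Uses fun k => Stk.map Fin.val (Stk.map (Fin.ofNat (m + 1)) k) = k := by
    refine hm.mono ?_
    rintro (x | x | _ | _ | _ | _) hx <;> simp [Stk.map]
    · exact le_of_lt hx
    · exact le_of_lt hx
  have hsingle : ∀ (k : Stk ℕ) (l : List Bool),
      Stk.map Fin.val (Stk.map (Fin.ofNat (m + 1)) k) = k →
      (fun k' : Stk (Fin (m + 1)) => single k l (Stk.map Fin.val k')) =
        single (Stk.map (Fin.ofNat (m + 1)) k) l := by
    intro k l hk
    funext k'
    unfold single
    by_cases h : k' = Stk.map (Fin.ofNat (m + 1)) k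
    · rw [h, hk, Function.update_self, Function.update_self]
    · rw [Function.update_of_ne h, Function.update_of_ne]
      intro h'
      exact h (by rw [← h', hfg])
  -- The time is polynomial in N = 2 ^ q, and (2 ^ q + 2) ^ d ≤ 2 ^ ((q + 2) * d).
  refine ⟨(q + 2) * Polynomial.C d, ⟨⟨(c.program.map (Stk.map (Fin.ofNat (m + 1)))).machine
    (.arr false) .acc, Equiv.refl Bool, Equiv.refl Bool⟩, fun n => (2 ^ q.eval n + 2) ^ d,
    fun a => Classical.choice ?_⟩, fun n => ?_⟩
  · obtain ⟨hN, mem, hrun, hf⟩ := h a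
    have h1 := (Cmd.exec_program hc hN hrun).map hfg huse
    rw [hsingle _ _ rfl, hsingle _ _ rfl] at h1
    have h2 := (h1.mono (t' := (2 ^ q.eval (enc a).length + 2) ^ d - 1) ?_).outputs
    · have h3 := Nat.one_le_pow d (2 ^ q.eval (enc a).length + 2) (by omega)
      rw [Nat.sub_add_cancel h3] at h2
      have h4 : List.map (Equiv.refl Bool).invFun (enc a) = enc a := List.map_id _
      rw [hf] at h2
      exact h4.symm ▸ h2
    · have := hd (2 ^ q.eval (enc a).length)
      simp at this
      rw [← hr] at this
      omega
  · show (2 ^ q.eval n + 2) ^ d ≤ _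
    have h1 : 2 ^ q.eval n + 2 ≤ 2 ^ (q.eval n + 2) := by
      have := Nat.one_le_two_pow (n := q.eval n)
      rw [pow_add]
      omega
    refine (Nat.pow_le_pow_left h1 d).trans (le_of_eq ?_)
    rw [← pow_mul]
    simp

/-! ### A library of expressions -/

theorem upd_fst (ρ : ℕ → ℕ) (x i v : ℕ) : upd ρ x i v x = i := by simp [upd]

theorem upd_snd (ρ : ℕ → ℕ) (x i v : ℕ) : upd ρ x i v (x + 1) = v := by simp [upd]

theorem upd_of_lt (ρ : ℕ → ℕ) {x y : ℕ} (i v : ℕ) (h : y < x) : upd ρ x i v y = ρ y := by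
  simp [upd, h.ne, (h.trans (Nat.lt_succ_self x)).ne]

namespace Expr

def one : Expr := .succ .zero
def not (e : Expr) : Expr := .ite e .zero one
def and (e f : Expr) : Expr := .ite e f .zero
def add (x : ℕ) (a b : Expr) : Expr := .loop x b a (.succ (.var (x + 1)))
def mul (x : ℕ) (a b : Expr) : Expr := .loop x a .zero (add (x + 2) (.var (x + 1)) b)
-- The result is the value of the loop variable in the last pass, or zero if there is none.
def pred (x : ℕ) (e : Expr) : Expr := .loop x e .zero (.var x)
def sub (x : ℕ) (a b : Expr) : Expr := .loop x b a (pred (x + 2) (.var (x + 1)))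
def le (x : ℕ) (a b : Expr) : Expr := not (sub x a b)
def eq (x : ℕ) (a b : Expr) : Expr := and (le x a b) (le x b a)
def parity (x : ℕ) (e : Expr) : Expr := .loop x e .zero (not (.var (x + 1)))
def half (x : ℕ) (e : Expr) : Expr :=
  .loop x e .zero (.ite (parity (x + 2) (.var x)) (.succ (.var (x + 1))) (.var (x + 1)))
def bit (x : ℕ) (e i : Expr) : Expr := parity x (.loop x i e (half (x + 2) (.var (x + 1))))
def pow2 (x : ℕ) (e : Expr) : Expr := .loop x e one (add (x + 2) (.var (x + 1)) (.var (x + 1)))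
def ex (x : ℕ) (n f : Expr) : Expr :=
  .loop x n .zero (.ite (.var (x + 1)) one (.ite f one .zero))
def all (x : ℕ) (n f : Expr) : Expr := not (ex x n (not f))
def ofBits (x : ℕ) (n f : Expr) : Expr :=
  .loop x n .zero (.ite f (add (x + 2) (.var (x + 1)) (pow2 (x + 2) (.var x))) (.var (x + 1)))
def zeros (x : ℕ) (n : Expr) : Expr :=
  .loop x n .zero (.ite (.read false (.var x)) (.var (x + 1)) (.succ (.var (x + 1))))
-- In a sequence of blocks of ones that end with zeros, the ones with exactly j zeros before them
-- form the j-th block, counted from zero.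
def number (x : ℕ) (j : Expr) : Expr :=
  .bind x j (.loop (x + 1) (.var 0) .zero
    (.ite (and (.read false (.var (x + 1))) (eq (x + 3) (zeros (x + 3) (.var (x + 1))) (.var x)))
      (.succ (.var (x + 2))) (.var (x + 2))))

end Expr

/-! ### Values and truth values of the library expressions -/

/-- The truth value of an expression. -/
def Tr (N : ℕ) (inp mem : List Bool) (e : Expr) (ρ : ℕ → ℕ) (P : Prop) : Prop :=
  ∃ v, Ev N inp mem e ρ v ∧ (v ≠ 0 ↔ P)

/-- The number of zeros before a position. -/
def zerosBefore (l : List Bool) (p : ℕ) : ℕ := ∑ q ∈ Finset.range p, if rd l q then 0 else 1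

/-- The number of ones that have exactly `j` zeros before them. -/
def numberAt (l : List Bool) (j : ℕ) : ℕ :=
  ∑ q ∈ Finset.range l.length, if rd l q = true ∧ zerosBefore l q = j then 1 else 0

open scoped Classical in
/-- The number below `2 ^ n` with given bits. -/
noncomputable def maskOf (P : ℕ → Prop) (n : ℕ) : ℕ :=
  ∑ i ∈ Finset.range n, if P i then 2 ^ i else 0

theorem maskOf_lt (P : ℕ → Prop) (n : ℕ) : maskOf P n < 2 ^ n := by
  induction n with
  | zero => simp [maskOf]
  | succ n ih =>
    unfold maskOf at ih ⊢
    rw [Finset.sum_range_succ, pow_succ]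
    split_ifs <;> omega

open scoped Classical in
theorem testBit_maskOf (P : ℕ → Prop) (n j : ℕ) :
    (maskOf P n).testBit j = true ↔ j < n ∧ P j := by
  induction n with
  | zero => simp [maskOf]
  | succ n ih =>
    have hlt := maskOf_lt P n
    have hs : maskOf P (n + 1) = (if P n then 2 ^ n else 0) + maskOf P n := by
      unfold maskOf
      rw [Finset.sum_range_succ, add_comm]
    rw [hs]
    rcases lt_trichotomy j n with hj | rfl | hj
    · have h : ((if P n then 2 ^ n else 0) + maskOf P n).testBit j = (maskOf P n).testBit j := by
        split_ifs
        · exact Nat.testBit_two_pow_add_gt hj _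
        · rw [zero_add]
      rw [h, ih]
      simp [hj, hj.trans (Nat.lt_succ_self n)]
    · have h0 : (maskOf P j).testBit j = false := Nat.testBit_lt_two_pow hlt
      split_ifs with hP
      · simp [Nat.testBit_two_pow_add_eq, h0, hP]
      · simp [h0, hP]
    · have h : ((if P n then 2 ^ n else 0) + maskOf P n).testBit j = false := by
        refine Nat.testBit_lt_two_pow (lt_of_lt_of_le ?_ (Nat.pow_le_pow_right (by norm_num) hj))
        rw [pow_succ]
        split_ifs <;> omega
      rw [h]
      simp
      omega

section Library

variable {N : ℕ} [NeZero N] {inp mem : List Bool} {ρ : ℕ → ℕ} {x : ℕ} {a b e f n : Expr}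
  {k l m : ℕ} {P Q : Prop}

theorem one_le_bound : 1 ≤ N := Nat.one_le_iff_ne_zero.2 (NeZero.ne N)

omit [NeZero N] in
theorem Ev.val (h : Ev N inp mem e ρ k) (hk : k = l) : Ev N inp mem e ρ l := hk ▸ h

omit [NeZero N] in
theorem ev_var (h : ρ x = k) (hk : k ≤ N) : Ev N inp mem (.var x) ρ k := by
  subst h
  exact .var hk

theorem ev_one : Ev N inp mem .one ρ 1 := .succ .zero one_le_bound

omit [NeZero N] in
theorem Tr.congr (h : Tr N inp mem e ρ P) (hPQ : P ↔ Q) : Tr N inp mem e ρ Q := by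
  obtain ⟨v, hv, hP⟩ := h
  exact ⟨v, hv, hP.trans hPQ⟩

theorem tr_not (h : Tr N inp mem e ρ P) : Tr N inp mem e.not ρ (¬ P) := by
  obtain ⟨v, hv, hP⟩ := h
  by_cases h0 : v = 0
  · subst h0
    exact ⟨1, .ite_zero hv ev_one, by simpa using hP⟩
  · exact ⟨0, .ite_pos hv h0 .zero, by simpa using hP.1 h0⟩

omit [NeZero N] in
-- The second condition is evaluated only if the first one holds, so it may rely on it.
theorem tr_and (h : Tr N inp mem e ρ P) (h' : P → Tr N inp mem f ρ Q) :
    Tr N inp mem (e.and f) ρ (P ∧ Q) := by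
  obtain ⟨v, hv, hP⟩ := h
  by_cases h0 : v = 0
  · subst h0
    exact ⟨0, .ite_zero hv .zero, by simpa using fun hp => absurd rfl (hP.2 hp)⟩
  · obtain ⟨w, hw, hQ⟩ := h' (hP.1 h0)
    exact ⟨w, .ite_pos hv h0 hw, by simp [hQ, hP.1 h0]⟩

theorem tr_read {c : Bool} (h : Ev N inp mem e ρ k) :
    Tr N inp mem (.read c e) ρ (rd (bif c then mem else inp) k = true) :=
  ⟨_, .read h one_le_bound, by simp⟩

omit [NeZero N] in
theorem tr_of_ev (h : Ev N inp mem e ρ k) : Tr N inp mem e ρ (k ≠ 0) := ⟨k, h, Iff.rfl⟩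

omit [NeZero N] in
theorem ev_ite [Decidable P] (h : Tr N inp mem e ρ P) (ha : P → Ev N inp mem a ρ k)
    (hb : ¬ P → Ev N inp mem b ρ l) : Ev N inp mem (.ite e a b) ρ (if P then k else l) := by
  obtain ⟨v, hv, hP⟩ := h
  by_cases h0 : v = 0
  · subst h0
    have hP' : ¬ P := fun hp => hP.2 hp rfl
    rw [if_neg hP']
    exact .ite_zero hv (hb hP')
  · rw [if_pos (hP.1 h0)]
    exact .ite_pos hv h0 (ha (hP.1 h0))

omit [NeZero N] in
theorem ev_add (ha : Ev N inp mem a ρ k) (hb : Ev N inp mem b ρ l) (h : k + l ≤ N) :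
    Ev N inp mem (.add x a b) ρ (k + l) :=
  .loop (fun i => k + i) hb ha fun i hi => by
    have h1 : k + i + 1 ≤ N := by omega
    exact .succ (ev_var (upd_snd _ _ _ _) (Nat.le_of_succ_le h1)) h1

omit [NeZero N] in
theorem ev_mul (ha : Ev N inp mem a ρ k) (hb : ∀ i v, Ev N inp mem b (upd ρ x i v) l)
    (h : k * l ≤ N) : Ev N inp mem (.mul x a b) ρ (k * l) := by
  refine Ev.loop (fun i => i * l) ha (Ev.zero.val (zero_mul l).symm) fun i hi => ?_
  have h1 : i * l + l ≤ N := by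
    rw [← Nat.succ_mul]
    exact (Nat.mul_le_mul_right l hi).trans h
  exact (ev_add (ev_var (upd_snd _ _ _ _) (by omega)) (hb _ _) h1).val (Nat.succ_mul i l).symm

omit [NeZero N] in
theorem ev_pred (h : Ev N inp mem e ρ k) : Ev N inp mem (.pred x e) ρ (k - 1) :=
  .loop (fun i => i - 1) h .zero fun i hi =>
    ev_var (upd_fst _ _ _ _) (by have := h.le; omega)

omit [NeZero N] in
theorem ev_sub (ha : Ev N inp mem a ρ k) (hb : Ev N inp mem b ρ l) :
    Ev N inp mem (.sub x a b) ρ (k - l) :=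
  .loop (fun i => k - i) hb ha fun i _ =>
    ev_pred (ev_var (upd_snd _ _ _ _) ((Nat.sub_le k i).trans ha.le))

theorem tr_le (ha : Ev N inp mem a ρ k) (hb : Ev N inp mem b ρ l) :
    Tr N inp mem (.le x a b) ρ (k ≤ l) :=
  (tr_not (tr_of_ev (ev_sub ha hb))).congr (by omega)

theorem tr_eq (ha : Ev N inp mem a ρ k) (hb : Ev N inp mem b ρ l) :
    Tr N inp mem (.eq x a b) ρ (k = l) :=
  (tr_and (tr_le ha hb) fun _ => tr_le hb ha).congr (by omega)

theorem ev_parity (h : Ev N inp mem e ρ k) : Ev N inp mem (.parity x e) ρ (k % 2) := by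
  refine .loop (fun i => i % 2) h .zero fun i hi => ?_
  have h1 : Ev N inp mem (.var (x + 1)) (upd ρ x i (i % 2)) (i % 2) :=
    ev_var (upd_snd _ _ _ _) (by have := h.le; omega)
  refine (ev_ite (tr_of_ev h1) (fun _ => .zero) fun _ => ev_one).val ?_
  split_ifs <;> omega

theorem ev_half (h : Ev N inp mem e ρ k) : Ev N inp mem (.half x e) ρ (k / 2) := by
  have hk := h.le
  refine .loop (fun i => i / 2) h .zero fun i hi => ?_
  have h1 : Ev N inp mem (.var (x + 1)) (upd ρ x i (i / 2)) (i / 2) :=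
    ev_var (upd_snd _ _ _ _) (by omega)
  refine (ev_ite (tr_of_ev (ev_parity (ev_var (upd_fst _ _ _ _) (by omega))))
    (fun _ => .succ h1 (by omega)) fun _ => h1).val ?_
  split_ifs <;> omega

theorem tr_bit {i : Expr} (h : Ev N inp mem e ρ k) (hi : Ev N inp mem i ρ l) :
    Tr N inp mem (.bit x e i) ρ (k.testBit l = true) := by
  have h1 : Ev N inp mem (.loop x i e (.half (x + 2) (.var (x + 1)))) ρ (k / 2 ^ l) := by
    refine .loop (fun i => k / 2 ^ i) hi (h.val (by simp)) fun i _ => ?_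
    refine (ev_half (ev_var (upd_snd _ _ _ _) ((Nat.div_le_self _ _).trans h.le))).val ?_
    rw [Nat.div_div_eq_div_mul, pow_succ]
  refine (tr_of_ev (ev_parity h1)).congr ?_
  rw [Nat.testBit_eq_decide_div_mod_eq, decide_eq_true_iff]
  omega

theorem ev_pow2 (h : Ev N inp mem e ρ k) (hk : 2 ^ k ≤ N) :
    Ev N inp mem (.pow2 x e) ρ (2 ^ k) := by
  refine .loop (fun i => 2 ^ i) h ev_one fun i hi => ?_
  have h1 : 2 ^ i + 2 ^ i ≤ N := by
    rw [← two_mul, ← pow_succ']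
    exact (Nat.pow_le_pow_right (by norm_num) hi).trans hk
  have h2 : Ev N inp mem (.var (x + 1)) (upd ρ x i (2 ^ i)) (2 ^ i) :=
    ev_var (upd_snd _ _ _ _) (by omega)
  exact (ev_add h2 h2 h1).val (by rw [pow_succ, mul_two])

theorem tr_ex {p : ℕ → Prop} (hn : Ev N inp mem n ρ k)
    (hf : ∀ i < k, ∀ v, Tr N inp mem f (upd ρ x i v) (p i)) :
    Tr N inp mem (.ex x n f) ρ (∃ i < k, p i) := by
  classical
  refine ⟨if ∃ i < k, p i then 1 else 0, ?_, by simp⟩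
  refine .loop (fun j => if ∃ i < j, p i then 1 else 0) hn (Ev.zero.val (by simp)) fun i hi => ?_
  have h1 : Ev N inp mem (.var (x + 1)) (upd ρ x i (if ∃ j < i, p j then 1 else 0))
      (if ∃ j < i, p j then 1 else 0) :=
    ev_var (upd_snd _ _ _ _) (by split_ifs <;> simp [one_le_bound])
  have h2 : ∀ j < i, p j → ∃ j < i + 1, p j := fun j hj hp => ⟨j, by omega, hp⟩
  refine (ev_ite (P := ∃ j < i, p j) ((tr_of_ev h1).congr (by simp)) (fun _ => ev_one) fun _ =>
    ev_ite (hf i hi _) (fun _ => ev_one) fun _ => .zero).val ?_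
  by_cases h3 : ∃ j < i, p j
  · obtain ⟨j, hj, hp⟩ := h3
    rw [if_pos ⟨j, hj, hp⟩, if_pos (h2 j hj hp)]
  · rw [if_neg h3]
    refine if_congr ⟨fun h => ⟨i, by omega, h⟩, ?_⟩ rfl rfl
    rintro ⟨j, hj, hp⟩
    rcases Nat.lt_succ_iff_lt_or_eq.1 hj with hj | rfl
    · exact absurd ⟨j, hj, hp⟩ h3
    · exact hp

theorem tr_all {p : ℕ → Prop} (hn : Ev N inp mem n ρ k)
    (hf : ∀ i < k, ∀ v, Tr N inp mem f (upd ρ x i v) (p i)) :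
    Tr N inp mem (.all x n f) ρ (∀ i < k, p i) :=
  (tr_not (tr_ex hn fun i hi v => tr_not (hf i hi v))).congr (by push Not; rfl)

theorem ev_ofBits {p : ℕ → Prop} (hn : Ev N inp mem n ρ k)
    (hf : ∀ i < k, ∀ v, Tr N inp mem f (upd ρ x i v) (p i)) (hk : 2 ^ k ≤ N) :
    Ev N inp mem (.ofBits x n f) ρ (maskOf p k) := by
  classical
  refine .loop (maskOf p) hn (Ev.zero.val (by simp [maskOf])) fun i hi => ?_
  have h0 : 2 ^ (i + 1) ≤ N := (Nat.pow_le_pow_right (by norm_num) hi).trans hk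
  have h1 := maskOf_lt p i
  rw [pow_succ] at h0
  have h2 : Ev N inp mem (.var (x + 1)) (upd ρ x i (maskOf p i)) (maskOf p i) :=
    ev_var (upd_snd _ _ _ _) (by omega)
  have h3 : i < 2 ^ i := Nat.lt_two_pow_self
  refine (ev_ite (hf i hi _) (fun _ => ev_add h2
    (ev_pow2 (ev_var (upd_fst _ _ _ _) (by omega)) (by omega)) (by omega)) fun _ => h2).val ?_
  unfold maskOf
  rw [Finset.sum_range_succ]
  split_ifs <;> simp

theorem zerosBefore_le (l : List Bool) (p : ℕ) : zerosBefore l p ≤ p := by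
  unfold zerosBefore
  refine (Finset.sum_le_card_nsmul _ _ 1 fun q _ => ?_).trans (by simp)
  split_ifs <;> simp

theorem ev_zeros (hn : Ev N inp mem n ρ k) :
    Ev N inp mem (.zeros x n) ρ (zerosBefore inp k) := by
  have hk := hn.le
  refine .loop (zerosBefore inp) hn .zero fun i hi => ?_
  have h1 := zerosBefore_le inp i
  have h2 : Ev N inp mem (.var (x + 1)) (upd ρ x i (zerosBefore inp i)) (zerosBefore inp i) :=
    ev_var (upd_snd _ _ _ _) (by omega)
  refine (ev_ite (tr_read (c := false) (ev_var (upd_fst _ _ _ _) (by omega))) (fun _ => h2)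
    fun _ => .succ h2 (by omega)).val ?_
  unfold zerosBefore
  rw [Finset.sum_range_succ]
  simp only [cond_false]
  split_ifs <;> simp

theorem numberAt_le (l : List Bool) (j : ℕ) : numberAt l j ≤ l.length := by
  unfold numberAt
  refine (Finset.sum_le_card_nsmul _ _ 1 fun q _ => ?_).trans (by simp)
  split_ifs <;> simp

theorem ev_number {j : Expr} (hx : 0 < x) (h0 : ρ 0 = inp.length) (hN : inp.length ≤ N)
    (hj : Ev N inp mem j ρ k) : Ev N inp mem (.number x j) ρ (numberAt inp k) := by
  have hk := hj.le
  refine .bind hj ?_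
  set F : ℕ → ℕ := fun p => ∑ q ∈ Finset.range p, if rd inp q = true ∧ zerosBefore inp q = k
    then 1 else 0 with hF
  have hFle : ∀ p, F p ≤ p := fun p => by
    refine (Finset.sum_le_card_nsmul _ _ 1 fun q _ => ?_).trans (by simp)
    split_ifs <;> simp
  refine .loop F (ev_var (by simp [hx.ne, h0]) hN) .zero fun i hi => ?_
  have h1 := hFle i
  have h2 : Ev N inp mem (.var (x + 2)) (upd (Function.update ρ x k) (x + 1) i (F i)) (F i) :=
    ev_var (upd_snd _ _ _ _) (by omega)
  have h3 : Ev N inp mem (.var (x + 1)) (upd (Function.update ρ x k) (x + 1) i (F i)) i :=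
    ev_var (upd_fst _ _ _ _) (by omega)
  refine (ev_ite (tr_and (tr_read (c := false) h3) fun _ => tr_eq (ev_zeros h3)
    (ev_var (by rw [upd_of_lt _ _ _ (Nat.lt_succ_self x), Function.update_self]) hk))
    (fun _ => .succ h2 (by omega)) fun _ => h2).val ?_
  simp only [hF, Finset.sum_range_succ, cond_false]
  split_ifs <;> simp

end Library

/-! ### Lists of numbers -/

theorem rd_append_left {l l' : List Bool} {p : ℕ} (h : p < l.length) : rd (l ++ l') p = rd l p :=
  List.getD_append _ _ _ _ h

theorem rd_append_right {l l' : List Bool} (p : ℕ) : rd (l ++ l') (l.length + p) = rd l' p := by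
  rw [rd, List.getD_append_right _ _ _ _ (Nat.le_add_right _ _), Nat.add_sub_cancel_left]
  rfl

theorem rd_encodeNumber (m p : ℕ) : rd (encodeNumber m) p = decide (p < m) := by
  unfold encodeNumber
  rcases lt_or_ge p m with h | h
  · rw [rd_append_left (by simpa using h)]
    simp [rd, List.getD_eq_getElem?_getD, h]
  · obtain ⟨q, rfl⟩ := Nat.exists_eq_add_of_le h
    have := rd_append_right (l := List.replicate m true) (l' := [false]) q
    rw [List.length_replicate] at this
    rw [this]
    cases q <;> simp [rd]

theorem zerosBefore_succ (l : List Bool) (p : ℕ) :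
    zerosBefore l (p + 1) = zerosBefore l p + if rd l p then 0 else 1 := Finset.sum_range_succ _ _

theorem zerosBefore_encodeNumber (m : ℕ) (l : List Bool) {p : ℕ} (hp : p ≤ m) :
    zerosBefore (encodeNumber m ++ l) p = 0 := by
  refine Finset.sum_eq_zero fun q hq => ?_
  rw [Finset.mem_range] at hq
  rw [rd_append_left (by simp [encodeNumber]; omega), rd_encodeNumber]
  simp [hq.trans_le hp]

theorem zerosBefore_encodeNumber_add (m : ℕ) (l : List Bool) (p : ℕ) :
    zerosBefore (encodeNumber m ++ l) (m + 1 + p) = zerosBefore l p + 1 := by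
  have hl : (encodeNumber m).length = m + 1 := by simp [encodeNumber]
  induction p with
  | zero =>
    rw [add_zero, zerosBefore_succ, zerosBefore_encodeNumber m l le_rfl,
      rd_append_left (by omega), rd_encodeNumber]
    simp [zerosBefore]
  | succ p ih =>
    rw [← add_assoc, zerosBefore_succ, ih, zerosBefore_succ, ← hl, rd_append_right]
    omega

theorem zerosBefore_numbers (ns : List ℕ) :
    zerosBefore (ns.map encodeNumber).flatten (ns.map encodeNumber).flatten.length = ns.length := by
  induction ns with
  | nil => rfl
  | cons m ns ih =>
    have hl : (encodeNumber m).length = m + 1 := by simp [encodeNumber]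
    rw [List.map_cons, List.flatten_cons, List.length_append, hl, zerosBefore_encodeNumber_add, ih,
      List.length_cons]

/-- The first block contributes exactly for j = 0; behind it all counts of zeros are raised by one.
-/
theorem numberAt_numbers (ns : List ℕ) (j : ℕ) :
    numberAt (ns.map encodeNumber).flatten j = ns.getD j 0 := by
  induction ns generalizing j with
  | nil => rfl
  | cons m ns ih =>
    have hl : (encodeNumber m).length = m + 1 := by simp [encodeNumber]
    rw [List.map_cons, List.flatten_cons]
    generalize (ns.map encodeNumber).flatten = l at ih ⊢
    unfold numberAt
    rw [List.length_append, hl, Finset.sum_range_add, Finset.sum_range_succ]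
    have h1 : ∀ q ∈ Finset.range m, (if rd (encodeNumber m ++ l) q = true ∧
        zerosBefore (encodeNumber m ++ l) q = j then 1 else 0) = if j = 0 then 1 else 0 := by
      intro q hq
      rw [Finset.mem_range] at hq
      rw [rd_append_left (by omega), rd_encodeNumber, zerosBefore_encodeNumber m l hq.le]
      simp [hq, eq_comm]
    have h2 : rd (encodeNumber m ++ l) m = false := by
      rw [rd_append_left (by omega), rd_encodeNumber]
      simp
    have h3 : ∀ q, rd (encodeNumber m ++ l) (m + 1 + q) = rd l q := fun q => by
      rw [← hl, rd_append_right]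
    rw [Finset.sum_congr rfl h1, h2]
    simp only [h3, zerosBefore_encodeNumber_add]
    cases j with
    | zero => simp
    | succ j =>
      rw [List.getD_cons_succ, ← ih j]
      simp [numberAt]

/-- The numbers in the description of a problem. -/
def Description.numbers (D : Description) : List ℕ :=
  D.δ :: D.k :: (D.configs.map fun c => (c.1 : ℕ) :: List.ofFn fun i => (c.2 i : ℕ)).flatten

theorem Description.encode_eq (D : Description) :
    D.encode = (D.numbers.map encodeNumber).flatten := by
  have h : ∀ c : Fin D.k × (Fin D.δ → Fin D.k), encodeConfig c =
      (((c.1 : ℕ) :: List.ofFn fun i => (c.2 i : ℕ)).map encodeNumber).flatten := by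
    intro c
    rw [List.map_cons, List.flatten_cons, List.map_ofFn]
    rfl
  have h' : (D.configs.map encodeConfig).flatten = (((D.configs.map fun c =>
      (c.1 : ℕ) :: List.ofFn fun i => (c.2 i : ℕ)).flatten).map encodeNumber).flatten := by
    induction D.configs with
    | nil => rfl
    | cons c cs ih => simp only [List.map_cons, List.flatten_cons, List.map_append,
        List.flatten_append, ih, h]
  rw [Description.encode, h', Description.numbers, List.map_cons, List.map_cons, List.flatten_cons,
    List.flatten_cons, List.append_assoc]

theorem getD_flatten {m : ℕ} {ls : List (List ℕ)} (h : ∀ l ∈ ls, l.length = m) {c j : ℕ}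
    (hj : j < m) : ls.flatten.getD (c * m + j) 0 = (ls.getD c []).getD j 0 := by
  induction ls generalizing c with
  | nil => simp
  | cons l ls ih =>
    have hl := h l List.mem_cons_self
    rw [List.flatten_cons]
    cases c with
    | zero => rw [zero_mul, zero_add, List.getD_append _ _ _ _ (by omega), List.getD_cons_zero]
    | succ c =>
      rw [List.getD_append_right _ _ _ _ (by rw [hl, Nat.succ_mul]; omega), List.getD_cons_succ,
        ← ih fun l hl => h l (List.mem_cons_of_mem _ hl)]
      congr 1
      rw [hl, Nat.succ_mul]
      omega

section Numbers

variable (D : Description)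

theorem Description.length_numbers :
    D.numbers.length = D.configs.length * (D.δ + 1) + 2 := by
  simp [Description.numbers, List.length_flatten, List.map_map, Function.comp_def]

theorem Description.numberAt_zero : numberAt D.encode 0 = D.δ := by
  rw [D.encode_eq, numberAt_numbers]
  rfl

theorem Description.numberAt_one : numberAt D.encode 1 = D.k := by
  rw [D.encode_eq, numberAt_numbers]
  rfl

theorem Description.zerosBefore_length :
    zerosBefore D.encode D.encode.length = D.configs.length * (D.δ + 1) + 2 := by
  rw [D.encode_eq, zerosBefore_numbers, D.length_numbers]

theorem Description.numberAt_config {c j : ℕ} (hj : j < D.δ + 1) :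
    numberAt D.encode (c * (D.δ + 1) + j + 2) = ((D.configs.map fun c =>
      (c.1 : ℕ) :: List.ofFn fun i => (c.2 i : ℕ)).getD c []).getD j 0 := by
  rw [D.encode_eq, numberAt_numbers, Description.numbers, List.getD_cons_succ, List.getD_cons_succ,
    getD_flatten (fun l hl => ?_) hj]
  obtain ⟨c, -, rfl⟩ := List.mem_map.1 hl
  simp

theorem Description.numberAt_root {c : ℕ} (hc : c < D.configs.length) :
    numberAt D.encode (c * (D.δ + 1) + 2) = (D.configs[c].1 : ℕ) := by
  have := D.numberAt_config (c := c) (j := 0) (by omega)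
  rw [add_zero] at this
  rw [this]
  simp [List.getD_eq_getElem?_getD, hc]

theorem Description.numberAt_child {c : ℕ} (hc : c < D.configs.length) (i : Fin D.δ) :
    numberAt D.encode (c * (D.δ + 1) + (i + 1) + 2) = (D.configs[c].2 i : ℕ) := by
  rw [D.numberAt_config (by omega)]
  simp [List.getD_eq_getElem?_getD, hc]

theorem Description.length_bounds :
    D.δ + D.k + D.configs.length + 2 ≤ D.encode.length := by
  have h1 := zerosBefore_le D.encode D.encode.length
  have h2 : D.configs.length ≤ (D.configs.map encodeConfig).flatten.length := by
    induction D.configs with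
    | nil => simp
    | cons c cs ih =>
      simp only [List.map_cons, List.flatten_cons, List.length_append, List.length_cons]
      have : 1 ≤ (encodeConfig c).length := by simp [encodeConfig, encodeNumber]; omega
      omega
  simp only [Description.encode, List.length_append, encodeNumber, List.length_replicate,
    List.length_singleton]
  omega

end Numbers

/-! ### The search as a command -/

namespace Expr

/-- `i * n + e`, for two variables `i` and `n`. -/
def linear (x i n : ℕ) (e : Expr) : Expr := add x (mul x (.var i) (.var n)) e

/-- The number of entries before configuration `c`, plus `e`, plus two. -/
def position (x c : ℕ) (e : Expr) : Expr :=
  .succ (.succ (add x (mul x (.var c) (.succ (.var 1))) e))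

def rootOf (x c : ℕ) : Expr := number x (position x c .zero)
def childOf (x c j : ℕ) : Expr := number x (position x c (.succ (.var j)))
def isConfig (x c : ℕ) : Expr := le x (position x c (.succ (.var 1))) (.var 3)

/-- All labels of configuration `c` belong to the set `S`. -/
def configIn (x S c : ℕ) : Expr :=
  and (bit x (.var S) (rootOf x c)) (all x (.var 1) (bit (x + 2) (.var S) (childOf (x + 2) c x)))

/-- The `i`-th set of the tuple `T`. -/
def component (x T i : ℕ) : Expr :=
  ofBits x (.var 2) (bit (x + 2) (.var T) (linear (x + 2) i 2 (.var x)))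

/-- The relation `p` shows that the children of configuration `c` can be assigned to the sets of
the tuple `T`. -/
def fits (x c T p : ℕ) : Expr :=
  and (all x (.var 1) (ex (x + 2) (.var 1)
      (and (bit (x + 4) (.var p) (linear (x + 4) x 1 (.var (x + 2))))
        (bit (x + 4) (.var T) (linear (x + 4) x 2 (childOf (x + 4) c (x + 2)))))))
    (all x (.var 1) (all (x + 2) (.var 1) (all (x + 4) (.var 1)
      (not (and (not (eq (x + 6) (.var x) (.var (x + 2))))
        (and (bit (x + 6) (.var p) (linear (x + 6) x 1 (.var (x + 4))))
          (bit (x + 6) (.var p) (linear (x + 6) (x + 2) 1 (.var (x + 4))))))))))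

/-- The label `a` belongs to the new set for the tuple `T`. -/
def isNew (x S T a : ℕ) : Expr :=
  ex x (.var 0) (and (isConfig (x + 2) x) (and (eq (x + 2) (rootOf (x + 2) x) (.var a))
    (and (configIn (x + 2) S x) (ex (x + 2) (.var 6) (fits (x + 4) x T (x + 2))))))

end Expr

open RootedLCL.Expr

namespace Cmd

def reset : Cmd := .loop 8 (.var 4) (.assign (.succ (.var 8)) false)

def start : Cmd :=
  .loop 8 (.var 2) (.when (bit 9 (.var 7) (.var 8)) (.assign (.succ (pow2 9 (.var 8))) true))

/-- Unlike in a pass of the search, a set found here is available at once for later tuples. Only the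
closure matters, and it is the same. -/
def pass : Cmd :=
  .loop 9 (.var 5) (.when (all 10 (.var 1) (.read true (.succ (component 12 9 10))))
    (.bind 10 (ofBits 10 (.var 2) (isNew 12 7 9 10))
      (.when (.var 10) (.assign (.succ (.var 10)) true))))

def close : Cmd := .loop 8 (.var 4) pass

def check : Cmd :=
  .when (and (.read true (.succ (.var 7))) (ex 8 (.var 0) (and (isConfig 10 8) (configIn 10 7 8))))
    (.assign .zero true)

def searchAll : Cmd := .loop 7 (.var 4) (.seq reset (.seq start (.seq close check)))

/-- The search for a certificate builder. The variables `1` to `6` are `δ`, `k`, the number of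
numbers in the input, and the numbers of sets of labels, of tuples of sets and of relations; the
variable `7` is the set of labels to which the problem is restricted. The sets that were found are
marked in the memory, one position after their number, and its first entry is the result. -/
def search : Cmd :=
  .bind 1 (number 1 .zero) (.bind 2 (number 2 one) (.bind 3 (zeros 3 (.var 0))
    (.bind 4 (pow2 4 (.var 2)) (.bind 5 (pow2 5 (mul 5 (.var 1) (.var 2)))
      (.bind 6 (pow2 6 (mul 6 (.var 1) (.var 1))) searchAll)))))

theorem search_wf : search.wf 1 = true := by decide

end Cmd

namespace Description

variable (D : Description)

def rootAt (c : ℕ) : ℕ := numberAt D.encode (c * (D.δ + 1) + 2)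

def childAt (c j : ℕ) : ℕ := numberAt D.encode (c * (D.δ + 1) + (j + 1) + 2)

def ConfigIn (S c : ℕ) : Prop :=
  S.testBit (D.rootAt c) = true ∧ ∀ j < D.δ, S.testBit (D.childAt c j) = true

noncomputable def component (T i : ℕ) : ℕ := maskOf (fun b => T.testBit (i * D.k + b) = true) D.k

/-- A relation that is total on the positions and never uses a target twice contains an injective
map, hence a permutation. -/
def Fits (c T p : ℕ) : Prop :=
  (∀ i < D.δ, ∃ j < D.δ, p.testBit (i * D.δ + j) = true ∧
    T.testBit (i * D.k + D.childAt c j) = true) ∧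
  ∀ i < D.δ, ∀ i' < D.δ, ∀ j < D.δ, ¬ (¬ i = i' ∧ p.testBit (i * D.δ + j) = true ∧
    p.testBit (i' * D.δ + j) = true)

def IsNew (S T a : ℕ) : Prop :=
  ∃ c < D.encode.length, c < D.configs.length ∧ D.rootAt c = a ∧ D.ConfigIn S c ∧
    ∃ p < 2 ^ (D.δ * D.δ), D.Fits c T p

noncomputable def newSet (S T : ℕ) : ℕ := maskOf (D.IsNew S T) D.k

open scoped Classical in
noncomputable def stepSet (S T : ℕ) (A : Finset ℕ) : Finset ℕ :=
  if (∀ i < D.δ, D.component T i ∈ A) ∧ D.newSet S T ≠ 0 then insert (D.newSet S T) A else A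

/-- The sets found after the first `n` tuples. -/
noncomputable def passSet (S : ℕ) (A : Finset ℕ) (n : ℕ) : Finset ℕ :=
  n.rec A fun T B => D.stepSet S T B

open scoped Classical in
noncomputable def startSet (S : ℕ) : Finset ℕ :=
  ((Finset.range D.k).filter fun σ => S.testBit σ = true).image fun σ => 2 ^ σ

noncomputable def closure (S : ℕ) : Finset ℕ :=
  (fun A => D.passSet S A (2 ^ (D.δ * D.k)))^[2 ^ D.k] (D.startSet S)

def Good (S : ℕ) : Prop :=
  S ∈ D.closure S ∧ ∃ c < D.encode.length, c < D.configs.length ∧ D.ConfigIn S c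

end Description

/-- The variables that belong to a description have the right values, and `N` is large. -/
structure Ctx (N : ℕ) (D : Description) (ρ : ℕ → ℕ) : Prop where
  var0 : ρ 0 = D.encode.length
  var1 : ρ 1 = D.δ
  var2 : ρ 2 = D.k
  var3 : ρ 3 = D.configs.length * (D.δ + 1) + 2
  var4 : ρ 4 = 2 ^ D.k
  var5 : ρ 5 = 2 ^ (D.δ * D.k)
  var6 : ρ 6 = 2 ^ (D.δ * D.δ)
  le_sq : (D.encode.length + 2) ^ 2 ≤ N
  le4 : 2 ^ D.k + 1 ≤ N
  le5 : 2 ^ (D.δ * D.k) ≤ N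
  le6 : 2 ^ (D.δ * D.δ) ≤ N

theorem upd_eq {ρ : ℕ → ℕ} {x y w : ℕ} (h : ρ y = w) (hy : y < x) (i v : ℕ) :
    upd ρ x i v y = w := (upd_of_lt ρ i v hy).trans h

section Correct

variable {N : ℕ} {D : Description} {ρ : ℕ → ℕ} {mem : List Bool} {x : ℕ}

theorem Ctx.update (h : Ctx N D ρ) (hx : 7 ≤ x) (v : ℕ) : Ctx N D (Function.update ρ x v) where
  var0 := by rw [Function.update_of_ne (by omega), h.var0]
  var1 := by rw [Function.update_of_ne (by omega), h.var1]
  var2 := by rw [Function.update_of_ne (by omega), h.var2]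
  var3 := by rw [Function.update_of_ne (by omega), h.var3]
  var4 := by rw [Function.update_of_ne (by omega), h.var4]
  var5 := by rw [Function.update_of_ne (by omega), h.var5]
  var6 := by rw [Function.update_of_ne (by omega), h.var6]
  le_sq := h.le_sq
  le4 := h.le4
  le5 := h.le5
  le6 := h.le6

theorem Ctx.upd (h : Ctx N D ρ) (hx : 7 ≤ x) (i v : ℕ) : Ctx N D (upd ρ x i v) :=
  (h.update hx i).update (by omega) v

theorem Ctx.bound (h : Ctx N D ρ) {a b c : ℕ} (ha : a ≤ D.encode.length)
    (hb : b ≤ D.encode.length) (hc : c ≤ D.encode.length) : a * b + c + 4 ≤ N := by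
  have := Nat.mul_le_mul ha hb
  have := h.le_sq
  nlinarith

theorem Ctx.length_le (h : Ctx N D ρ) : D.encode.length ≤ N := by
  have := h.bound (Nat.zero_le _) (Nat.zero_le _) le_rfl
  omega

variable [NeZero N]

omit [NeZero N] in
theorem ev_linear {i n i' n' v : ℕ} {e : Expr} (hi : ρ i = i') (hn : ρ n = n') (hnx : n < x)
    (hi' : i' ≤ N) (hn' : n' ≤ N) (he : Ev N D.encode mem e ρ v) (h : i' * n' + v ≤ N) :
    Ev N D.encode mem (.linear x i n e) ρ (i' * n' + v) :=
  ev_add (ev_mul (ev_var hi hi') (fun _ _ => ev_var (upd_eq hn hnx _ _) hn') (by omega)) he h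

omit [NeZero N] in
theorem ev_position (h : Ctx N D ρ) (hx : 7 ≤ x) {c c' v : ℕ} {e : Expr} (hc : ρ c = c')
    (hc' : c' < D.encode.length) (he : Ev N D.encode mem e ρ v) (hv : v ≤ D.encode.length) :
    Ev N D.encode mem (.position x c e) ρ (c' * (D.δ + 1) + v + 2) := by
  have h1 := D.length_bounds
  have h2 := h.bound (b := D.δ + 1) hc'.le (by omega) hv
  have h3 : Ev N D.encode mem (Expr.mul x (.var c) (.succ (.var 1))) ρ (c' * (D.δ + 1)) :=
    ev_mul (ev_var hc (by have := h.length_le; omega))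
      (fun _ _ => .succ (ev_var (upd_eq h.var1 (by omega) _ _) (by have := h.length_le; omega))
        (by have := h.length_le; omega)) (by omega)
  exact .succ (.succ (ev_add h3 he (by omega)) (by omega)) (by omega)

theorem ev_rootOf (h : Ctx N D ρ) (hx : 7 ≤ x) {c c' : ℕ} (hc : ρ c = c')
    (hc' : c' < D.encode.length) : Ev N D.encode mem (.rootOf x c) ρ (D.rootAt c') :=
  ev_number (by omega) h.var0 h.length_le (ev_position h hx hc hc' .zero (Nat.zero_le _))

theorem ev_childOf (h : Ctx N D ρ) (hx : 7 ≤ x) {c c' j j' : ℕ} (hc : ρ c = c')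
    (hc' : c' < D.encode.length) (hj : ρ j = j') (hj' : j' < D.δ) :
    Ev N D.encode mem (.childOf x c j) ρ (D.childAt c' j') := by
  have h1 := D.length_bounds
  have h2 := h.length_le
  exact ev_number (by omega) h.var0 h.length_le (ev_position h hx hc hc'
    (.succ (ev_var hj (by omega)) (by omega)) (by omega))

theorem tr_isConfig (h : Ctx N D ρ) (hx : 7 ≤ x) {c c' : ℕ} (hc : ρ c = c')
    (hc' : c' < D.encode.length) :
    Tr N D.encode mem (.isConfig x c) ρ (c' < D.configs.length) := by
  have h1 := D.length_bounds
  have h2 := h.length_le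
  have h3 := h.bound (a := D.configs.length) (b := D.δ + 1) (c := 0) (by omega) (by omega) (by omega)
  refine (tr_le (ev_position h hx hc hc' (.succ (ev_var h.var1 (by omega)) (by omega)) (by omega))
    (ev_var h.var3 (by omega))).congr ?_
  rw [← Nat.succ_mul, Nat.add_le_add_iff_right]
  exact Nat.mul_le_mul_right_iff (Nat.succ_pos _)

theorem tr_configIn (h : Ctx N D ρ) (hx : 7 ≤ x) {S S' c c' : ℕ} (hS : ρ S = S') (hSx : S < x)
    (hSN : S' ≤ N) (hc : ρ c = c') (hcx : c < x) (hc' : c' < D.encode.length) :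
    Tr N D.encode mem (.configIn x S c) ρ (D.ConfigIn S' c') := by
  have h1 := D.length_bounds
  have h2 := h.length_le
  refine tr_and (tr_bit (ev_var hS hSN) (ev_rootOf h hx hc hc')) fun _ =>
    tr_all (ev_var h.var1 (by omega)) fun j hj v => ?_
  exact tr_bit (ev_var (upd_eq hS hSx _ _) hSN) (ev_childOf (h.upd hx _ _) (by omega)
    (upd_eq hc hcx _ _) hc' (upd_fst _ _ _ _) hj)

theorem ev_component (h : Ctx N D ρ) (hx : 7 ≤ x) {T T' i i' : ℕ} (hT : ρ T = T') (hTx : T < x)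
    (hTN : T' ≤ N) (hi : ρ i = i') (hix : i < x) (hi' : i' < D.δ) :
    Ev N D.encode mem (.component x T i) ρ (D.component T' i') := by
  have h1 := D.length_bounds
  have h2 := h.length_le
  refine ev_ofBits (ev_var h.var2 (by omega)) (fun b hb v => ?_) (by have := h.le4; omega)
  have h3 := h.bound (a := i') (b := D.k) (c := b) (by omega) (by omega) (by omega)
  exact tr_bit (ev_var (upd_eq hT hTx _ _) hTN) (ev_linear (upd_eq hi hix _ _)
    (upd_eq h.var2 (by omega) _ _) (by omega) (by omega) (by omega)
    (ev_var (upd_fst _ _ _ _) (by omega)) (by omega))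

theorem tr_fits (h : Ctx N D ρ) (hx : 7 ≤ x) {c c' T T' p p' : ℕ} (hc : ρ c = c') (hcx : c < x)
    (hc' : c' < D.encode.length) (hT : ρ T = T') (hTx : T < x) (hTN : T' ≤ N) (hp : ρ p = p')
    (hpx : p < x) (hpN : p' ≤ N) : Tr N D.encode mem (.fits x c T p) ρ (D.Fits c' T' p') := by
  have h1 := D.length_bounds
  have h2 := h.length_le
  refine tr_and (tr_all (ev_var h.var1 (by omega)) fun i hi v => ?_) fun _ =>
    tr_all (ev_var h.var1 (by omega)) fun i hi v => ?_
  · have hi1 := h.upd hx i v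
    refine tr_ex (ev_var hi1.var1 (by omega)) fun j hj w => ?_
    have hj1 := hi1.upd (x := x + 2) (by omega) j w
    have h3 := h.bound (a := i) (b := D.δ) (c := j) (by omega) (by omega) (by omega)
    have h4 := h.bound (a := i) (b := D.k) (c := D.childAt c' j) (by omega) (by omega)
      (numberAt_le _ _)
    have hix := upd_eq (upd_fst ρ x i v) (show x < x + 2 by omega) j w
    have up : ∀ {y w' : ℕ}, ρ y = w' → y < x → upd (upd ρ x i v) (x + 2) j w y = w' :=
      fun e hy => upd_eq (upd_eq e hy _ _) (by omega) _ _
    exact tr_and (tr_bit (ev_var (up hp hpx) hpN) (ev_linear hix hj1.var1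
      (by omega) (by omega) (by omega) (ev_var (upd_fst _ _ _ _) (by omega)) (by omega)))
      fun _ => tr_bit (ev_var (up hT hTx) hTN)
        (ev_linear hix hj1.var2 (by omega) (by omega) (by omega)
          (ev_childOf hj1 (by omega) (up hc hcx) hc' (upd_fst _ _ _ _) hj) (by omega))
  · have hi1 := h.upd hx i v
    refine tr_all (ev_var hi1.var1 (by omega)) fun i' hi' v' => ?_
    have hi2 := hi1.upd (x := x + 2) (by omega) i' v'
    refine tr_all (ev_var hi2.var1 (by omega)) fun j hj w => tr_not ?_
    have hi3 := hi2.upd (x := x + 4) (by omega) j w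
    have h3 := h.bound (a := i) (b := D.δ) (c := j) (by omega) (by omega) (by omega)
    have h4 := h.bound (a := i') (b := D.δ) (c := j) (by omega) (by omega) (by omega)
    have e1 := upd_eq (upd_eq (upd_fst ρ x i v) (show x < x + 2 by omega) i' v')
      (show x < x + 4 by omega) j w
    have e2 := upd_eq (upd_fst (upd ρ x i v) (x + 2) i' v') (show x + 2 < x + 4 by omega) j w
    have e3 := upd_fst (upd (upd ρ x i v) (x + 2) i' v') (x + 4) j w
    have e4 := upd_eq (upd_eq (upd_eq hp hpx i v) (show p < x + 2 by omega) i' v')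
      (show p < x + 4 by omega) j w
    exact tr_and (tr_not (tr_eq (ev_var e1 (by omega)) (ev_var e2 (by omega)))) fun _ =>
      tr_and (tr_bit (ev_var e4 hpN) (ev_linear e1 hi3.var1 (by omega) (by omega) (by omega)
        (ev_var e3 (by omega)) (by omega))) fun _ =>
      tr_bit (ev_var e4 hpN) (ev_linear e2 hi3.var1 (by omega) (by omega) (by omega)
        (ev_var e3 (by omega)) (by omega))

theorem tr_isNew (h : Ctx N D ρ) (hx : 7 ≤ x) {S S' T T' a a' : ℕ} (hS : ρ S = S') (hSx : S < x)
    (hSN : S' ≤ N) (hT : ρ T = T') (hTx : T < x) (hTN : T' ≤ N) (ha : ρ a = a') (hax : a < x)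
    (haN : a' ≤ N) : Tr N D.encode mem (.isNew x S T a) ρ (D.IsNew S' T' a') := by
  have h1 := D.length_bounds
  have h2 := h.length_le
  refine tr_ex (ev_var h.var0 h2) fun c hc v => ?_
  have hc1 := h.upd hx c v
  have e1 := upd_fst ρ x c v
  refine tr_and (tr_isConfig hc1 (by omega) e1 hc) fun _ =>
    tr_and (tr_eq (ev_rootOf hc1 (by omega) e1 hc) (ev_var (upd_eq ha hax _ _) haN)) fun _ =>
    tr_and (tr_configIn hc1 (by omega) (upd_eq hS hSx _ _) (by omega) hSN e1 (by omega) hc)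
      fun _ => tr_ex (ev_var hc1.var6 h.le6) fun p hp w => ?_
  exact tr_fits (hc1.upd (by omega) _ _) (by omega) (upd_eq e1 (by omega) _ _) (by omega) hc
    (upd_eq (upd_eq hT hTx _ _) (by omega) _ _) (by omega) hTN (upd_fst _ _ _ _) (by omega)
    (hp.le.trans h.le6)

omit [NeZero N] in
-- Choice turns the invariant into the sequence of memories that a run of the loop requires.
theorem run_loop {inp : List Bool} {n : Expr} {c : Cmd} {k : ℕ} (I : ℕ → List Bool → Prop)
    (hn : Ev N inp mem n ρ k)
    (h : ∀ i < k, ∀ mem, I i mem →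
      ∃ mem', Run N inp c (Function.update ρ x i) mem mem' ∧ I (i + 1) mem')
    (h0 : I 0 mem) : ∃ mem', Run N inp (.loop x n c) ρ mem mem' ∧ I k mem' := by
  have h' : ∀ i mem, ∃ mem', i < k → I i mem →
      Run N inp c (Function.update ρ x i) mem mem' ∧ I (i + 1) mem' := by
    intro i mem
    by_cases hi : i < k ∧ I i mem
    · obtain ⟨mem', hm⟩ := h i hi.1 mem hi.2
      exact ⟨mem', fun _ _ => hm⟩
    · exact ⟨mem, fun h1 h2 => absurd ⟨h1, h2⟩ hi⟩
  choose g hg using h'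
  set F : ℕ → List Bool := fun i => i.rec mem g with hF
  have hI : ∀ i ≤ k, I i (F i) := by
    intro i
    induction i with
    | zero => exact fun _ => h0
    | succ i ih => exact fun hi => (hg i (F i) hi (ih (by omega))).2
  exact ⟨F k, .loop F hn fun i hi => (hg i (F i) hi (hI i hi.le)).1, hI k le_rfl⟩

omit [NeZero N] in
theorem run_when {inp : List Bool} {e : Expr} {c : Cmd} {P : Prop} (J : List Bool → Prop)
    (he : Tr N inp mem e ρ P) (h : P → ∃ mem', Run N inp c ρ mem mem' ∧ J mem')
    (h' : ¬ P → J mem) : ∃ mem', Run N inp (.when e c) ρ mem mem' ∧ J mem' := by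
  obtain ⟨v, hv, hP⟩ := he
  by_cases h0 : v = 0
  · subst h0
    exact ⟨mem, .when_zero hv, h' fun hp => hP.2 hp rfl⟩
  · obtain ⟨mem', hr, hJ⟩ := h (hP.1 h0)
    exact ⟨mem', .when_pos hv h0 hr, hJ⟩

omit [NeZero N] in
theorem run_seq {inp : List Bool} {c c' : Cmd} {I J : List Bool → Prop}
    (h : ∃ mem', Run N inp c ρ mem mem' ∧ I mem')
    (h' : ∀ mem, I mem → ∃ mem', Run N inp c' ρ mem mem' ∧ J mem') :
    ∃ mem', Run N inp (.seq c c') ρ mem mem' ∧ J mem' := by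
  obtain ⟨mem₁, hr, hI⟩ := h
  obtain ⟨mem₂, hr', hJ⟩ := h' mem₁ hI
  exact ⟨mem₂, .seq hr hr', hJ⟩

/-- The memory marks the sets in `A` and has the first entry `b`. -/
def Marks (D : Description) (mem : List Bool) (A : Finset ℕ) (b : Bool) : Prop :=
  rd mem 0 = b ∧ ∀ r < 2 ^ D.k, rd mem (r + 1) = true ↔ r ∈ A

omit [NeZero N] in
theorem run_reset (h : Ctx N D ρ) : ∃ mem', Run N D.encode .reset ρ mem mem' ∧
    Marks D mem' ∅ (rd mem 0) := by
  have h4 := h.le4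
  refine run_loop (fun i mem' => rd mem' 0 = rd mem 0 ∧ ∀ r < i, rd mem' (r + 1) = false)
    (ev_var h.var4 (by omega)) (fun i hi mem' hm => ?_) ⟨rfl, by simp⟩ |> fun ⟨m, hr, hm⟩ =>
      ⟨m, hr, hm.1, fun r hr => by simp [hm.2 r hr]⟩
  refine ⟨_, .assign (.succ (ev_var (Function.update_self _ _ _) (by omega)) (by omega)), ?_, ?_⟩
  · rw [rd_wr, if_neg (by omega), hm.1]
  · intro r hr
    rw [rd_wr]
    split_ifs with h0
    · rfl
    · exact hm.2 r (by omega)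

theorem run_start (h : Ctx N D ρ) {S : ℕ} (hS : ρ 7 = S) (hSN : S ≤ N) {b : Bool}
    (hm : Marks D mem ∅ b) : ∃ mem', Run N D.encode .start ρ mem mem' ∧
      Marks D mem' (D.startSet S) b := by
  classical
  have h1 := D.length_bounds
  have h2 := h.length_le
  have h4 := h.le4
  refine run_loop (fun i mem' => Marks D mem'
    (((Finset.range i).filter fun σ => S.testBit σ = true).image fun σ => 2 ^ σ) b)
    (ev_var h.var2 (by omega)) (fun i hi mem' hm => ?_) (by simpa using hm) |> fun ⟨m, hr, hm⟩ =>
      ⟨m, hr, by unfold Description.startSet; convert hm⟩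
  have hi1 := h.update (x := 8) (by omega) i
  have hpow : 2 ^ i < 2 ^ D.k := Nat.pow_lt_pow_right (by norm_num) hi
  have hv : Function.update ρ 8 i 8 = i := Function.update_self _ _ _
  have hE : Ev N D.encode mem' (.var 8) (Function.update ρ 8 i) i := ev_var hv (by omega)
  refine run_when _ (tr_bit (ev_var (x := 7) (k := S) (by simp [hS]) hSN) hE)
    (fun hb => ⟨_, .assign (.succ (ev_pow2 hE (by omega)) (by omega)), ?_, ?_⟩)
    fun hb => ?_
  · rw [rd_wr, if_neg (Nat.succ_ne_zero _).symm, hm.1]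
  · intro r hr
    rw [rd_wr, Finset.range_add_one, Finset.filter_insert, if_pos hb, Finset.image_insert,
      Finset.mem_insert, ← hm.2 r hr]
    by_cases h0 : r = 2 ^ i <;> simp [h0]
  · rw [Finset.range_add_one, Finset.filter_insert, if_neg hb]
    exact hm

theorem run_pass (h : Ctx N D ρ) {S : ℕ} (hS : ρ 7 = S) (hSN : S ≤ N) {b : Bool} {A : Finset ℕ}
    (hm : Marks D mem A b) : ∃ mem', Run N D.encode .pass ρ mem mem' ∧
      Marks D mem' (D.passSet S A (2 ^ (D.δ * D.k))) b := by
  have h1 := D.length_bounds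
  have h2 := h.length_le
  have h4 := h.le4
  have h5 := h.le5
  refine run_loop (fun i mem' => Marks D mem' (D.passSet S A i) b)
    (ev_var h.var5 h5) (fun T hT mem' hm => ?_) hm
  have hT1 := h.update (x := 9) (by omega) T
  have hlt : ∀ T i, D.component T i < 2 ^ D.k := fun T i => maskOf_lt _ _
  have hnew : D.newSet S T < 2 ^ D.k := maskOf_lt _ _
  have hv : Function.update ρ 9 T 9 = T := Function.update_self _ _ _
  have hS1 : Function.update ρ 9 T 7 = S := by simp [hS]
  have hstep : D.passSet S A (T + 1) = D.stepSet S T (D.passSet S A T) := rfl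
  rw [hstep]
  unfold Description.stepSet
  refine run_when _ (tr_all (p := fun i => D.component T i ∈ D.passSet S A T)
    (ev_var hT1.var1 (by omega)) fun i hi v => ?_) (fun hall => ?_) fun hall => ?_
  · have := hlt T i
    exact (tr_read (.succ (ev_component (hT1.upd (by omega) _ _) (by omega)
      (upd_eq hv (by omega) _ _) (by omega) (by omega) (upd_fst _ _ _ _) (by omega) hi)
        (by omega))).congr (hm.2 _ this)
  · have hE : Ev N D.encode mem' (.ofBits 10 (.var 2) (.isNew 12 7 9 10)) (Function.update ρ 9 T)
        (D.newSet S T) := by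
      refine ev_ofBits (ev_var hT1.var2 (by omega)) (fun a ha v => ?_) (by omega)
      exact tr_isNew (hT1.upd (by omega) _ _) (by omega) (upd_eq hS1 (by omega) _ _) (by omega) hSN
        (upd_eq hv (by omega) _ _) (by omega) (by omega) (upd_fst _ _ _ _) (by omega) (by omega)
    have hE1 : Ev N D.encode mem' (.var 10)
        (Function.update (Function.update ρ 9 T) 10 (D.newSet S T)) (D.newSet S T) :=
      ev_var (Function.update_self _ _ _) (by omega)
    have hw : ∃ mem'', Run N D.encode (.when (.var 10) (.assign (.succ (.var 10)) true))
        (Function.update (Function.update ρ 9 T) 10 (D.newSet S T)) mem' mem'' ∧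
        Marks D mem'' (if (∀ i < D.δ, D.component T i ∈ D.passSet S A T) ∧ D.newSet S T ≠ 0
          then insert (D.newSet S T) (D.passSet S A T) else D.passSet S A T) b := by
      refine run_when _ (tr_of_ev hE1) (fun h0 => ⟨_, .assign (.succ hE1 (by omega)), ?_⟩)
        fun h0 => ?_
      · rw [if_pos ⟨hall, h0⟩]
        refine ⟨by rw [rd_wr, if_neg (Nat.succ_ne_zero _).symm, hm.1], fun r hr => ?_⟩
        rw [rd_wr, Finset.mem_insert, ← hm.2 r hr]
        by_cases h0 : r = D.newSet S T <;> simp [h0]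
      · rw [if_neg fun h => h0 h.2]
        exact hm
    obtain ⟨mem'', hr, hJ⟩ := hw
    exact ⟨mem'', .bind hE hr, by convert hJ⟩
  · rw [if_neg fun h => hall h.1]
    exact hm

theorem run_close (h : Ctx N D ρ) {S : ℕ} (hS : ρ 7 = S) (hSN : S ≤ N) {b : Bool}
    (hm : Marks D mem (D.startSet S) b) : ∃ mem', Run N D.encode .close ρ mem mem' ∧
      Marks D mem' (D.closure S) b := by
  have h4 := h.le4
  refine run_loop (fun i mem' => Marks D mem'
    ((fun A => D.passSet S A (2 ^ (D.δ * D.k)))^[i] (D.startSet S)) b)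
    (ev_var h.var4 (by omega)) (fun i hi mem' hm => ?_) hm
  rw [Function.iterate_succ_apply']
  exact run_pass (h.update (by omega) i) (by simp [hS]) hSN hm

theorem run_check (h : Ctx N D ρ) {S : ℕ} (hS : ρ 7 = S) (hSk : S < 2 ^ D.k) {b : Bool}
    (hm : Marks D mem (D.closure S) b) : ∃ mem', Run N D.encode .check ρ mem mem' ∧
      (rd mem' 0 = true ↔ b = true ∨ D.Good S) := by
  have h2 := h.length_le
  have h4 := h.le4
  refine run_when (P := D.Good S) _ (tr_and ((tr_read (.succ (ev_var hS (by omega)) (by omega))).congr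
    (hm.2 S hSk)) fun _ => tr_ex (ev_var h.var0 h2) fun c hc v => ?_)
    (fun hg => ⟨_, .assign .zero, ?_⟩) fun hg => ?_
  · have hc1 := h.upd (x := 8) (by omega) c v
    exact tr_and (tr_isConfig hc1 (by omega) (upd_fst _ _ _ _) hc) fun _ =>
      tr_configIn hc1 (by omega) (upd_eq hS (by omega) _ _) (by omega) (by omega) (upd_fst _ _ _ _)
        (by omega) hc
  · simp [rd_wr, hg]
  · simp [hm.1, hg]

theorem run_searchAll (h : Ctx N D ρ) : ∃ mem', Run N D.encode .searchAll ρ [] mem' ∧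
    (rd mem' 0 = true ↔ ∃ S < 2 ^ D.k, D.Good S) := by
  have h4 := h.le4
  refine run_loop (fun i mem' => rd mem' 0 = true ↔ ∃ S < i, D.Good S)
    (ev_var h.var4 (by omega)) (fun S hS mem' hm => ?_) (by simp [rd])
  have h1 := h.update (x := 7) le_rfl S
  have hv : Function.update ρ 7 S 7 = S := Function.update_self _ _ _
  refine run_seq (run_reset h1) fun m1 hm1 => run_seq (run_start h1 hv (by omega) hm1)
    fun m2 hm2 => run_seq (run_close h1 hv (by omega) hm2) fun m3 hm3 => ?_
  obtain ⟨m4, hr, hm4⟩ := run_check h1 hv hS hm3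
  refine ⟨m4, hr, hm4.trans ?_⟩
  rw [hm]
  constructor
  · rintro (⟨S', hS', hg⟩ | hg)
    · exact ⟨S', by omega, hg⟩
    · exact ⟨S, by omega, hg⟩
  · rintro ⟨S', hS', hg⟩
    rcases Nat.lt_succ_iff_lt_or_eq.1 hS' with h0 | rfl
    · exact Or.inl ⟨S', h0, hg⟩
    · exact Or.inr hg

theorem run_search (D : Description) {N : ℕ} [NeZero N] (hsq : (D.encode.length + 2) ^ 2 ≤ N)
    (h4 : 2 ^ D.k + 1 ≤ N) (h5 : 2 ^ (D.δ * D.k) ≤ N) (h6 : 2 ^ (D.δ * D.δ) ≤ N) :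
    ∃ mem', Run N D.encode .search (fun _ => D.encode.length) [] mem' ∧
      (rd mem' 0 = true ↔ ∃ S < 2 ^ D.k, D.Good S) := by
  have h1 := D.length_bounds
  have hlen : D.encode.length ≤ N := by nlinarith
  have h8 : D.δ * D.k ≤ N := Nat.lt_two_pow_self.le.trans h5
  have h9 : D.δ * D.δ ≤ N := Nat.lt_two_pow_self.le.trans h6
  have hctx : Ctx N D (Function.update (Function.update (Function.update (Function.update
      (Function.update (Function.update (fun _ => D.encode.length) 1 D.δ) 2 D.k) 3
        (D.configs.length * (D.δ + 1) + 2)) 4 (2 ^ D.k)) 5 (2 ^ (D.δ * D.k))) 6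
          (2 ^ (D.δ * D.δ))) :=
    { var0 := by simp
      var1 := by simp
      var2 := by simp
      var3 := by simp
      var4 := by simp
      var5 := by simp
      var6 := by simp
      le_sq := hsq
      le4 := h4
      le5 := h5
      le6 := h6 }
  obtain ⟨mem', hr, hm⟩ := run_searchAll hctx
  refine ⟨mem', .bind ?_ (.bind ?_ (.bind ?_ (.bind ?_ (.bind ?_ (.bind ?_ hr))))), hm⟩
  · exact (ev_number (by omega) rfl hlen .zero).val D.numberAt_zero
  · exact (ev_number (by omega) (by simp) hlen ev_one).val D.numberAt_one
  · exact (ev_zeros (ev_var (by simp) hlen)).val D.zerosBefore_length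
  · exact ev_pow2 (ev_var (by simp) (by omega)) (by omega)
  · exact ev_pow2 (ev_mul (ev_var (by simp) (by omega))
      (fun _ _ => ev_var (upd_eq (by simp) (by omega) _ _) (by omega)) h8) h5
  · exact ev_pow2 (ev_mul (ev_var (by simp) (by omega))
      (fun _ _ => ev_var (upd_eq (by simp) (by omega) _ _) (by omega)) h9)
      h6

end Correct

/-! ### The command finds a certificate builder if the search does -/

/-- The set of labels with a given number. -/
def labelSet {k : ℕ} (n : ℕ) : Finset (Fin k) := Finset.univ.filter fun i => n.testBit i = true

/-- The number of a set of labels. -/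
noncomputable def labelMask {k : ℕ} (s : Finset (Fin k)) : ℕ :=
  maskOf (fun i => ∃ h : i < k, ⟨i, h⟩ ∈ s) k

theorem mem_labelSet {k n : ℕ} {i : Fin k} : i ∈ labelSet n ↔ n.testBit i = true := by
  simp [labelSet]

theorem labelSet_labelMask {k : ℕ} (s : Finset (Fin k)) : labelSet (labelMask s) = s := by
  ext i
  rw [mem_labelSet, labelMask, testBit_maskOf]
  simp

theorem maskOf_eq {P : ℕ → Prop} {k n : ℕ} (hn : n < 2 ^ k)
    (h : ∀ i < k, P i ↔ n.testBit i = true) : maskOf P k = n := by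
  refine Nat.eq_of_testBit_eq fun i => Bool.eq_iff_iff.2 ?_
  rw [testBit_maskOf]
  constructor
  · exact fun hi => (h i hi.1).1 hi.2
  · intro hi
    have hik : i < k := by
      by_contra hik
      rw [Nat.testBit_lt_two_pow (hn.trans_le (Nat.pow_le_pow_right (by norm_num) (not_lt.1 hik)))]
        at hi
      cases hi
    exact ⟨hik, (h i hik).2 hi⟩

theorem labelMask_labelSet {k n : ℕ} (hn : n < 2 ^ k) :
    labelMask (labelSet n : Finset (Fin k)) = n :=
  maskOf_eq hn fun i hi => by simp [mem_labelSet, hi]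

theorem labelMask_lt {k : ℕ} (s : Finset (Fin k)) : labelMask s < 2 ^ k := maskOf_lt _ _

theorem labelMask_eq_zero {k : ℕ} {s : Finset (Fin k)} : labelMask s = 0 ↔ s = ∅ := by
  constructor
  · intro h
    rw [← labelSet_labelMask s, h]
    ext i
    simp [mem_labelSet]
  · rintro rfl
    exact maskOf_eq (by positivity) fun i hi => by simp

theorem mul_add_inj {k i i' b b' : ℕ} (hb : b < k) (hb' : b' < k) (h : i * k + b = i' * k + b') :
    i = i' ∧ b = b' := by
  have hk : 0 < k := by omega
  have h1 : (i * k + b) / k = i := by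
    rw [mul_comm, Nat.mul_add_div hk, Nat.div_eq_of_lt hb, add_zero]
  have h2 : (i' * k + b') / k = i' := by
    rw [mul_comm, Nat.mul_add_div hk, Nat.div_eq_of_lt hb', add_zero]
  have h3 : i = i' := by rw [← h1, h, h2]
  subst h3
  exact ⟨rfl, by omega⟩

/-- A relation between the numbers below `m` and those below `k`, as a number. -/
theorem exists_relation {m k : ℕ} (R : ℕ → ℕ → Prop) :
    ∃ T < 2 ^ (m * k), ∀ i < m, ∀ b < k, T.testBit (i * k + b) = true ↔ R i b := by
  refine ⟨maskOf (fun q => ∃ i b, b < k ∧ q = i * k + b ∧ R i b) (m * k), maskOf_lt _ _,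
    fun i hi b hb => ?_⟩
  rw [testBit_maskOf]
  constructor
  · rintro ⟨-, i', b', hb', h, hR⟩
    obtain ⟨rfl, rfl⟩ := mul_add_inj hb hb' h
    exact hR
  · refine fun hR => ⟨?_, i, b, hb, rfl, hR⟩
    calc i * k + b < i * k + k := by omega
      _ = (i + 1) * k := (Nat.succ_mul i k).symm
      _ ≤ m * k := Nat.mul_le_mul_right k hi

namespace Description

variable (D : Description)

/-- The restriction of the problem to the set with number `S`. -/
def restricted (S : ℕ) : LCL D.δ (Fin D.k) := D.toLCL.restrict (labelSet S)

theorem mem_labels_restricted {S : ℕ} {a : Fin D.k} :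
    a ∈ (D.restricted S).labels ↔ S.testBit a = true := by
  simp [restricted, LCL.restrict, toLCL, mem_labelSet]

theorem mem_configs_restricted {S : ℕ} {x : Fin D.k × (Fin D.δ → Fin D.k)} :
    x ∈ (D.restricted S).configs ↔
      ∃ c, ∃ h : c < D.configs.length, D.configs[c] = x ∧ D.ConfigIn S c := by
  simp only [restricted, LCL.restrict, toLCL, Finset.mem_filter, List.mem_toFinset,
    List.mem_iff_getElem, mem_labelSet]
  constructor
  · rintro ⟨⟨c, hc, rfl⟩, h1, h2⟩
    refine ⟨c, hc, rfl, ?_, fun j hj => ?_⟩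
    · rw [rootAt, D.numberAt_root hc]
      exact h1
    · rw [childAt, D.numberAt_child hc ⟨j, hj⟩]
      exact h2 _
  · rintro ⟨c, hc, rfl, h1, h2⟩
    refine ⟨⟨c, hc, rfl⟩, ?_, fun i => ?_⟩
    · rwa [rootAt, D.numberAt_root hc] at h1
    · have := h2 i i.2
      rwa [childAt, D.numberAt_child hc i] at this

/-- The order of the children is tested through relations p on the δ positions: a fitting p yields a
permutation that assigns the children of the configuration to the sets of the tuple, and the graph
of such a permutation is a fitting p. -/
theorem isNew_iff {S T : ℕ} (a : Fin D.k) : D.IsNew S T a ↔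
    a ∈ (D.restricted S).rootLabels fun i => labelSet (D.component T i) := by
  have hmem : ∀ (i : Fin D.δ) (b : Fin D.k),
      b ∈ labelSet (D.component T i) ↔ T.testBit (i * D.k + b) = true := fun i b => by
    rw [mem_labelSet, component, testBit_maskOf]
    simp
  rw [mem_rootLabels]
  constructor
  · rintro ⟨c, -, hc, hroot, hin, p, -, hfit, hinj⟩
    rw [rootAt, D.numberAt_root hc] at hroot
    have hroot' : D.configs[c].1 = a := Fin.ext hroot
    have hcc : D.configs[c] ∈ (D.restricted S).configs :=
      D.mem_configs_restricted.2 ⟨c, hc, rfl, hin⟩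
    have hf : ∀ i : Fin D.δ, ∃ j : Fin D.δ, p.testBit (i * D.δ + j) = true ∧
        T.testBit (i * D.k + D.childAt c j) = true := fun i => by
      obtain ⟨j, hj, h⟩ := hfit i i.2
      exact ⟨⟨j, hj⟩, h⟩
    choose f hf1 hf2 using hf
    have hfinj : Function.Injective f := by
      intro i i' h
      by_contra hne
      refine hinj i i.2 i' i'.2 (f i) (f i).2 ⟨fun h => hne (Fin.ext h), hf1 i, ?_⟩
      rw [h]
      exact hf1 i'
    set π := Equiv.ofBijective f (Finite.injective_iff_bijective.1 hfinj) with hπ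
    refine ⟨hroot' ▸ (D.restricted S).root_mem _ hcc, fun i => D.configs[c].2 (π i), fun i => ?_,
      π.symm, ?_⟩
    · have := hf2 i
      rw [childAt, D.numberAt_child hc] at this
      exact (hmem _ _).2 this
    · simpa [← hroot'] using hcc
  · rintro ⟨-, b, hb, σ, hσ⟩
    obtain ⟨c, hc, hcσ, hin⟩ := D.mem_configs_restricted.1 hσ
    -- The graph of the inverse permutation: `b i` stands at position `σ.symm i` of the
    -- configuration.
    obtain ⟨p, hp, hpR⟩ := exists_relation (m := D.δ) (k := D.δ)
      fun i j => ∃ i' : Fin D.δ, (i' : ℕ) = i ∧ (σ.symm i' : ℕ) = j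
    have hlen := D.length_bounds
    refine ⟨c, by omega, hc, ?_, hin, p, hp, fun i hi => ?_, ?_⟩
    · rw [rootAt, D.numberAt_root hc, hcσ]
    · refine ⟨σ.symm ⟨i, hi⟩, (σ.symm ⟨i, hi⟩).2, (hpR _ hi _ (σ.symm ⟨i, hi⟩).2).2 ⟨⟨i, hi⟩, rfl, rfl⟩, ?_⟩
      rw [childAt, D.numberAt_child hc, hcσ]
      have := (hmem _ _).1 (hb ⟨i, hi⟩)
      simpa using this
    · rintro i hi i' hi' j hj ⟨hne, h1, h2⟩
      obtain ⟨i1, rfl, e1⟩ := (hpR i hi j hj).1 h1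
      obtain ⟨i2, rfl, e2⟩ := (hpR i' hi' j hj).1 h2
      have := σ.symm.injective (Fin.ext (e1.trans e2.symm))
      exact hne (by rw [this])

theorem newSet_eq (S T : ℕ) : D.newSet S T =
    labelMask ((D.restricted S).rootLabels fun i => labelSet (D.component T i)) := by
  refine maskOf_eq (labelMask_lt _) fun i hi => ?_
  rw [D.isNew_iff ⟨i, hi⟩, ← mem_labelSet (i := (⟨i, hi⟩ : Fin D.k)), labelSet_labelMask]

theorem subset_stepSet (S T : ℕ) (A : Finset ℕ) : A ⊆ D.stepSet S T A := by
  unfold stepSet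
  split_ifs
  · exact Finset.subset_insert _ _
  · exact Finset.Subset.refl _

theorem passSet_mono (S : ℕ) (A : Finset ℕ) {m n : ℕ} (h : m ≤ n) :
    D.passSet S A m ⊆ D.passSet S A n := by
  induction h with
  | refl => exact Finset.Subset.refl _
  | step _ ih => exact ih.trans (D.subset_stepSet S _ _)

theorem subset_passSet (S : ℕ) (A : Finset ℕ) (n : ℕ) : A ⊆ D.passSet S A n :=
  D.passSet_mono S A (Nat.zero_le n)

/-- All elements of `A` are numbers of sets that can be found. -/
def Sound (S : ℕ) (A : Finset ℕ) : Prop :=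
  ∀ r ∈ A, r < 2 ^ D.k ∧ Reach (D.restricted S) (labelSet r)

theorem sound_passSet {S : ℕ} {A : Finset ℕ} (hA : D.Sound S A) (n : ℕ) :
    D.Sound S (D.passSet S A n) := by
  induction n with
  | zero => exact hA
  | succ T ih =>
    show D.Sound S (D.stepSet S T (D.passSet S A T))
    unfold stepSet
    split_ifs with h
    · intro r hr
      rcases Finset.mem_insert.1 hr with rfl | hr
      · refine ⟨maskOf_lt _ _, ?_⟩
        rw [D.newSet_eq, labelSet_labelMask]
        refine Reach.step _ (fun i => (ih _ (h.1 i i.2)).2) fun h0 => h.2 ?_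
        rw [D.newSet_eq]
        exact labelMask_eq_zero.2 h0
      · exact ih r hr
    · exact ih

theorem sound_startSet (S : ℕ) : D.Sound S (D.startSet S) := by
  classical
  intro r hr
  simp only [startSet, Finset.mem_image, Finset.mem_filter, Finset.mem_range] at hr
  obtain ⟨σ, ⟨hσ, hS⟩, rfl⟩ := hr
  refine ⟨Nat.pow_lt_pow_right (by norm_num) hσ, ?_⟩
  have : (labelSet (2 ^ σ) : Finset (Fin D.k)) = {⟨σ, hσ⟩} := by
    ext i
    rw [mem_labelSet, Finset.mem_singleton, Nat.testBit_two_pow, decide_eq_true_iff, Fin.ext_iff,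
      eq_comm]
  rw [this]
  exact .single _ (D.mem_labels_restricted.2 hS)

theorem sound_iterate (S n : ℕ) :
    D.Sound S ((fun A => D.passSet S A (2 ^ (D.δ * D.k)))^[n] (D.startSet S)) := by
  induction n with
  | zero => exact D.sound_startSet S
  | succ n ih =>
    rw [Function.iterate_succ_apply']
    exact D.sound_passSet ih _

/-- There are only 2 ^ k sets of labels, so 2 ^ k passes end in a fixed point. A derivation step
corresponds to some number T of a tuple, and a pass from the fixed point processes T. -/
theorem labelMask_mem_closure {S : ℕ} {s : Finset (Fin D.k)} (h : Reach (D.restricted S) s) :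
    labelMask s ∈ D.closure S := by
  classical
  have hfix : D.passSet S (D.closure S) (2 ^ (D.δ * D.k)) = D.closure S :=
    iterate_card_fixed (fun A => D.passSet S A (2 ^ (D.δ * D.k)))
      (fun A => D.subset_passSet S A _) (D.startSet S) (Finset.range (2 ^ D.k))
      (fun n r hr => Finset.mem_range.2 (D.sound_iterate S n r hr).1) (Finset.card_range _).le
  induction h with
  | single σ h =>
    refine subset_iterate (fun A => D.passSet S A (2 ^ (D.δ * D.k)))
      (fun A => D.subset_passSet S A _) _ _ ?_
    have : labelMask ({σ} : Finset (Fin D.k)) = 2 ^ (σ : ℕ) :=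
      maskOf_eq (Nat.pow_lt_pow_right (by norm_num) σ.2) fun i hi => by
        simp [Fin.ext_iff, hi, Nat.testBit_two_pow, eq_comm]
    rw [this]
    exact Finset.mem_image.2 ⟨σ, Finset.mem_filter.2 ⟨Finset.mem_range.2 σ.2,
      D.mem_labels_restricted.1 h⟩, rfl⟩
  | step r hr h ih =>
    obtain ⟨T, hT, hTR⟩ := exists_relation (m := D.δ) (k := D.k)
      fun i b => ∃ (hi : i < D.δ) (hb : b < D.k), (⟨b, hb⟩ : Fin D.k) ∈ r ⟨i, hi⟩
    have hcomp : ∀ i : Fin D.δ, D.component T i = labelMask (r i) := by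
      intro i
      refine maskOf_eq (labelMask_lt _) fun b hb => ?_
      rw [hTR i i.2 b hb, ← mem_labelSet (i := (⟨b, hb⟩ : Fin D.k)), labelSet_labelMask]
      simp [hb]
    have hnew : D.newSet S T = labelMask ((D.restricted S).rootLabels r) := by
      rw [D.newSet_eq]
      simp only [hcomp, labelSet_labelMask]
    rw [← hfix]
    -- When T is processed all its components are present, and nothing is removed later in the pass.
    refine D.passSet_mono S _ (Nat.succ_le_of_lt hT) ?_
    show _ ∈ D.stepSet S T (D.passSet S (D.closure S) T)
    unfold stepSet
    rw [if_pos, hnew]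
    · exact Finset.mem_insert_self _ _
    · refine ⟨fun i hi => D.subset_passSet S _ _ ?_, ?_⟩
      · rw [hcomp ⟨i, hi⟩]
        exact ih ⟨i, hi⟩
      · rw [hnew]
        exact fun h0 => h (labelMask_eq_zero.1 h0)

theorem good_iff {S : ℕ} (hS : S < 2 ^ D.k) : D.Good S ↔
    Reach (D.restricted S) (labelSet S) ∧ (D.restricted S).configs.Nonempty := by
  refine and_congr ⟨fun h => (D.sound_iterate S _ S h).2, fun h => ?_⟩ ?_
  · have := D.labelMask_mem_closure h
    rwa [labelMask_labelSet hS] at this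
  · constructor
    · rintro ⟨c, -, hc, hin⟩
      exact ⟨_, D.mem_configs_restricted.2 ⟨c, hc, rfl, hin⟩⟩
    · rintro ⟨x, hx⟩
      obtain ⟨c, hc, -, hin⟩ := D.mem_configs_restricted.1 hx
      exact ⟨c, by have := D.length_bounds; omega, hc, hin⟩

theorem exists_good_iff :
    (∃ S < 2 ^ D.k, D.Good S) ↔ D.toLCL.findCertificate.isSome = true := by
  rw [findCertificate_isSome_iff]
  constructor
  · rintro ⟨S, hS, hg⟩
    exact ⟨labelSet S, Finset.subset_univ _, (D.good_iff hS).1 hg⟩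
  · rintro ⟨s, -, hs⟩
    refine ⟨labelMask s, labelMask_lt s, (D.good_iff (labelMask_lt s)).2 ?_⟩
    rwa [restricted, labelSet_labelMask]

end Description

/-- For a description of length ℓ, the bound N = 2 ^ ((ℓ + 2) ^ 2) exceeds all numbers that occur:
the numbers of label sets, of δ-tuples of them and of relations on the δ positions, and the
positions in the input. -/
theorem exists_machine_search : ∃ (p : Polynomial ℕ)
    (M : Turing.TM2ComputableInTime Description.encode Computability.encodeBool
      (fun D : Description => D.toLCL.findCertificate.isSome)), ∀ n, M.time n ≤ 2 ^ p.eval n := by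
  refine exists_machine Cmd.search Cmd.search_wf ((Polynomial.X + 2) ^ 2) fun D => ?_
  have hq : ((Polynomial.X + 2) ^ 2 : Polynomial ℕ).eval D.encode.length =
      (D.encode.length + 2) ^ 2 := by simp
  rw [hq]
  have h1 := D.length_bounds
  have hsq : (D.encode.length + 2) ^ 2 < 2 ^ (D.encode.length + 2) ^ 2 := Nat.lt_two_pow_self
  have : NeZero (2 ^ (D.encode.length + 2) ^ 2) := ⟨by positivity⟩
  refine ⟨le_trans (by nlinarith) hsq.le, ?_⟩
  have h4 : 2 ^ D.k + 1 ≤ 2 ^ (D.encode.length + 2) ^ 2 := by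
    calc 2 ^ D.k + 1 ≤ 2 ^ D.k + 2 ^ D.k := Nat.add_le_add_left Nat.one_le_two_pow _
      _ = 2 ^ (D.k + 1) := by rw [pow_succ, mul_two]
      _ ≤ _ := Nat.pow_le_pow_right (by norm_num) (by nlinarith)
  have h5 : 2 ^ (D.δ * D.k) ≤ 2 ^ (D.encode.length + 2) ^ 2 :=
    Nat.pow_le_pow_right (by norm_num) (by
      rw [sq]
      exact Nat.mul_le_mul (by omega) (by omega))
  have h6 : 2 ^ (D.δ * D.δ) ≤ 2 ^ (D.encode.length + 2) ^ 2 :=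
    Nat.pow_le_pow_right (by norm_num) (by
      rw [sq]
      exact Nat.mul_le_mul (by omega) (by omega))
  obtain ⟨mem, hr, hm⟩ := run_search D hsq.le h4 h5 h6
  exact ⟨mem, hr, Bool.eq_iff_iff.2 (hm.trans D.exists_good_iff)⟩

end RootedLCL

theorem mainTheorem6 :
    (∃ (p : Polynomial ℕ)
        (M : Turing.TM2ComputableInTime RootedLCL.Description.encode Computability.encodeBool
          (fun D : RootedLCL.Description => D.toLCL.findCertificate.isSome)),
        ∀ n, M.time n ≤ 2 ^ p.eval n) ∧
      ∀ (D : RootedLCL.Description) (cm : RootedLCL.Communication) (rm : RootedLCL.Randomness)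
        (c : ℕ), 1 ≤ c →
        (D.toLCL.findCertificate.isSome = true ↔
          D.toLCL.ComplexityO cm rm c (fun n => (RootedLCL.logStar n : ℝ))) ∧
        (D.toLCL.findCertificate.isSome = false ↔
          D.toLCL.ComplexityOmega cm rm c (fun n => Real.log n)) := by
  refine ⟨RootedLCL.exists_machine_search, fun D cm rm c hc => ?_⟩
  have hO := fun h => RootedLCL.complexityO_of_isSome D.toLCL h cm rm c
  have hΩ := fun h => RootedLCL.complexityOmega_of_isNone (P := D.toLCL) D.δ_pos rfl h cm rm hc
  -- The two classes exclude each other, so each of the two implications also yields the converse of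
  -- the other.
  have hne := fun h h' =>
    RootedLCL.not_complexityO_and_complexityOmega (P := D.toLCL) (cm := cm) (rm := rm) (c := c)
      D.δ_pos h h'
  cases hf : D.toLCL.findCertificate.isSome with
  | true => exact ⟨by simpa using hO hf, by simpa using fun h => hne (hO hf) h⟩
  | false => exact ⟨by simpa using fun h => hne h (hΩ hf), by simpa using hΩ hf⟩
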